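/- Let $A>0$, $\gamma>0$. Consider the focusing nonlocal Lakshmanan–Porsezian–Daniel equation $$q_t+\tfrac i2 q_{xx}-iq^2r-\gamma H[q]=0,\qquad r(x,t)=-\overline{q(-x,t)},$$ $$H[q]=-iq_{xxxx}+6irq_x^2+4iqq_xr_x+8irqq_{xx}+2iq^2r_{xx}-6ir^2q^3,$$ for $x\in\mathbb R$, $t>0$, with $q(x,0)=q_0(x)$ and $q(x,t)\to0$ as $x\to-\infty$, $q(x,t)\to A$ as $x\to+\infty$. Let $q_0$ be continuous, $q_0\to0$ at $-\infty$, $q_0\to A$ at $+\infty$, and $\int_{\mathbb R}(1+|x|)\,|q_0(x)-A\mathbf 1_{x>0}|\,dx<\infty$. *Scattering data.* For $\xi\in\mathbb C$ let $\phi_\pm^{(j)}(x,\xi)\in\mathbb C^2$ be the Jost solutions of $$\phi_x=\begin{pmatrix}-i\xi&q_0(x)\\-\overline{q_0(-x)}&i\xi\end{pmatrix}\phi$$ determined by $e^{i\xi x}\phi_-^{(1)}\to(1,\tfrac A{2i\xi})^T$ ($\operatorname{Im}\xi\ge0$, $\xi\ne0$) and $e^{-i\xi x}\phi_-^{(2)}\to(0,1)^T$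 ($\operatorname{Im}\xi\le0$) as $x\to-\infty$, and by $e^{i\xi x}\phi_+^{(1)}\to(1,0)^T$ ($\operatorname{Im}\xi\le0$) and $e^{-i\xi x}\phi_+^{(2)}\to(\tfrac A{2i\xi},1)^T$ ($\operatorname{Im}\xi\ge0$, $\xi\ne0$) as $x\to+\infty$. Put $a_1=\det(\phi_-^{(1)},\phi_+^{(2)})$, $a_2=\det(\phi_+^{(1)},\phi_-^{(2)})$, $b=\det(\phi_-^{(2)},\phi_+^{(2)})$ (the last on $\mathbb R\setminus\{0\}$). *Case 2* means: in $\{\operatorname{Im}\xi\ge0\}\setminus\{0\}$ the function $a_1$ has exactly one zero $i\xi_1$, $\xi_1>0$, and it is simple; in $\{\operatorname{Im}\xi\le0\}$ the function $a_2$ has exactly one zero, $\xi=0$; the derivative $\dot a_2(0)$ exists and is nonzero, and the limit $a_{11}=\lim_{\xi\to0}\xi a_1(\xi)$ exists and is nonzero. *RH problem at $(x,t)$.* With $\theta=\xi x-(\xi^2-8\gamma\xi^4)t$ and the constant $r_1$ defined by $\phi_-^{(1)}(\cdot,i\xi_1)=r_1\phi_+^{(2)}(\cdot,i\xi_1)$,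 find a $2\times2$ matrix $M(\xi)$, analytic in $\mathbb C\setminus\mathbb R$ except for a possible simple pole of its first column at $i\xi_1$, such that: (i) boundary values $M_\pm$ from above and below exist at every point of $\mathbb R\setminus\{0\}$ and satisfy $$M_+=M_-\begin{pmatrix}1+\frac{b(\xi)\overline{b(-\xi)}}{a_1(\xi)a_2(\xi)}&-\frac{b(\xi)}{a_2(\xi)}e^{-2i\theta}\\-\frac{\overline{b(-\xi)}}{a_1(\xi)}e^{2i\theta}&1\end{pmatrix};$$ (ii) $M=I+O(1/\xi)$ as $\xi\to\infty$; (iii) $\operatorname{Res}_{\xi=i\xi_1}[M]_1=\frac{r_1}{\dot a_1(i\xi_1)}e^{-2\xi_1x+2i\xi_1^2t+16i\xi_1^4\gamma t}[M(i\xi_1)]_2$; (iv) for some functions $f_1,f_2:\mathbb R\to\mathbb C$, $$M=\left[\begin{pmatrix}\frac{f_1(x)}{a_{11}}&-\overline{f_2(-x)}\\\frac{f_2(x)}{a_{11}}&-\overline{f_1(-x)}\end{pmatrix}+O(\xi)\right]\begin{pmatrix}1&0\\0&\frac1\xi\end{pmatrix}\ (\xi\to0,\ \operatorname{Im}\xi>0),$$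 $$M=\left[\frac{2i}A\begin{pmatrix}-\overline{f_2(-x)}&\frac{f_1(x)}{\dot a_2(0)}\\-\overline{f_1(-x)}&\frac{f_2(x)}{\dot a_2(0)}\end{pmatrix}+O(\xi)\right]\begin{pmatrix}1&0\\0&\frac1\xi\end{pmatrix}\ (\xi\to0,\ \operatorname{Im}\xi<0).$$ **Proposition.** Suppose that $q_0$ is in Case 2 and that $b(\xi)=0$ for all $\xi\in\mathbb R\setminus\{0\}$. Then $\xi_1=\frac A2$, and $r_1=e^{i\alpha}$ for some $\alpha\in\mathbb R$. Put $$D(x,t)=1-e^{-Ax+\frac i2A^2t+iA^4\gamma t+i\alpha},\qquad q_\alpha(x,t)=\frac A{D(x,t)},\qquad F(x,t)=\frac A{2i\,D(x,t)}.$$ 1. For all $x\in\mathbb R$, $t\ge0$ with $D(x,t)\neq0$ the RH problem has exactly one solution, namely $$M(x,t,\xi)=\begin{pmatrix}\frac{\xi+F(x,t)}{\xi-\frac{iA}2}&\frac{F(x,t)}\xi\\\frac{-\overline{F(-x,t)}}{\xi-\frac{iA}2}&\frac{\xi-\overline{F(-x,t)}}\xi\end{pmatrix},$$ and $2i\lim_{\xi\to\infty}\xi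 M_{12}(x,t,\xi)=q_\alpha(x,t)$. 2. The exact solution of the initial boundary value problem is $q_\alpha$: one has $D(x,0)\ne0$ and $q_\alpha(x,0)=q_0(x)$ for all $x$; $q_\alpha$ is smooth and satisfies the equation at every point $(x,t)$, $t>0$, with $D(x,t)\ne0$; for every $t\ge0$, $q_\alpha(x,t)\to0$ as $x\to-\infty$ and $q_\alpha(x,t)\to A$ as $x\to+\infty$. Conversely, let $q$ be a classical solution on $\mathbb R\times[0,T)$ with $q(\cdot,0)=q_0$, in the following sense: $\partial_x^kq$, $k\le4$, exist and are continuous on $\mathbb R\times[0,T)$; $q$ is differentiable in $t$ and satisfies the equation for $0<t<T$; $\int(1+|x|)|q(x,t)-A\mathbf 1_{x>0}|\,dx<\infty$ for every $t\in[0,T)$; and $q\to0$ ($x\to-\infty$), $q\to A$ ($x\to+\infty$), $\partial_x^kq\to0$ ($x\to\pm\infty$, $k=1,2,3$), uniformly on $[0,T']$ for every $T'<T$. Then $D\neq0$ and $q=q_\alpha$ on $\mathbb R\times[0,T)$. -/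

import Mathlib

open Filter Topology Asymptotics MeasureTheory

namespace NonlocalLPD

noncomputable section

/-! ### The nonlocal Lakshmanan-Porsezian-Daniel equation -/

/-- The nonlocal partner `r(x,t) = -conj q(-x,t)` (focusing case) of a field `q`. -/
def partner (q : ℝ → ℝ → ℂ) (x t : ℝ) : ℂ := -(starRingEnd ℂ) (q (-x) t)

/-- The `k`-th spatial derivative of a field. -/
def dx (k : ℕ) (q : ℝ → ℝ → ℂ) (x t : ℝ) : ℂ := iteratedDeriv k (fun y => q y t) x

/-- The higher order term `H[q]` of the equation. -/
def higherTerm (q : ℝ → ℝ → ℂ) (x t : ℝ) : ℂ :=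
  -Complex.I * dx 4 q x t
    + 6 * Complex.I * partner q x t * dx 1 q x t ^ 2
    + 4 * Complex.I * q x t * dx 1 q x t * dx 1 (partner q) x t
    + 8 * Complex.I * partner q x t * q x t * dx 2 q x t
    + 2 * Complex.I * q x t ^ 2 * dx 2 (partner q) x t
    - 6 * Complex.I * partner q x t ^ 2 * q x t ^ 3

/-- The equation `q_t + (i/2) q_xx - i q² r - γ H[q] = 0` at the point `(x,t)`. -/
def SatisfiesLPDAt (γ : ℝ) (q : ℝ → ℝ → ℂ) (x t : ℝ) : Prop :=
  deriv (fun s => q x s) t + (1 / 2) * Complex.I * dx 2 q x t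
    - Complex.I * q x t ^ 2 * partner q x t - (γ : ℂ) * higherTerm q x t = 0

/-- The pure step: `0` on the left, `A` on the right. -/
def step (A x : ℝ) : ℂ := if 0 < x then (A : ℂ) else 0

/-- A function that approaches the pure step in the weighted space `L¹((1+|x|)dx)`. -/
def WeightedClose (A : ℝ) (u : ℝ → ℂ) : Prop :=
  Integrable (fun x : ℝ => (1 + |x|) * ‖u x - step A x‖)

/-- Step-like initial data. -/
structure StepLike (A : ℝ) (u : ℝ → ℂ) : Prop where
  continuous : Continuous u
  left : Tendsto u atBot (𝓝 0)
  right : Tendsto u atTop (𝓝 (A : ℂ))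
  close : WeightedClose A u

/-- `q` is a classical solution on `ℝ × [0,T)` of the initial value problem with data `q₀` and with
the boundary conditions `q → 0` (`x → -∞`), `q → A` (`x → +∞`). -/
structure IsClassicalSolution (A γ T : ℝ) (q₀ : ℝ → ℂ) (q : ℝ → ℝ → ℂ) : Prop where
  initial : ∀ x, q x 0 = q₀ x
  contDiff : ∀ t ∈ Set.Ico 0 T, ContDiff ℝ 4 (fun x => q x t)
  continuousOn : ∀ k ≤ 4,
    ContinuousOn (fun p : ℝ × ℝ => dx k q p.1 p.2) (Set.univ ×ˢ Set.Ico 0 T)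
  differentiableAt : ∀ t ∈ Set.Ioo 0 T, ∀ x, DifferentiableAt ℝ (fun s => q x s) t
  equation : ∀ t ∈ Set.Ioo 0 T, ∀ x, SatisfiesLPDAt γ q x t
  close : ∀ t ∈ Set.Ico 0 T, WeightedClose A (fun x => q x t)
  left : ∀ T' < T, TendstoUniformlyOn q (fun _ => 0) atBot (Set.Icc 0 T')
  right : ∀ T' < T, TendstoUniformlyOn q (fun _ => (A : ℂ)) atTop (Set.Icc 0 T')
  left_dx : ∀ k : ℕ, 1 ≤ k → k ≤ 3 → ∀ T' < T,
    TendstoUniformlyOn (dx k q) (fun _ => 0) atBot (Set.Icc 0 T')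
  right_dx : ∀ k : ℕ, 1 ≤ k → k ≤ 3 → ∀ T' < T,
    TendstoUniformlyOn (dx k q) (fun _ => 0) atTop (Set.Icc 0 T')

/-! ### Jost solutions and scattering data of the initial datum -/

/-- The matrix `-iξσ₃ + Q` of the `x`-part of the Lax pair at the initial time. -/
def laxX (q₀ : ℝ → ℂ) (ξ : ℂ) (x : ℝ) : Matrix (Fin 2) (Fin 2) ℂ :=
  !![-Complex.I * ξ, q₀ x; -(starRingEnd ℂ) (q₀ (-x)), Complex.I * ξ]

/-- `v` solves `v' = (-iξσ₃ + Q) v` on the whole line. -/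
def SolvesLaxX (q₀ : ℝ → ℂ) (ξ : ℂ) (v : ℝ → Fin 2 → ℂ) : Prop :=
  ∀ x, HasDerivAt v ((laxX q₀ ξ x).mulVec (v x)) x

/-- First column of the Jost solution `φ₋`, for `Im ξ ≥ 0`, `ξ ≠ 0`: the solution with
`e^{iξx} φ → (1, A/(2iξ))` as `x → -∞`. -/
def IsJostMinus₁ (A : ℝ) (q₀ : ℝ → ℂ) (ξ : ℂ) (v : ℝ → Fin 2 → ℂ) : Prop :=
  SolvesLaxX q₀ ξ v ∧
    Tendsto (fun x : ℝ => Complex.exp (Complex.I * ξ * x) • v x) atBot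
      (𝓝 ![1, (A : ℂ) / (2 * Complex.I * ξ)])

/-- Second column of the Jost solution `φ₋`, for `Im ξ ≤ 0`: the solution with
`e^{-iξx} φ → (0, 1)` as `x → -∞`. -/
def IsJostMinus₂ (q₀ : ℝ → ℂ) (ξ : ℂ) (v : ℝ → Fin 2 → ℂ) : Prop :=
  SolvesLaxX q₀ ξ v ∧
    Tendsto (fun x : ℝ => Complex.exp (-(Complex.I * ξ * x)) • v x) atBot (𝓝 ![0, 1])

/-- First column of the Jost solution `φ₊`, for `Im ξ ≤ 0`: the solution with
`e^{iξx} φ → (1, 0)` as `x → +∞`. -/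
def IsJostPlus₁ (q₀ : ℝ → ℂ) (ξ : ℂ) (v : ℝ → Fin 2 → ℂ) : Prop :=
  SolvesLaxX q₀ ξ v ∧
    Tendsto (fun x : ℝ => Complex.exp (Complex.I * ξ * x) • v x) atTop (𝓝 ![1, 0])

/-- Second column of the Jost solution `φ₊`, for `Im ξ ≥ 0`, `ξ ≠ 0`: the solution with
`e^{-iξx} φ → (A/(2iξ), 1)` as `x → +∞`. -/
def IsJostPlus₂ (A : ℝ) (q₀ : ℝ → ℂ) (ξ : ℂ) (v : ℝ → Fin 2 → ℂ) : Prop :=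
  SolvesLaxX q₀ ξ v ∧
    Tendsto (fun x : ℝ => Complex.exp (-(Complex.I * ξ * x)) • v x) atTop
      (𝓝 ![(A : ℂ) / (2 * Complex.I * ξ), 1])

/-- The Jost column `φ₋⁽¹⁾(·, ξ)`. -/
def jostMinus₁ (A : ℝ) (q₀ : ℝ → ℂ) (ξ : ℂ) : ℝ → Fin 2 → ℂ :=
  Classical.epsilon (IsJostMinus₁ A q₀ ξ)

/-- The Jost column `φ₋⁽²⁾(·, ξ)`. -/
def jostMinus₂ (q₀ : ℝ → ℂ) (ξ : ℂ) : ℝ → Fin 2 → ℂ :=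
  Classical.epsilon (IsJostMinus₂ q₀ ξ)

/-- The Jost column `φ₊⁽¹⁾(·, ξ)`. -/
def jostPlus₁ (q₀ : ℝ → ℂ) (ξ : ℂ) : ℝ → Fin 2 → ℂ :=
  Classical.epsilon (IsJostPlus₁ q₀ ξ)

/-- The Jost column `φ₊⁽²⁾(·, ξ)`. -/
def jostPlus₂ (A : ℝ) (q₀ : ℝ → ℂ) (ξ : ℂ) : ℝ → Fin 2 → ℂ :=
  Classical.epsilon (IsJostPlus₂ A q₀ ξ)

/-- The Wronskian `det (v, w)`. -/
def wr (v w : Fin 2 → ℂ) : ℂ := v 0 * w 1 - v 1 * w 0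

/-- The spectral function `a₁ = s₁₁`, on the closed upper half-plane without `0`. -/
def a₁ (A : ℝ) (q₀ : ℝ → ℂ) (ξ : ℂ) : ℂ := wr (jostMinus₁ A q₀ ξ 0) (jostPlus₂ A q₀ ξ 0)

/-- The spectral function `a₂ = s₂₂`, on the closed lower half-plane. -/
def a₂ (q₀ : ℝ → ℂ) (ξ : ℂ) : ℂ := wr (jostPlus₁ q₀ ξ 0) (jostMinus₂ q₀ ξ 0)

/-- The spectral function `b = s₁₂` on `ℝ \ {0}`, i.e. the coefficient of `φ₊⁽¹⁾` in
`φ₋⁽²⁾ = b φ₊⁽¹⁾ + a₂ φ₊⁽²⁾`. -/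
def b (A : ℝ) (q₀ : ℝ → ℂ) (s : ℝ) : ℂ := wr (jostMinus₂ q₀ s 0) (jostPlus₂ A q₀ s 0)

/-- Case 2: in the closed upper half-plane without `0` the function `a₁` vanishes exactly at `iξ₁`,
`ξ₁ > 0`, and this zero is simple; in the closed lower half-plane `a₂` vanishes exactly at `0`;
`d₂ = a₂'(0) ≠ 0` and `a₁₁ = lim_{ξ → 0} ξ a₁(ξ) ≠ 0`. -/
structure Case2 (A : ℝ) (q₀ : ℝ → ℂ) (ξ₁ : ℝ) (a₁₁ d₂ : ℂ) : Prop where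
  pos : 0 < ξ₁
  zero_a₁ : ∀ ξ : ℂ, 0 ≤ ξ.im → ξ ≠ 0 → (a₁ A q₀ ξ = 0 ↔ ξ = Complex.I * ξ₁)
  simple_a₁ : deriv (a₁ A q₀) (Complex.I * ξ₁) ≠ 0
  zero_a₂ : ∀ ξ : ℂ, ξ.im ≤ 0 → (a₂ q₀ ξ = 0 ↔ ξ = 0)
  deriv_a₂ : HasDerivWithinAt (a₂ q₀) d₂ {ξ : ℂ | ξ.im ≤ 0} 0
  deriv_a₂_ne : d₂ ≠ 0
  lim_a₁ : Tendsto (fun ξ : ℂ => ξ * a₁ A q₀ ξ) (𝓝[{ξ : ℂ | 0 ≤ ξ.im ∧ ξ ≠ 0}] 0) (𝓝 a₁₁)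
  lim_a₁_ne : a₁₁ ≠ 0

/-- `r₁` is the norming constant at `iξ₁`: `φ₋⁽¹⁾(·, iξ₁) = r₁ φ₊⁽²⁾(·, iξ₁)`. -/
def IsNorming (A : ℝ) (q₀ : ℝ → ℂ) (ξ₁ : ℝ) (r₁ : ℂ) : Prop :=
  ∀ x, jostMinus₁ A q₀ (Complex.I * ξ₁) x = r₁ • jostPlus₂ A q₀ (Complex.I * ξ₁) x

/-! ### The Riemann-Hilbert problem -/

/-- The phase `θ = ξx - (ξ² - 8γξ⁴)t`. -/
def theta (γ x t : ℝ) (ξ : ℂ) : ℂ := ξ * x - (ξ ^ 2 - 8 * ξ ^ 4 * γ) * t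

/-- The jump matrix `J(x,t,s)`, `s ∈ ℝ \ {0}`. -/
def jump (A γ : ℝ) (q₀ : ℝ → ℂ) (x t s : ℝ) : Matrix (Fin 2) (Fin 2) ℂ :=
  !![1 + b A q₀ s * (starRingEnd ℂ) (b A q₀ (-s)) / (a₁ A q₀ s * a₂ q₀ s),
      -(b A q₀ s / a₂ q₀ s) * Complex.exp (-(2 * Complex.I * theta γ x t s));
    -((starRingEnd ℂ) (b A q₀ (-s)) / a₁ A q₀ s) * Complex.exp (2 * Complex.I * theta γ x t s),
      1]

/-- `M` solves, at the point `(x,t)`, the Riemann-Hilbert problem built from the spectral functions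
of `q₀` in Case 2. Only the values of `M` off the real axis and (in the first column) off `iξ₁` are
relevant. The square integrability of `M - I` on `ℝ \ [-ε,ε]` follows from the existence of the
boundary values at every nonzero real point together with the normalization. -/
structure IsRHSolution (A γ : ℝ) (q₀ : ℝ → ℂ) (ξ₁ : ℝ) (a₁₁ d₂ r₁ : ℂ) (x t : ℝ)
    (M : ℂ → Matrix (Fin 2) (Fin 2) ℂ) : Prop where
  /-- the first column is analytic off the real axis and the point `iξ₁` -/
  analytic₁ : ∀ i, DifferentiableOn ℂ (fun ξ => M ξ i 0)
    {ξ : ℂ | ξ.im ≠ 0 ∧ ξ ≠ Complex.I * ξ₁}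
  /-- the second column is analytic off the real axis -/
  analytic₂ : ∀ i, DifferentiableOn ℂ (fun ξ => M ξ i 1) {ξ : ℂ | ξ.im ≠ 0}
  /-- jump condition -/
  jump_cond : ∃ Mp Mm : ℝ → Matrix (Fin 2) (Fin 2) ℂ, ∀ s : ℝ, s ≠ 0 →
    Tendsto M (𝓝[{ξ : ℂ | 0 < ξ.im}] (s : ℂ)) (𝓝 (Mp s)) ∧
    Tendsto M (𝓝[{ξ : ℂ | ξ.im < 0}] (s : ℂ)) (𝓝 (Mm s)) ∧
    Mp s = Mm s * jump A γ q₀ x t s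
  /-- normalization `M = I + O(1/ξ)` at infinity -/
  normalization : ∀ i j, (fun ξ => M ξ i j - (1 : Matrix (Fin 2) (Fin 2) ℂ) i j)
    =O[cocompact ℂ ⊓ 𝓟 {ξ : ℂ | ξ.im ≠ 0}] fun ξ => ξ⁻¹
  /-- residue condition at `iξ₁` -/
  residue : ∀ i, Tendsto (fun ξ => (ξ - Complex.I * ξ₁) * M ξ i 0) (𝓝[≠] (Complex.I * ξ₁))
    (𝓝 (r₁ / deriv (a₁ A q₀) (Complex.I * ξ₁)
      * Complex.exp (-2 * ξ₁ * x + 2 * Complex.I * ξ₁ ^ 2 * t + 16 * Complex.I * ξ₁ ^ 4 * γ * t)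
      * M (Complex.I * ξ₁) i 1))
  /-- singularity conditions at `0`, with unknown functions `f₁ = f 0`, `f₂ = f 1`:
  `M₊ = ((f₁/a₁₁, -conj f₂(-x)), (f₂/a₁₁, -conj f₁(-x)) + O(ξ)) diag(1, 1/ξ)` and
  `M₋ = (2i/A) ((-conj f₂(-x), f₁/d₂), (-conj f₁(-x), f₂/d₂) + O(ξ)) diag(1, 1/ξ)` -/
  singularity : ∃ f : Fin 2 → ℝ → ℂ, ∀ i,
    ((fun ξ => M ξ i 0 - f i x / a₁₁)
      =O[𝓝[{ξ : ℂ | 0 < ξ.im}] 0] fun ξ => ξ) ∧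
    ((fun ξ => ξ * M ξ i 1 - -(starRingEnd ℂ) (f (1 - i) (-x)))
      =O[𝓝[{ξ : ℂ | 0 < ξ.im}] 0] fun ξ => ξ) ∧
    ((fun ξ => M ξ i 0 - 2 * Complex.I / A * -(starRingEnd ℂ) (f (1 - i) (-x)))
      =O[𝓝[{ξ : ℂ | ξ.im < 0}] 0] fun ξ => ξ) ∧
    ((fun ξ => ξ * M ξ i 1 - 2 * Complex.I / A * (f i x / d₂))
      =O[𝓝[{ξ : ℂ | ξ.im < 0}] 0] fun ξ => ξ)

/-! ### The explicit solution -/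

/-- The denominator `1 - exp(-Ax + (i/2)A²t + iA⁴γt + iα)`. -/
def den (A γ α x t : ℝ) : ℂ :=
  1 - Complex.exp (-A * x + Complex.I / 2 * A ^ 2 * t + Complex.I * A ^ 4 * γ * t + Complex.I * α)

/-- The one-soliton `A / (1 - exp(-Ax + (i/2)A²t + iA⁴γt + iα))`. -/
def soliton (A γ α x t : ℝ) : ℂ := A / den A γ α x t

/-- The function `f₁(x,t) = (A/2i) / (1 - exp(-Ax + (i/2)A²t + iA⁴γt + iα))`. -/
def solF (A γ α x t : ℝ) : ℂ := A / (2 * Complex.I) / den A γ α x t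

/-- The explicit solution of the Riemann-Hilbert problem. -/
def solM (A γ α x t : ℝ) (ξ : ℂ) : Matrix (Fin 2) (Fin 2) ℂ :=
  !![(ξ + solF A γ α x t) / (ξ - Complex.I * A / 2), solF A γ α x t / ξ;
    -(starRingEnd ℂ) (solF A γ α (-x) t) / (ξ - Complex.I * A / 2),
      (ξ - (starRingEnd ℂ) (solF A γ α (-x) t)) / ξ]

end

end NonlocalLPD

/-!
Why the theorem is true. Write `u = q₀` and `r(x) = -conj u(-x)`.

*Inverse scattering.* The Jost solutions are built from Volterra equations on half-lines
(`HalfPlaneKernel.exists_solution`, `StepLike.exists_jost`). This makes `φ₊⁽²⁾` and `φ₋⁽²⁾ / a₂`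
analytic in the open upper and lower half-plane, continuous up to `ℝ \ {0}`, with explicit limits at
infinity. The vanishing of `b` says that the two agree on `ℝ \ {0}`, and since the only zero of `a₂`
is a simple one at `0`, they glue to a function with at most a simple pole at `0`. By Liouville's
theorem (`eq_affine_of_glue`), `e^{-iξx} φ₊⁽²⁾ = (c₁/ξ, 1 + c₂/ξ)` with functions `c₁`, `c₂` of `x`
alone (`StepLike.exists_rational_jostPlus₂`). Comparing powers of `ξ` in the scattering problem gives
`u = 2i c₁`, `c₁' = 2i c₁ c₂` and `c₂' = r c₁`, a nonlocal system that is reduced to a Riccati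
equation by the first integrals `conj c₂(-x) - c₂(x)` and
`c₁(x) conj c₁(-x) - c₂(x)² - iκ₀ c₂(x)`; the limits of `u` at `±∞` leave only
`u = A / (1 - κ e^{-Ax})` with `|κ| = 1` (`StepLike.exists_eq_profile`).

*Scattering data.* Such a profile satisfies `u' = u (A - u)` and `r = u - A`, and all of its Jost
solutions are explicit: `a₁ = (ξ - iA/2)/ξ`, `a₂ = ξ/(ξ - iA/2)`, and the norming constant is `κ`.
This fixes `ξ₁ = A/2`, `a₁₁`, `d₂` and `r₁ = κ = e^{iα}` (`IsProfile.isNorming`,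
`Case2.data_of_isProfile`).

*Riemann-Hilbert problem.* The jump matrix is the identity, so `ξ M_{i2}` and `(ξ - iA/2) M_{i1}` are
affine in `ξ` (`eq_affine_of_no_jump`). The conditions at `0` and the residue condition then form a
linear system with determinant `D`, which the explicit matrix solves (`isRHSolution_solM`,
`eq_solM_of_isRHSolution`).

*The equation.* Near a regular point the soliton satisfies `q_x = q (A - q)`, `r = q - A` and
`q_t = i (A/2 + A³γ) q r`, so the equation becomes a polynomial identity in `q`
(`satisfiesLPDAt_soliton`).

*Uniqueness.* For a classical solution `q` the Lax pair `ψ_x = Uψ`, `ψ_t = Vψ` is compatible. The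
solution of the `x`-part with values on `x = 0` evolving by `V` solves the `t`-part at every `x`
(`hasDerivAt_time_wr`), and as `x → ±∞` Gronwall's inequality compares the `t`-part with its limit,
whose eigenvalues are `±(iξ² - 8iγξ⁴)` (`tendsto_of_uniform_limit`). Hence `a₂` does not depend on
time, `b` stays zero, and the norming constant gets the factor `e^{i(A²/2 + A⁴γ)t}`. So
`StepLike.exists_eq_profile` applies to `q(·, t)` at every time, and the norming constant identifies
the profile as the soliton (`IsClassicalSolution.profile_eq`).
-/

namespace NonlocalLPD

/-! ### Linear systems of two equations -/

/-- Entrywise `ℓ¹` size of a matrix; it bounds the operator norm for the sup norm on vectors. -/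
noncomputable def matSize (U : Matrix (Fin 2) (Fin 2) ℂ) : ℝ := ∑ i, ∑ j, ‖U i j‖

theorem matSize_nonneg (U : Matrix (Fin 2) (Fin 2) ℂ) : 0 ≤ matSize U := by
  unfold matSize; positivity

theorem norm_mulVec_le (U : Matrix (Fin 2) (Fin 2) ℂ) (v : Fin 2 → ℂ) :
    ‖U.mulVec v‖ ≤ matSize U * ‖v‖ := by
  refine (pi_norm_le_iff_of_nonneg (mul_nonneg (matSize_nonneg U) (norm_nonneg _))).2 fun i => ?_
  calc ‖U.mulVec v i‖ = ‖∑ j, U i j * v j‖ := rfl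
    _ ≤ ∑ j, ‖U i j‖ * ‖v‖ := by
        refine (norm_sum_le _ _).trans (Finset.sum_le_sum fun j _ => ?_)
        rw [norm_mul]
        exact mul_le_mul_of_nonneg_left (norm_le_pi_norm v j) (norm_nonneg _)
    _ = (∑ j, ‖U i j‖) * ‖v‖ := (Finset.sum_mul ..).symm
    _ ≤ matSize U * ‖v‖ := by
        refine mul_le_mul_of_nonneg_right ?_ (norm_nonneg _)
        exact Finset.single_le_sum (f := fun i => ∑ j, ‖U i j‖)
          (fun i _ => Finset.sum_nonneg fun j _ => norm_nonneg _) (Finset.mem_univ i)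

theorem continuous_matSize : Continuous matSize := by
  unfold matSize
  refine continuous_finsetSum _ fun i _ => continuous_finsetSum _ fun j _ => ?_
  exact (continuous_id.matrix_elem i j).norm

section Picard

variable {X : Type*}

/-- The terms of the Picard series of `v' = U v`, `v(0) = c`, with a parameter. -/
noncomputable def picardTerm (U : X → ℝ → Matrix (Fin 2) (Fin 2) ℂ) (c : X → Fin 2 → ℂ) :
    ℕ → X → ℝ → Fin 2 → ℂ
  | 0, s, _ => c s
  | k + 1, s, x => ∫ y in (0 : ℝ)..x, (U s y).mulVec (picardTerm U c k s y)

variable {U : X → ℝ → Matrix (Fin 2) (Fin 2) ℂ} {c : X → Fin 2 → ℂ}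

theorem continuous_picardTerm [TopologicalSpace X] [FirstCountableTopology X]
    [LocallyCompactSpace X]
    (hU : Continuous fun p : X × ℝ => U p.1 p.2) (hc : Continuous c)
    (k : ℕ) : Continuous fun p : X × ℝ => picardTerm U c k p.1 p.2 := by
  induction k with
  | zero => exact hc.comp continuous_fst
  | succ k ih =>
    have : Continuous (Function.uncurry fun s y => (U s y).mulVec (picardTerm U c k s y)) :=
      Continuous.matrix_mulVec hU ih
    exact intervalIntegral.continuous_parametric_primitive_of_continuous this


/-- The factorial bound that makes the Picard series converge locally uniformly. -/
theorem norm_picardTerm_le {s : X} {M B R : ℝ} (hM : ∀ y ∈ Set.Icc (-R) R, matSize (U s y) ≤ M)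
    (hB : ‖c s‖ ≤ B) (hM0 : 0 ≤ M) (k : ℕ) :
    ∀ x ∈ Set.Icc (-R) R, ‖picardTerm U c k s x‖ ≤ B * ((M * |x|) ^ k / k.factorial) := by
  induction k with
  | zero => intro x _; simpa [picardTerm] using hB
  | succ k ih =>
    intro x hx
    have hB0 : 0 ≤ B := (norm_nonneg _).trans hB
    have hbd : ∀ y ∈ Set.uIoc 0 x, ‖(U s y).mulVec (picardTerm U c k s y)‖
        ≤ M * (B * ((M * |y|) ^ k / k.factorial)) := by
      intro y hy
      have hy' : y ∈ Set.Icc (-R) R := by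
        rcases le_total 0 x with h | h
        · rw [Set.uIoc_of_le h] at hy; exact ⟨by linarith [hy.1, hx.2, hy.2], hy.2.trans hx.2⟩
        · rw [Set.uIoc_of_ge h] at hy; exact ⟨by linarith [hy.1, hx.1], by linarith [hy.2, hx.1]⟩
      refine (norm_mulVec_le _ _).trans ?_
      exact mul_le_mul (hM y hy') (ih y hy') (norm_nonneg _) hM0
    have hcont : Continuous fun y : ℝ => M * (B * ((M * |y|) ^ k / k.factorial)) := by fun_prop
    have hval : ∀ x : ℝ, 0 ≤ x → ∫ y in (0 : ℝ)..x, M * (B * ((M * |y|) ^ k / k.factorial))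
        = B * ((M * x) ^ (k + 1) / (k + 1).factorial) := by
      intro x hx
      have : ∫ y in (0 : ℝ)..x, M * (B * ((M * |y|) ^ k / k.factorial))
          = ∫ y in (0 : ℝ)..x, (B * M ^ (k + 1) / k.factorial) * y ^ k := by
        refine intervalIntegral.integral_congr fun y hy => ?_
        rw [Set.uIcc_of_le hx] at hy
        simp only [abs_of_nonneg hy.1]
        ring
      rw [this, intervalIntegral.integral_const_mul, integral_pow, Nat.factorial_succ]
      push_cast
      have : (k.factorial : ℝ) ≠ 0 := by positivity
      field_simp
      rw [mul_pow]
      simp [mul_assoc]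
    rcases le_total 0 x with h | h
    · refine (intervalIntegral.norm_integral_le_of_norm_le h (ae_of_all _ fun y hy => ?_)
        (hcont.intervalIntegrable _ _)).trans ?_
      · exact hbd y (by rwa [Set.uIoc_of_le h])
      · rw [hval x h, abs_of_nonneg h]
    · show ‖∫ y in (0 : ℝ)..x, _‖ ≤ _
      rw [intervalIntegral.integral_symm, norm_neg]
      refine (intervalIntegral.norm_integral_le_of_norm_le h (ae_of_all _ fun y hy => ?_)
        (hcont.intervalIntegrable _ _)).trans ?_
      · exact hbd y (by rwa [Set.uIoc_of_ge h])
      · have := intervalIntegral.integral_comp_neg (a := 0) (b := -x)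
          (fun y : ℝ => M * (B * ((M * |y|) ^ k / k.factorial)))
        simp only [abs_neg, neg_neg, neg_zero] at this
        rw [← this, hval (-x) (by linarith), abs_of_nonpos h]

/-- A linear system with coefficients depending continuously on a parameter has a global solution
that is jointly continuous in the variable and the parameter. -/
theorem exists_linear_ode_solution [TopologicalSpace X] [FirstCountableTopology X]
    [LocallyCompactSpace X]
    (hU : Continuous fun p : X × ℝ => U p.1 p.2)
    (hc : Continuous c) : ∃ ψ : X → ℝ → Fin 2 → ℂ, (Continuous fun p : X × ℝ => ψ p.1 p.2) ∧
      (∀ s, ψ s 0 = c s) ∧ ∀ s x, HasDerivAt (ψ s) ((U s x).mulVec (ψ s x)) x := by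
  have hbound : ∀ K : Set X, IsCompact K → ∀ R : ℝ, ∃ u : ℕ → ℝ, Summable u ∧
      (∀ k, ∀ s ∈ K, ∀ x ∈ Set.Icc (-R) R, ‖picardTerm U c k s x‖ ≤ u k) ∧
      ∃ M, 0 ≤ M ∧ ∀ s ∈ K, ∀ x ∈ Set.Icc (-R) R, matSize (U s x) ≤ M := by
    intro K hK R
    obtain ⟨M, hM⟩ := (hK.prod (isCompact_Icc (a := -R) (b := R))).bddAbove_image
      (continuous_matSize.comp hU).continuousOn
    obtain ⟨B, hB⟩ := hK.bddAbove_image (hc.norm).continuousOn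
    have hM' : ∀ s ∈ K, ∀ x ∈ Set.Icc (-R) R, matSize (U s x) ≤ max M 0 := fun s hs x hx =>
      (hM ⟨(s, x), ⟨hs, hx⟩, rfl⟩).trans (le_max_left _ _)
    refine ⟨fun k => max B 0 * ((max M 0 * |R|) ^ k / k.factorial),
      (Real.summable_pow_div_factorial _).mul_left _, fun k s hs x hx => ?_,
      max M 0, le_max_right _ _, hM'⟩
    refine (norm_picardTerm_le (hM' s hs) ((hB ⟨s, hs, rfl⟩).trans (le_max_left _ 0))
      (le_max_right _ _) k x hx).trans ?_
    have : |x| ≤ |R| := (abs_le.2 hx).trans (le_abs_self R)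
    have h1 : (max M 0 * |x|) ^ k ≤ (max M 0 * |R|) ^ k :=
      pow_le_pow_left₀ (by positivity) (by gcongr) k
    exact mul_le_mul_of_nonneg_left (div_le_div_of_nonneg_right h1 (by positivity))
      (le_max_right _ _)
  have hsummable : ∀ s x, Summable fun k => picardTerm U c k s x := by
    intro s x
    obtain ⟨u, hu, hle, -⟩ := hbound {s} isCompact_singleton |x|
    exact Summable.of_norm_bounded hu fun k => hle k s rfl x
      ⟨neg_abs_le x, le_abs_self x⟩
  refine ⟨fun s x => ∑' k, picardTerm U c k s x, ?_, ?_, ?_⟩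
  · rw [continuous_iff_continuousAt]
    rintro ⟨s, x⟩
    obtain ⟨K, hK, hKs⟩ := exists_compact_mem_nhds s
    obtain ⟨u, hu, hle, -⟩ := hbound K hK (|x| + 1)
    have hon : ContinuousOn (fun p : X × ℝ => ∑' k, picardTerm U c k p.1 p.2)
        (K ×ˢ Set.Icc (-(|x| + 1)) (|x| + 1)) :=
      continuousOn_tsum (fun k => (continuous_picardTerm hU hc k).continuousOn) hu
        fun k p hp => hle k p.1 hp.1 p.2 hp.2
    refine hon.continuousAt (prod_mem_nhds hKs (Icc_mem_nhds ?_ ?_))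
    · linarith [neg_abs_le x]
    · linarith [le_abs_self x]
  · intro s
    show ∑' k, picardTerm U c k s 0 = c s
    rw [tsum_eq_single 0]
    · rfl
    · intro k hk
      obtain ⟨k, rfl⟩ := Nat.exists_eq_succ_of_ne_zero hk
      simp [picardTerm]
  · intro s x
    obtain ⟨u, hu, hle, M, hM0, hM⟩ := hbound {s} isCompact_singleton (|x| + 1)
    have hUs : Continuous fun y => U s y := hU.comp (Continuous.prodMk_right s)
    have hts : ∀ k, Continuous fun y => picardTerm U c k s y := fun k =>
      (continuous_picardTerm hU hc k).comp (Continuous.prodMk_right s)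
    have hx1 : x ∈ Set.Ioo (-(|x| + 1)) (|x| + 1) :=
      ⟨by linarith [neg_abs_le x], by linarith [le_abs_self x]⟩
    set f' : ℕ → ℝ → Fin 2 → ℂ := fun k y =>
      Nat.casesOn k 0 (fun j => (U s y).mulVec (picardTerm U c j s y)) with hf'
    have key := hasDerivAt_tsum_of_isPreconnected (𝕜 := ℝ) (g := fun k y => picardTerm U c k s y)
      (g' := f') (u := fun k => Nat.casesOn k 0 (fun j => M * u j))
      (t := Set.Ioo (-(|x| + 1)) (|x| + 1)) (y₀ := x) (y := x)
      ((summable_nat_add_iff 1).1 (by simpa using hu.mul_left M)) isOpen_Ioo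
      isPreconnected_Ioo ?_ ?_ hx1 (hsummable s x) hx1
    · have hsum : Summable fun k => f' k x := by
        refine (summable_nat_add_iff 1).1 ?_
        refine Summable.of_norm_bounded (hu.mul_left M) fun k => ?_
        exact (norm_mulVec_le _ _).trans (mul_le_mul (hM s rfl x (Set.Ioo_subset_Icc_self hx1))
          (hle k s rfl x (Set.Ioo_subset_Icc_self hx1)) (norm_nonneg _) hM0)
      have hval : ∑' k, f' k x = (U s x).mulVec (∑' k, picardTerm U c k s x) := by
        rw [hsum.tsum_eq_zero_add]
        have := ContinuousLinearMap.map_tsum (Matrix.mulVecLin (U s x)).toContinuousLinearMap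
          (hsummable s x)
        simp only [LinearMap.coe_toContinuousLinearMap', Matrix.mulVecLin_apply] at this
        rw [this]
        simp [hf']
      rw [hval] at key
      exact key
    · rintro (_ | k) y hy
      · exact hasDerivAt_const y (c s)
      · exact ((hUs.matrix_mulVec (hts k)).integral_hasStrictDerivAt 0 y).hasDerivAt
    · rintro (_ | k) y hy
      · simp [hf']
      · exact (norm_mulVec_le _ _).trans (mul_le_mul (hM s rfl y (Set.Ioo_subset_Icc_self hy))
          (hle k s rfl y (Set.Ioo_subset_Icc_self hy)) (norm_nonneg _) hM0)

end Picard

/-- A linear system with continuous coefficients has a global solution with prescribed value at a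
prescribed point. -/
theorem exists_linear_ode_solution_at {U : ℝ → Matrix (Fin 2) (Fin 2) ℂ} (hU : Continuous U)
    (x₀ : ℝ) (c : Fin 2 → ℂ) : ∃ ψ : ℝ → Fin 2 → ℂ, ψ x₀ = c ∧
      ∀ x, HasDerivAt ψ ((U x).mulVec (ψ x)) x := by
  obtain ⟨ψ, -, h0, hd⟩ := exists_linear_ode_solution (X := Unit) (U := fun _ y => U (y + x₀))
    (c := fun _ => c) (by fun_prop) continuous_const
  refine ⟨fun x => ψ () (x - x₀), by simp [h0], fun x => ?_⟩
  have := (hd () (x - x₀)).comp_sub_const x x₀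
  simpa using this

/-- The derivative of a Wronskian of solutions of two linear systems. -/
theorem hasDerivAt_wr {v w : ℝ → Fin 2 → ℂ} {v' w' : Fin 2 → ℂ} {x : ℝ}
    (hv : HasDerivAt v v' x) (hw : HasDerivAt w w' x) :
    HasDerivAt (fun y => wr (v y) (w y)) (wr v' (w x) + wr (v x) w') x := by
  have hv := hasDerivAt_pi.1 hv
  have hw := hasDerivAt_pi.1 hw
  refine (((hv 0).mul (hw 1)).sub ((hv 1).mul (hw 0))).congr_deriv ?_
  unfold wr
  ring

theorem wr_mulVec (U : Matrix (Fin 2) (Fin 2) ℂ) (v w : Fin 2 → ℂ) :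
    wr (U.mulVec v) w + wr v (U.mulVec w) = (U 0 0 + U 1 1) * wr v w := by
  simp [wr, Matrix.mulVec, dotProduct, Fin.sum_univ_two]; ring

/-- The Wronskian of two solutions of a trace-free system is constant. -/
theorem wr_eq_of_hasDerivAt {U : ℝ → Matrix (Fin 2) (Fin 2) ℂ} (htr : ∀ x, U x 0 0 + U x 1 1 = 0)
    {v w : ℝ → Fin 2 → ℂ} (hv : ∀ x, HasDerivAt v ((U x).mulVec (v x)) x)
    (hw : ∀ x, HasDerivAt w ((U x).mulVec (w x)) x) (x y : ℝ) :
    wr (v x) (w x) = wr (v y) (w y) := by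
  have hd : ∀ x, HasDerivAt (fun y => wr (v y) (w y)) 0 x := fun x => by
    have := hasDerivAt_wr (hv x) (hw x)
    rwa [wr_mulVec, htr, zero_mul] at this
  exact is_const_of_deriv_eq_zero (fun x => (hd x).differentiableAt) (fun x => (hd x).deriv) x y

theorem wr_smul_left (c : ℂ) (v w : Fin 2 → ℂ) : wr (c • v) w = c * wr v w := by
  simp only [wr, Pi.smul_apply, smul_eq_mul]; ring

theorem wr_smul_right (c : ℂ) (v w : Fin 2 → ℂ) : wr v (c • w) = c * wr v w := by
  simp only [wr, Pi.smul_apply, smul_eq_mul]; ring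

theorem tendsto_wr {α : Type*} {l : Filter α} {v w : α → Fin 2 → ℂ} {v₀ w₀ : Fin 2 → ℂ}
    (hv : Tendsto v l (𝓝 v₀)) (hw : Tendsto w l (𝓝 w₀)) :
    Tendsto (fun x => wr (v x) (w x)) l (𝓝 (wr v₀ w₀)) := by
  have hv := tendsto_pi_nhds.1 hv
  have hw := tendsto_pi_nhds.1 hw
  exact ((hv 0).mul (hw 1)).sub ((hv 1).mul (hw 0))

/-- A vector whose Wronskian with a nonzero vector vanishes is a multiple of it. -/
theorem exists_eq_smul_of_wr_eq_zero {v w : Fin 2 → ℂ} (hw : w ≠ 0) (h : wr v w = 0) :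
    ∃ c : ℂ, v = c • w := by
  have h : v 0 * w 1 - v 1 * w 0 = 0 := h
  by_cases h0 : w 0 = 0
  · have h1 : w 1 ≠ 0 := fun h1 => hw (by ext i; fin_cases i <;> simp [h0, h1])
    refine ⟨v 1 / w 1, ?_⟩
    rw [h0] at h
    have : v 0 = 0 := by simpa [h1] using h
    ext i; fin_cases i <;> simp [h0, this, h1]
  · refine ⟨v 0 / w 0, ?_⟩
    ext i; fin_cases i
    · simp [h0]
    · simp only [Fin.mk_one, Pi.smul_apply, smul_eq_mul]
      field_simp
      linear_combination -h

/-- Two solutions of a trace-free system that agree at one point agree everywhere. -/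
theorem linear_ode_unique {U : ℝ → Matrix (Fin 2) (Fin 2) ℂ} (hU : Continuous U)
    (htr : ∀ x, U x 0 0 + U x 1 1 = 0) {v w : ℝ → Fin 2 → ℂ}
    (hv : ∀ x, HasDerivAt v ((U x).mulVec (v x)) x)
    (hw : ∀ x, HasDerivAt w ((U x).mulVec (w x)) x) {x₀ : ℝ} (h : v x₀ = w x₀) : v = w := by
  have hd : ∀ x, HasDerivAt (v - w) ((U x).mulVec ((v - w) x)) x := fun x => by
    have := (hv x).sub (hw x)
    rwa [← Matrix.mulVec_sub] at this
  funext x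
  have hwr : ∀ c : Fin 2 → ℂ, wr (v x - w x) c = 0 := by
    intro c
    obtain ⟨χ, hχ, hχd⟩ := exists_linear_ode_solution_at hU x c
    have := wr_eq_of_hasDerivAt htr hd hχd x x₀
    rw [hχ] at this
    simpa [h, wr] using this
  have h0 := hwr ![0, 1]
  have h1 := hwr ![1, 0]
  simp [wr, sub_eq_zero] at h0 h1
  ext i; fin_cases i
  · exact h0
  · exact h1.symm

/-! ### Integrals depending on a parameter -/

/-- A dominated integral of functions that are holomorphic in a parameter is holomorphic. -/
theorem differentiableOn_integral_of_dominated {α : Type*} [MeasurableSpace α] {μ : Measure α}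
    {F : ℂ → α → ℂ} {U : Set ℂ} (hU : IsOpen U) {bound : α → ℝ}
    (hmeas : ∀ ξ ∈ U, AEStronglyMeasurable (F ξ) μ)
    (hb : ∀ᵐ a ∂μ, ∀ ξ ∈ U, ‖F ξ a‖ ≤ bound a) (hbi : Integrable bound μ)
    (hd : ∀ᵐ a ∂μ, DifferentiableOn ℂ (F · a) U) :
    DifferentiableOn ℂ (fun ξ => ∫ a, F ξ a ∂μ) U := by
  intro ξ₀ hξ₀
  obtain ⟨ε, hε, hball⟩ := Metric.isOpen_iff.1 hU ξ₀ hξ₀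
  set R := ε / 2 with hR
  have hR0 : 0 < R := by positivity
  have hsub : ∀ ξ ∈ Metric.ball ξ₀ R, Metric.closedBall ξ (R / 2) ⊆ U := fun ξ hξ w hw => by
    refine hball ?_
    rw [Metric.mem_ball] at hξ ⊢
    have := Metric.mem_closedBall.1 hw
    linarith [dist_triangle w ξ ξ₀]
  have hR' : 0 < R / 2 := by positivity
  have hmemU : ∀ ξ ∈ Metric.ball ξ₀ R, ξ ∈ U := fun ξ hξ =>
    hsub ξ hξ (Metric.mem_closedBall_self hR'.le)
  -- the derivative is measurable in the integration variable as a limit of difference quotients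
  have hmeas' : AEStronglyMeasurable (fun a => deriv (F · a) ξ₀) μ := by
    obtain ⟨v, hv⟩ : ∃ v : ℕ → ℂ, ∀ n, v n = (R / 2 : ℝ) / ((n : ℂ) + 1) := ⟨_, fun _ => rfl⟩
    have hv0 : ∀ n, v n ≠ 0 := fun n => by
      rw [hv]
      exact div_ne_zero (by exact_mod_cast hR'.ne') (Nat.cast_add_one_ne_zero n)
    have hvlim : Tendsto v atTop (𝓝 0) := by
      have := (tendsto_one_div_add_atTop_nhds_zero_nat (𝕜 := ℂ)).const_mul ((R / 2 : ℝ) : ℂ)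
      simp only [mul_zero] at this
      refine this.congr fun n => ?_
      rw [hv]; ring
    have hvU : ∀ n, ξ₀ + v n ∈ U := fun n => by
      refine hsub ξ₀ (Metric.mem_ball_self hR0) ?_
      rw [Metric.mem_closedBall, dist_eq_norm, add_sub_cancel_left, hv, norm_div,
        Complex.norm_real, Real.norm_of_nonneg hR'.le]
      have : (1 : ℝ) ≤ ‖(n : ℂ) + 1‖ := by
        have : ((n : ℂ) + 1) = ((n + 1 : ℝ) : ℂ) := by push_cast; rfl
        rw [this, Complex.norm_real, Real.norm_of_nonneg (by positivity)]
        linarith [Nat.cast_nonneg (α := ℝ) n]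
      exact div_le_self hR'.le this
    refine aestronglyMeasurable_of_tendsto_ae atTop
      (f := fun n a => (v n)⁻¹ * (F (ξ₀ + v n) a - F ξ₀ a)) (fun n => ?_) ?_
    · exact ((hmeas _ (hvU n)).sub (hmeas _ hξ₀)).const_mul _
    · filter_upwards [hd] with a ha
      have hda := (ha.differentiableAt (hU.mem_nhds hξ₀)).hasDerivAt
      have := hda.tendsto_slope_zero.comp
        (tendsto_nhdsWithin_iff.2 ⟨hvlim, Eventually.of_forall hv0⟩)
      simpa [Function.comp_def] using this
  have key := hasDerivAt_integral_of_dominated_loc_of_deriv_le (μ := μ) (F := F)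
    (F' := fun ξ a => deriv (F · a) ξ) (x₀ := ξ₀) (bound := fun a => bound a / (R / 2))
    (Metric.ball_mem_nhds ξ₀ hR0) ?_ ?_ hmeas' ?_ (hbi.div_const _) ?_
  · exact key.2.differentiableAt.differentiableWithinAt
  · filter_upwards [hU.mem_nhds hξ₀] with ξ hξ using hmeas ξ hξ
  · refine hbi.mono' (hmeas ξ₀ hξ₀) ?_
    filter_upwards [hb] with a ha using ha ξ₀ hξ₀
  · filter_upwards [hb, hd] with a ha hda ξ hξ
    refine Complex.norm_deriv_le_of_forall_mem_sphere_norm_le hR' ?_ fun w hw =>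
      ha w (hsub ξ hξ (Metric.sphere_subset_closedBall hw))
    refine DifferentiableOn.diffContOnCl (hda.mono ?_)
    rw [closure_ball ξ hR'.ne']
    exact hsub ξ hξ
  · filter_upwards [hd] with a ha ξ hξ
    exact (ha.differentiableAt (hU.mem_nhds (hmemU ξ hξ))).hasDerivAt

theorem hasDerivAt_integral_Ioi {E : Type*} [NormedAddCommGroup E] [NormedSpace ℝ E]
    [CompleteSpace E] {f : ℝ → E} (hf : Continuous f)
    (hi : ∀ x, IntegrableOn f (Set.Ioi x)) (x : ℝ) :
    HasDerivAt (fun x => ∫ y in Set.Ioi x, f y) (-f x) x := by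
  have h : (fun x => ∫ y in Set.Ioi x, f y)
      = fun x => (∫ y in Set.Ioi 0, f y) - ∫ y in (0 : ℝ)..x, f y := by
    funext x
    rw [← intervalIntegral.integral_Ioi_sub_Ioi' (hi 0) (hi x)]
    abel
  rw [h]
  simpa using ((hf.integral_hasStrictDerivAt 0 x).hasDerivAt).const_sub (∫ y in Set.Ioi 0, f y)

theorem tendsto_integral_Ioi_atTop {E : Type*} [NormedAddCommGroup E] [NormedSpace ℝ E]
    [CompleteSpace E] {f : ℝ → E}
    (hi : ∀ x, IntegrableOn f (Set.Ioi x)) :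
    Tendsto (fun x => ∫ y in Set.Ioi x, f y) atTop (𝓝 0) := by
  have h : (fun x => ∫ y in Set.Ioi x, f y)
      = fun x => (∫ y in Set.Ioi 0, f y) - ∫ y in (0 : ℝ)..x, f y := by
    funext x
    rw [← intervalIntegral.integral_Ioi_sub_Ioi' (hi 0) (hi x)]
    abel
  rw [h]
  simpa using (tendsto_const_nhds (x := ∫ y in Set.Ioi 0, f y)).sub
    (intervalIntegral_tendsto_integral_Ioi 0 (hi 0) tendsto_id)

/-! ### Volterra equations on half-lines with a spectral parameter in a half-plane -/

/-- A family of functions of `x` that is analytic in the spectral parameter `ξ` in the open upper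
half-plane, continuous up to the real axis, and bounded on `[x₀, ∞)` uniformly in `ξ`. -/
structure HalfPlaneFamily (n : ℝ → ℂ → ℂ) : Prop where
  cont : ∀ ξ : ℂ, 0 ≤ ξ.im → Continuous fun x => n x ξ
  contOn : ∀ x, ContinuousOn (n x) {ξ : ℂ | 0 ≤ ξ.im}
  diffOn : ∀ x, DifferentiableOn ℂ (n x) {ξ : ℂ | 0 < ξ.im}
  bdd : ∀ x₀ : ℝ, ∃ B : ℝ, ∀ ξ : ℂ, 0 ≤ ξ.im → ∀ x, x₀ ≤ x → ‖n x ξ‖ ≤ B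

/-- A kernel `k(x, z, ξ)`, `x ≤ z`, of at most linear growth in `z - x`, analytic in `ξ` in the open
upper half-plane and continuous up to the real axis. -/
structure HalfPlaneKernel (C : ℝ) (k : ℝ → ℝ → ℂ → ℂ) : Prop where
  nonneg : 0 ≤ C
  cont : ∀ ξ : ℂ, 0 ≤ ξ.im → Continuous fun p : ℝ × ℝ => k p.1 p.2 ξ
  contOn : ∀ x z, ContinuousOn (k x z) {ξ : ℂ | 0 ≤ ξ.im}
  diffOn : ∀ x z, DifferentiableOn ℂ (k x z) {ξ : ℂ | 0 < ξ.im}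
  bdd : ∀ ξ : ℂ, 0 ≤ ξ.im → ∀ x z, x ≤ z → ‖k x z ξ‖ ≤ C * (1 + (z - x))

/-- A continuous function whose first moment is finite at `+∞`. -/
structure TailIntegrable (ρ : ℝ → ℂ) : Prop where
  cont : Continuous ρ
  integrable : ∀ x, IntegrableOn (fun z => (1 + |z|) * ‖ρ z‖) (Set.Ioi x)

/-- The Volterra operator `n ↦ ∫_x^∞ k(x,z) ρ(z) n(z) dz`. -/
noncomputable def tailOp (k : ℝ → ℝ → ℂ → ℂ) (ρ : ℝ → ℂ) (n : ℝ → ℂ → ℂ) (x : ℝ) (ξ : ℂ) : ℂ :=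
  ∫ z in Set.Ioi x, k x z ξ * ρ z * n z ξ

section Volterra

variable {C : ℝ} {k : ℝ → ℝ → ℂ → ℂ} {ρ : ℝ → ℂ} {n : ℝ → ℂ → ℂ}

theorem TailIntegrable.integrableOn (hρ : TailIntegrable ρ) (x : ℝ) :
    IntegrableOn ρ (Set.Ioi x) := by
  refine (hρ.integrable x).mono' hρ.cont.aestronglyMeasurable (ae_of_all _ fun z => ?_)
  nlinarith [abs_nonneg z, norm_nonneg (ρ z)]

/-- The growth of the kernel is absorbed by the first moment of `ρ`. -/
theorem HalfPlaneKernel.norm_mul_le (hk : HalfPlaneKernel C k) {ξ : ℂ} (hξ : 0 ≤ ξ.im)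
    {x₀ x z : ℝ} (hx : x₀ ≤ x) (hz : x ≤ z) :
    ‖k x z ξ * ρ z‖ ≤ C * (1 + |x₀|) * ((1 + |z|) * ‖ρ z‖) := by
  rw [norm_mul]
  have h1 : 1 + (z - x) ≤ (1 + |x₀|) * (1 + |z|) := by
    nlinarith [abs_nonneg z, abs_nonneg x₀, le_abs_self z, neg_abs_le x₀,
      mul_nonneg (abs_nonneg x₀) (abs_nonneg z)]
  calc ‖k x z ξ‖ * ‖ρ z‖ ≤ (C * ((1 + |x₀|) * (1 + |z|))) * ‖ρ z‖ := by
        refine mul_le_mul_of_nonneg_right ((hk.bdd ξ hξ x z hz).trans ?_) (norm_nonneg _)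
        exact mul_le_mul_of_nonneg_left h1 hk.nonneg
    _ = _ := by ring

theorem HalfPlaneKernel.tailOp_family (hk : HalfPlaneKernel C k) (hρ : TailIntegrable ρ)
    (hn : HalfPlaneFamily n) : HalfPlaneFamily (tailOp k ρ n) := by
  have hcont : ∀ ξ : ℂ, 0 ≤ ξ.im → ∀ x, Continuous fun z => k x z ξ * ρ z * n z ξ :=
    fun ξ hξ x => (((hk.cont ξ hξ).comp (Continuous.prodMk_right x)).mul hρ.cont).mul
      (hn.cont ξ hξ)
  have hb : ∀ x₀ : ℝ, ∃ B : ℝ, ∀ ξ : ℂ, 0 ≤ ξ.im → ∀ x z, x₀ ≤ x → x ≤ z →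
      ‖k x z ξ * ρ z * n z ξ‖ ≤ B * ((1 + |z|) * ‖ρ z‖) := by
    intro x₀
    obtain ⟨B, hB⟩ := hn.bdd x₀
    refine ⟨C * (1 + |x₀|) * B, fun ξ hξ x z hx hz => ?_⟩
    rw [norm_mul]
    calc _ ≤ C * (1 + |x₀|) * ((1 + |z|) * ‖ρ z‖) * B :=
          mul_le_mul (hk.norm_mul_le hξ hx hz) (hB ξ hξ z (hx.trans hz)) (norm_nonneg _)
            (by have := hk.nonneg; positivity)
      _ = _ := by ring
  refine ⟨fun ξ hξ => ?_, fun x => ?_, fun x => ?_, fun x₀ => ?_⟩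
  · rw [continuous_iff_continuousAt]
    intro x₁
    obtain ⟨B, hB⟩ := hb (x₁ - 1)
    have hrw : (fun x => tailOp k ρ n x ξ)
        = fun x => ∫ z, (Set.Ioi x).indicator (fun z => k x z ξ * ρ z * n z ξ) z := by
      funext x
      rw [integral_indicator measurableSet_Ioi]
      rfl
    rw [hrw]
    refine continuousAt_of_dominated
      (bound := (Set.Ioi (x₁ - 1)).indicator fun z => |B| * ((1 + |z|) * ‖ρ z‖)) ?_ ?_ ?_ ?_
    · exact Eventually.of_forall fun x =>
        (hcont ξ hξ x).aestronglyMeasurable.indicator measurableSet_Ioi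
    · filter_upwards [Ioi_mem_nhds (show x₁ - 1 < x₁ by linarith)] with x hx
      refine ae_of_all _ fun z => ?_
      by_cases hz : z ∈ Set.Ioi x
      · rw [Set.indicator_of_mem hz, Set.indicator_of_mem (Set.Ioi_subset_Ioi (le_of_lt hx) hz)]
        refine (hB ξ hξ x z (le_of_lt hx) (le_of_lt hz)).trans ?_
        exact mul_le_mul_of_nonneg_right (le_abs_self B) (by positivity)
      · rw [Set.indicator_of_notMem hz, norm_zero]
        exact Set.indicator_nonneg (fun z _ => by positivity) z
    · rw [integrable_indicator_iff measurableSet_Ioi]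
      exact (hρ.integrable _).const_mul _
    · have : ∀ᵐ z : ℝ, z ≠ x₁ := by simp [ae_iff]
      filter_upwards [this] with z hz
      have hkx : ContinuousAt (fun x => k x z ξ * ρ z * n z ξ) x₁ := by
        have : Continuous fun x => k x z ξ := (hk.cont ξ hξ).comp (Continuous.prodMk_left z)
        fun_prop
      rcases lt_or_gt_of_ne hz with h | h
      · refine (continuousAt_const (y := (0 : ℂ))).congr ?_
        filter_upwards [Ioi_mem_nhds h] with x hx
        rw [Set.indicator_of_notMem (by simpa using le_of_lt hx)]
      · refine hkx.congr ?_
        filter_upwards [Iio_mem_nhds h] with x hx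
        rw [Set.indicator_of_mem (by simpa using hx)]
  · obtain ⟨B, hB⟩ := hb x
    refine continuousOn_of_dominated (bound := fun z => B * ((1 + |z|) * ‖ρ z‖)) ?_ ?_ ?_ ?_
    · exact fun ξ hξ => (hcont ξ hξ x).aestronglyMeasurable
    · intro ξ hξ
      refine (ae_restrict_iff' measurableSet_Ioi).2 (ae_of_all _ fun z hz => ?_)
      exact hB ξ hξ x z le_rfl (le_of_lt hz)
    · exact (hρ.integrable _).const_mul _
    · exact ae_of_all _ fun z => ((hk.contOn x z).mul continuousOn_const).mul (hn.contOn z)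
  · obtain ⟨B, hB⟩ := hb x
    refine differentiableOn_integral_of_dominated
      (isOpen_lt continuous_const Complex.continuous_im)
      (bound := fun z => B * ((1 + |z|) * ‖ρ z‖)) ?_ ?_ ?_ ?_
    · exact fun ξ hξ => (hcont ξ (le_of_lt hξ) x).aestronglyMeasurable
    · refine (ae_restrict_iff' measurableSet_Ioi).2 (ae_of_all _ fun z hz ξ hξ => ?_)
      exact hB ξ (le_of_lt hξ) x z le_rfl (le_of_lt hz)
    · exact (hρ.integrable _).const_mul _
    · exact ae_of_all _ fun z =>
        ((hk.diffOn x z).mul (differentiableOn_const _)).mul (hn.diffOn z)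
  · obtain ⟨B, hB⟩ := hb x₀
    refine ⟨∫ z in Set.Ioi x₀, |B| * ((1 + |z|) * ‖ρ z‖), fun ξ hξ x hx => ?_⟩
    refine (norm_integral_le_of_norm_le ((hρ.integrable x).const_mul |B|)
      ((ae_restrict_iff' measurableSet_Ioi).2 (ae_of_all _ fun z hz => ?_))).trans
      (setIntegral_mono_set ((hρ.integrable x₀).const_mul _) (ae_of_all _ fun z => ?_)
        (Set.Ioi_subset_Ioi hx).eventuallyLE)
    · refine (hB ξ hξ x z hx (le_of_lt hz)).trans ?_
      exact mul_le_mul_of_nonneg_right (le_abs_self B) (by positivity)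
    · show 0 ≤ |B| * ((1 + |z|) * ‖ρ z‖)
      positivity

/-- The weight in the norm that makes the Volterra operator a contraction. -/
noncomputable def tailWeight (ρ : ℝ → ℂ) (c x : ℝ) : ℝ :=
  Real.exp (2 * ∫ z in Set.Ioi x, c * ((1 + |z|) * ‖ρ z‖))

/-- The weight is chosen such that the Volterra operator with constant `c` halves it. -/
theorem TailIntegrable.tailWeight_integral (hρ : TailIntegrable ρ) {c : ℝ} (hc : 0 ≤ c) (x : ℝ) :
    IntegrableOn (fun z => c * ((1 + |z|) * ‖ρ z‖) * tailWeight ρ c z) (Set.Ioi x) ∧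
    ∫ z in Set.Ioi x, c * ((1 + |z|) * ‖ρ z‖) * tailWeight ρ c z ≤ tailWeight ρ c x / 2 := by
  have hcont : Continuous fun z : ℝ => c * ((1 + |z|) * ‖ρ z‖) := by
    have := hρ.cont
    fun_prop
  have hi : ∀ x, IntegrableOn (fun z : ℝ => c * ((1 + |z|) * ‖ρ z‖)) (Set.Ioi x) :=
    fun x => (hρ.integrable x).const_mul c
  have hd : ∀ y ∈ Set.Ici x, HasDerivAt (fun z => -(tailWeight ρ c z / 2))
      (c * ((1 + |y|) * ‖ρ y‖) * tailWeight ρ c y) y := by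
    intro y _
    have := (((hasDerivAt_integral_Ioi hcont hi y).const_mul 2).exp.div_const 2).neg
    refine this.congr_deriv ?_
    simp only [tailWeight]
    ring
  have hlim : Tendsto (fun z => -(tailWeight ρ c z / 2)) atTop (𝓝 (-(1 / 2))) := by
    have := (((Real.continuous_exp.tendsto _).comp
      ((tendsto_integral_Ioi_atTop hi).const_mul 2)).div_const 2).neg
    simpa [tailWeight, Function.comp_def] using this
  have hpos : ∀ y ∈ Set.Ioi x, 0 ≤ c * ((1 + |y|) * ‖ρ y‖) * tailWeight ρ c y := by
    intro y _
    unfold tailWeight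
    positivity
  refine ⟨integrableOn_Ioi_deriv_of_nonneg' hd hpos hlim, ?_⟩
  rw [integral_Ioi_of_hasDerivAt_of_nonneg' hd hpos hlim]
  linarith

/-- Solvability of the Volterra equation, by a Neumann series that is geometric with ratio `1/2`
in the weighted norm. -/
theorem HalfPlaneKernel.exists_solution (hk : HalfPlaneKernel C k) (hρ : TailIntegrable ρ)
    (hn : HalfPlaneFamily n) : ∃ N : ℝ → ℂ → ℂ, HalfPlaneFamily N ∧
      ∀ ξ : ℂ, 0 ≤ ξ.im → ∀ x, N x ξ = n x ξ + tailOp k ρ N x ξ := by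
  set T : ℕ → ℝ → ℂ → ℂ := fun j => (tailOp k ρ)^[j] n with hT
  have hTs : ∀ j, T (j + 1) = tailOp k ρ (T j) := fun j => Function.iterate_succ_apply' _ _ _
  have hfam : ∀ j, HalfPlaneFamily (T j) := by
    intro j
    induction j with
    | zero => exact hn
    | succ j ih => rw [hTs]; exact hk.tailOp_family hρ ih
  have hw1 : ∀ c x, 0 ≤ c → 1 ≤ tailWeight ρ c x := fun c x hc => by
    refine Real.one_le_exp (mul_nonneg zero_le_two (integral_nonneg fun z => ?_))
    show 0 ≤ c * ((1 + |z|) * ‖ρ z‖)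
    positivity
  have hbound : ∀ x₀ : ℝ, ∃ B : ℝ, ∀ j, ∀ ξ : ℂ, 0 ≤ ξ.im → ∀ x, x₀ ≤ x →
      ‖T j x ξ‖ ≤ B * (1 / 2) ^ j := by
    intro x₀
    obtain ⟨B, hB⟩ := hn.bdd x₀
    set c := C * (1 + |x₀|) with hc
    have hc0 : 0 ≤ c := by have := hk.nonneg; positivity
    have hind : ∀ j, ∀ ξ : ℂ, 0 ≤ ξ.im → ∀ x, x₀ ≤ x →
        ‖T j x ξ‖ ≤ |B| * (1 / 2) ^ j * tailWeight ρ c x := by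
      intro j
      induction j with
      | zero =>
        intro ξ hξ x hx
        calc ‖T 0 x ξ‖ ≤ B := hB ξ hξ x hx
          _ ≤ |B| * 1 := by rw [mul_one]; exact le_abs_self B
          _ ≤ |B| * tailWeight ρ c x := mul_le_mul_of_nonneg_left (hw1 c x hc0) (abs_nonneg B)
          _ = _ := by simp
      | succ j ih =>
        intro ξ hξ x hx
        obtain ⟨hi, hle⟩ := hρ.tailWeight_integral hc0 x
        rw [hTs]
        refine (norm_integral_le_of_norm_le (hi.const_mul (|B| * (1 / 2) ^ j))
          ((ae_restrict_iff' measurableSet_Ioi).2 (ae_of_all _ fun z hz => ?_))).trans ?_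
        · rw [norm_mul]
          calc _ ≤ c * ((1 + |z|) * ‖ρ z‖) * (|B| * (1 / 2) ^ j * tailWeight ρ c z) :=
                mul_le_mul (hk.norm_mul_le hξ hx (le_of_lt hz))
                  (ih ξ hξ z (hx.trans (le_of_lt hz))) (norm_nonneg _) (by positivity)
            _ = _ := by ring
        · rw [integral_const_mul]
          calc _ ≤ |B| * (1 / 2) ^ j * (tailWeight ρ c x / 2) :=
                mul_le_mul_of_nonneg_left hle (by positivity)
            _ = _ := by ring
    refine ⟨|B| * tailWeight ρ c x₀, fun j ξ hξ x hx => (hind j ξ hξ x hx).trans ?_⟩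
    have : tailWeight ρ c x ≤ tailWeight ρ c x₀ := by
      refine Real.exp_le_exp.2 (mul_le_mul_of_nonneg_left ?_ zero_le_two)
      refine setIntegral_mono_set ((hρ.integrable x₀).const_mul _) (ae_of_all _ fun z => ?_)
        (Set.Ioi_subset_Ioi hx).eventuallyLE
      show 0 ≤ c * ((1 + |z|) * ‖ρ z‖)
      positivity
    calc _ ≤ |B| * (1 / 2) ^ j * tailWeight ρ c x₀ :=
          mul_le_mul_of_nonneg_left this (by positivity)
      _ = _ := by ring
  have hgeo : ∀ B : ℝ, Summable fun j : ℕ => B * (1 / 2 : ℝ) ^ j := fun B =>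
    summable_geometric_two.mul_left B
  have hsum : ∀ ξ : ℂ, 0 ≤ ξ.im → ∀ x, Summable fun j => T j x ξ := fun ξ hξ x => by
    obtain ⟨B, hB⟩ := hbound x
    exact Summable.of_norm_bounded (hgeo B) fun j => hB j ξ hξ x le_rfl
  refine ⟨fun x ξ => ∑' j, T j x ξ, ⟨fun ξ hξ => ?_, fun x => ?_, fun x => ?_, fun x₀ => ?_⟩,
    fun ξ hξ x => ?_⟩
  · rw [continuous_iff_continuousAt]
    intro x₁
    obtain ⟨B, hB⟩ := hbound (x₁ - 1)
    have : ContinuousOn (fun x => ∑' j, T j x ξ) (Set.Ici (x₁ - 1)) :=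
      continuousOn_tsum (fun j => ((hfam j).cont ξ hξ).continuousOn) (hgeo B)
        fun j x hx => hB j ξ hξ x hx
    exact this.continuousAt (Ici_mem_nhds (by linarith))
  · obtain ⟨B, hB⟩ := hbound x
    exact continuousOn_tsum (fun j => (hfam j).contOn x) (hgeo B)
      fun j ξ hξ => hB j ξ hξ x le_rfl
  · obtain ⟨B, hB⟩ := hbound x
    exact Complex.differentiableOn_tsum_of_summable_norm (hgeo B) (fun j => (hfam j).diffOn x)
      (isOpen_lt continuous_const Complex.continuous_im)
      fun j ξ hξ => hB j ξ (le_of_lt hξ) x le_rfl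
  · obtain ⟨B, hB⟩ := hbound x₀
    exact ⟨∑' j : ℕ, B * (1 / 2 : ℝ) ^ j, fun ξ hξ x hx =>
      tsum_of_norm_bounded (hgeo B).hasSum fun j => hB j ξ hξ x hx⟩
  · obtain ⟨B, hB⟩ := hbound x
    show ∑' j, T j x ξ = n x ξ + tailOp k ρ (fun x ξ => ∑' j, T j x ξ) x ξ
    rw [(hsum ξ hξ x).tsum_eq_zero_add]
    congr 1
    simp_rw [hTs]
    refine HasSum.tsum_eq (hasSum_integral_of_dominated_convergence
      (fun j z => C * (1 + |x|) * ((1 + |z|) * ‖ρ z‖) * (B * (1 / 2) ^ j)) (fun j => ?_)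
      (fun j => ?_) (ae_of_all _ fun z => (hgeo B).mul_left _) ?_ (ae_of_all _ fun z => ?_))
    · exact ((((hk.cont ξ hξ).comp (Continuous.prodMk_right x)).mul hρ.cont).mul
        ((hfam j).cont ξ hξ)).aestronglyMeasurable
    · refine (ae_restrict_iff' measurableSet_Ioi).2 (ae_of_all _ fun z hz => ?_)
      rw [norm_mul]
      exact mul_le_mul (hk.norm_mul_le hξ le_rfl (le_of_lt hz)) (hB j ξ hξ z (le_of_lt hz))
        (norm_nonneg _) (by have := hk.nonneg; positivity)
    · simp_rw [tsum_mul_left]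
      exact ((hρ.integrable x).const_mul _).mul_const _
    · exact (hsum ξ hξ z).hasSum.mul_left _

end Volterra

/-! ### Oscillatory integrals in the closed upper half-plane -/

theorem norm_cexp_two_I_mul_le_one {ξ : ℂ} (hξ : 0 ≤ ξ.im) {s : ℝ} (hs : 0 ≤ s) :
    ‖Complex.exp (2 * Complex.I * ξ * s)‖ ≤ 1 := by
  rw [Complex.norm_exp, Real.exp_le_one_iff]
  simp
  positivity

/-- The filter of neighbourhoods of infinity in the closed upper half-plane. -/
noncomputable abbrev upperInfty : Filter ℂ := cocompact ℂ ⊓ 𝓟 {ξ : ℂ | 0 ≤ ξ.im}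

instance : upperInfty.IsCountablyGenerated := by
  have : (cocompact ℂ).IsCountablyGenerated := by
    rw [← Metric.cobounded_eq_cocompact, ← comap_norm_atTop]
    infer_instance
  infer_instance

theorem tendsto_norm_upperInfty : Tendsto (fun ξ : ℂ => ‖ξ‖) upperInfty atTop :=
  (tendsto_norm_cocompact_atTop).mono_left inf_le_left

theorem eventually_im_nonneg : ∀ᶠ ξ in upperInfty, 0 ≤ ξ.im :=
  eventually_inf_principal.2 (Eventually.of_forall fun _ h => h)

theorem tendsto_inv_upperInfty : Tendsto (fun ξ : ℂ => ξ⁻¹) upperInfty (𝓝 0) :=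
  tendsto_inv₀_cobounded.mono_left (inf_le_left.trans (Metric.cobounded_eq_cocompact (α := ℂ)).ge)

/-- Decay of an oscillatory integral with continuously differentiable amplitude, by an integration
by parts. -/
theorem norm_integral_deriv_exp_le {f f' : ℝ → ℂ} (hf : ∀ s, HasDerivAt f (f' s) s)
    (hf' : Continuous f') {L : ℝ} (hL : 0 ≤ L) : ∃ K : ℝ, ∀ ξ : ℂ, 0 ≤ ξ.im → ξ ≠ 0 →
      ‖∫ s in (0 : ℝ)..L, f s * Complex.exp (2 * Complex.I * ξ * s)‖ ≤ K * ‖ξ⁻¹‖ := by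
  have hfc : Continuous f := continuous_iff_continuousAt.2 fun s => (hf s).continuousAt
  refine ⟨(‖f L‖ + ‖f 0‖ + ∫ s in (0 : ℝ)..L, ‖f' s‖), fun ξ hξ hξ0 => ?_⟩
  have h2 : 2 * Complex.I * ξ ≠ 0 := mul_ne_zero (by simp) hξ0
  have he : ∀ s : ℝ, HasDerivAt
      (fun s : ℝ => Complex.exp (2 * Complex.I * ξ * s) / (2 * Complex.I * ξ))
      (Complex.exp (2 * Complex.I * ξ * s)) s := fun s => by
    have := (((hasDerivAt_id (s : ℂ)).const_mul (2 * Complex.I * ξ)).cexp.div_const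
      (2 * Complex.I * ξ)).comp_ofReal
    refine this.congr_deriv ?_
    simp only [id]
    field_simp
  have hec : Continuous fun s : ℝ => Complex.exp (2 * Complex.I * ξ * s) := by fun_prop
  rw [intervalIntegral.integral_mul_deriv_eq_deriv_mul (fun s _ => hf s) (fun s _ => he s)
    (hf'.intervalIntegrable _ _) (hec.intervalIntegrable _ _)]
  have hn : ∀ s : ℝ, 0 ≤ s →
      ‖Complex.exp (2 * Complex.I * ξ * s) / (2 * Complex.I * ξ)‖ ≤ ‖ξ⁻¹‖ := fun s hs => by
    rw [norm_div, norm_mul, norm_inv, ← one_div]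
    have h1 := norm_cexp_two_I_mul_le_one hξ hs
    have : ‖2 * Complex.I‖ = 2 := by simp
    rw [this]
    have hp : 0 < ‖ξ‖ := norm_pos_iff.2 hξ0
    gcongr
    linarith
  have hi : ‖∫ s in (0 : ℝ)..L, f' s *
      (Complex.exp (2 * Complex.I * ξ * s) / (2 * Complex.I * ξ))‖
      ≤ ∫ s in (0 : ℝ)..L, ‖f' s‖ * ‖ξ⁻¹‖ := by
    refine intervalIntegral.norm_integral_le_of_norm_le hL (ae_of_all _ fun s hs => ?_)
      ((hf'.norm.mul continuous_const).intervalIntegrable _ _)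
    rw [norm_mul]
    exact mul_le_mul_of_nonneg_left (hn s hs.1.le) (norm_nonneg _)
  rw [intervalIntegral.integral_mul_const] at hi
  refine (norm_sub_le _ _).trans ((add_le_add (norm_sub_le _ _) hi).trans ?_)
  rw [norm_mul, norm_mul, add_mul, add_mul]
  have hL' := hn L hL
  have h0' := hn 0 le_rfl
  gcongr

/-- A continuous amplitude on a bounded interval is uniformly approximated by polynomials. -/
theorem tendsto_integral_real_exp {f : ℝ → ℝ} (hf : Continuous f) {L : ℝ} (hL : 0 ≤ L) :
    Tendsto (fun ξ : ℂ => ∫ s in (0 : ℝ)..L, (f s : ℂ) * Complex.exp (2 * Complex.I * ξ * s))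
      upperInfty (𝓝 0) := by
  rw [Metric.tendsto_nhds]
  intro ε hε
  obtain ⟨p, hp⟩ := exists_polynomial_near_of_continuousOn 0 L f hf.continuousOn
    (ε / (2 * (L + 1))) (by positivity)
  obtain ⟨K, hK⟩ := norm_integral_deriv_exp_le (f := fun s => ((p.eval s : ℝ) : ℂ))
    (f' := fun s => ((p.derivative.eval s : ℝ) : ℂ)) (fun s => (p.hasDerivAt s).ofReal_comp)
    (Complex.continuous_ofReal.comp p.derivative.continuous) hL
  have hlim : Tendsto (fun ξ : ℂ => K * ‖ξ⁻¹‖) upperInfty (𝓝 0) := by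
    simpa using tendsto_inv_upperInfty.norm.const_mul K
  filter_upwards [hlim.eventually_lt_const (half_pos hε), eventually_im_nonneg,
    tendsto_norm_upperInfty.eventually_gt_atTop 0] with ξ h1 h2 h3
  have hξ0 : ξ ≠ 0 := norm_pos_iff.1 h3
  have hec : Continuous fun s : ℝ => Complex.exp (2 * Complex.I * ξ * s) := by fun_prop
  have hpc : Continuous fun s : ℝ => ((p.eval s : ℝ) : ℂ) :=
    Complex.continuous_ofReal.comp p.continuous
  have hfc : Continuous fun s : ℝ => (f s : ℂ) := Complex.continuous_ofReal.comp hf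
  have hdiff : ‖(∫ s in (0 : ℝ)..L, (f s : ℂ) * Complex.exp (2 * Complex.I * ξ * s))
      - ∫ s in (0 : ℝ)..L, ((p.eval s : ℝ) : ℂ) * Complex.exp (2 * Complex.I * ξ * s)‖
      ≤ ε / (2 * (L + 1)) * |L - 0| := by
    rw [← intervalIntegral.integral_sub (Continuous.intervalIntegrable (by fun_prop) _ _)
      (Continuous.intervalIntegrable (by fun_prop) _ _)]
    refine intervalIntegral.norm_integral_le_of_norm_le_const fun s hs => ?_
    rw [Set.uIoc_of_le hL] at hs
    rw [← sub_mul, norm_mul, ← Complex.ofReal_sub, Complex.norm_real, Real.norm_eq_abs,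
      abs_sub_comm]
    calc _ ≤ ε / (2 * (L + 1)) * 1 :=
          mul_le_mul (hp s ⟨hs.1.le, hs.2⟩).le (norm_cexp_two_I_mul_le_one h2 hs.1.le)
            (norm_nonneg _) (by positivity)
      _ = _ := mul_one _
  rw [dist_zero_right]
  have hlt : ε / (2 * (L + 1)) * |L - 0| < ε / 2 := by
    rw [sub_zero, abs_of_nonneg hL, div_mul_eq_mul_div, div_lt_div_iff₀ (by positivity) two_pos]
    nlinarith
  have := norm_le_norm_add_norm_sub'
    (∫ s in (0 : ℝ)..L, (f s : ℂ) * Complex.exp (2 * Complex.I * ξ * s))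
    (∫ s in (0 : ℝ)..L, ((p.eval s : ℝ) : ℂ) * Complex.exp (2 * Complex.I * ξ * s))
  linarith [hK ξ h2 hξ0]

theorem tendsto_integral_exp {f : ℝ → ℂ} (hf : Continuous f) {L : ℝ} (hL : 0 ≤ L) :
    Tendsto (fun ξ : ℂ => ∫ s in (0 : ℝ)..L, f s * Complex.exp (2 * Complex.I * ξ * s))
      upperInfty (𝓝 0) := by
  have h1 := tendsto_integral_real_exp (Complex.continuous_re.comp hf) hL
  have h2 := (tendsto_integral_real_exp (Complex.continuous_im.comp hf) hL).const_mul Complex.I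
  rw [mul_zero] at h2
  have := h1.add h2
  rw [add_zero] at this
  refine this.congr fun ξ => ?_
  have hec : Continuous fun s : ℝ => Complex.exp (2 * Complex.I * ξ * s) := by fun_prop
  rw [← intervalIntegral.integral_const_mul, ← intervalIntegral.integral_add]
  · refine intervalIntegral.integral_congr fun s _ => ?_
    simp only [Function.comp]
    conv_rhs => rw [← Complex.re_add_im (f s)]
    ring
  · exact Continuous.intervalIntegrable (by fun_prop) _ _
  · exact Continuous.intervalIntegrable (by fun_prop) _ _

/-- **Riemann-Lebesgue lemma** in the closed upper half-plane. -/
theorem tendsto_integral_Ioi_exp {f : ℝ → ℂ} (hf : Continuous f)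
    (hi : ∀ x, IntegrableOn f (Set.Ioi x)) (x : ℝ) :
    Tendsto (fun ξ : ℂ => ∫ y in Set.Ioi x,
      Complex.exp (2 * Complex.I * ξ * ((y - x : ℝ) : ℂ)) * f y)
      upperInfty (𝓝 0) := by
  rw [Metric.tendsto_nhds]
  intro ε hε
  have htail := tendsto_integral_Ioi_atTop (f := fun y => ‖f y‖) fun x => (hi x).norm
  obtain ⟨R, hR1, hR2⟩ := ((htail.eventually_lt_const (half_pos hε)).and
    (eventually_ge_atTop x)).exists
  have hfin := tendsto_integral_exp (f := fun s => f (s + x)) (by fun_prop)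
    (L := R - x) (by linarith)
  rw [Metric.tendsto_nhds] at hfin
  filter_upwards [hfin (ε / 2) (half_pos hε), eventually_im_nonneg] with ξ h1 h2
  rw [dist_zero_right] at h1 ⊢
  have hle : ∀ y, x ≤ y → ‖Complex.exp (2 * Complex.I * ξ * ((y - x : ℝ) : ℂ)) * f y‖ ≤ ‖f y‖ :=
    fun y hy => by
      rw [norm_mul]
      exact mul_le_of_le_one_left (norm_nonneg _)
        (norm_cexp_two_I_mul_le_one h2 (by linarith))
  have hcont : Continuous fun y : ℝ =>
      Complex.exp (2 * Complex.I * ξ * ((y - x : ℝ) : ℂ)) * f y := by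
    fun_prop
  have hint : ∀ a, x ≤ a → IntegrableOn
      (fun y : ℝ => Complex.exp (2 * Complex.I * ξ * ((y - x : ℝ) : ℂ)) * f y) (Set.Ioi a) :=
    fun a ha => (hi a).norm.mono' hcont.aestronglyMeasurable
      ((ae_restrict_iff' measurableSet_Ioi).2 (ae_of_all _ fun y hy => hle y
        (ha.trans (le_of_lt hy))))
  have hsplit := intervalIntegral.integral_Ioi_sub_Ioi (hint x le_rfl) hR2
  have hsub : ∫ y in x..R, Complex.exp (2 * Complex.I * ξ * ((y - x : ℝ) : ℂ)) * f y
      = ∫ s in (0 : ℝ)..(R - x), f (s + x) * Complex.exp (2 * Complex.I * ξ * s) := by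
    have := intervalIntegral.integral_comp_sub_right (a := x) (b := R)
      (fun s : ℝ => f (s + x) * Complex.exp (2 * Complex.I * ξ * s)) x
    rw [sub_self] at this
    rw [← this]
    refine intervalIntegral.integral_congr fun y _ => ?_
    simp only [sub_add_cancel]
    rw [mul_comm]
  rw [hsub] at hsplit
  have htl : ‖∫ y in Set.Ioi R, Complex.exp (2 * Complex.I * ξ * ((y - x : ℝ) : ℂ)) * f y‖
      ≤ ∫ y in Set.Ioi R, ‖f y‖ :=
    norm_integral_le_of_norm_le (hi R).norm ((ae_restrict_iff' measurableSet_Ioi).2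
      (ae_of_all _ fun y hy => hle y (hR2.trans (le_of_lt hy))))
  rw [sub_eq_iff_eq_add] at hsplit
  rw [hsplit]
  exact (norm_add_le _ _).trans_lt (by linarith)

/-- Integrals of exponentials over bounded intervals are entire functions of the exponent. -/
theorem differentiable_integral_exp {f : ℝ → ℂ} {h : ℝ → ℂ} (hf : Continuous f)
    (hh : Continuous h) (a b : ℝ) :
    Differentiable ℂ fun ξ : ℂ => ∫ y in a..b, f y * Complex.exp (ξ * h y) := by
  intro ξ₀
  have key : ∀ a b : ℝ, DifferentiableOn ℂ
      (fun ξ : ℂ => ∫ y in Set.Ioc a b, f y * Complex.exp (ξ * h y))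
      (Metric.ball 0 (‖ξ₀‖ + 1)) := by
    intro a b
    refine differentiableOn_integral_of_dominated Metric.isOpen_ball
      (bound := fun y => ‖f y‖ * Real.exp ((‖ξ₀‖ + 1) * ‖h y‖)) ?_ ?_ ?_ ?_
    · exact fun ξ _ => Continuous.aestronglyMeasurable (by fun_prop)
    · refine ae_of_all _ fun y ξ hξ => ?_
      rw [norm_mul]
      refine mul_le_mul_of_nonneg_left ((Complex.norm_exp_le_exp_norm _).trans ?_) (norm_nonneg _)
      rw [norm_mul, Real.exp_le_exp]
      rw [mem_ball_zero_iff] at hξ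
      gcongr
    · exact Continuous.integrableOn_Ioc (by fun_prop)
    · exact ae_of_all _ fun y => by fun_prop
  have hmem : Metric.ball (0 : ℂ) (‖ξ₀‖ + 1) ∈ 𝓝 ξ₀ :=
    Metric.isOpen_ball.mem_nhds (by simp)
  exact ((key a b).differentiableAt hmem).sub ((key b a).differentiableAt hmem)

/-! ### The Volterra kernels of the scattering problem -/

/-- The kernel `e^{2iξ(z-x)}`. -/
noncomputable def expKer (x z : ℝ) (ξ : ℂ) : ℂ :=
  Complex.exp (2 * Complex.I * ξ * ((z - x : ℝ) : ℂ))

/-- The kernel `∫_x^z u(y) e^{2iξ(z-y)} dy`. -/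
noncomputable def kerLeft (u : ℝ → ℂ) (x z : ℝ) (ξ : ℂ) : ℂ :=
  ∫ y in x..z, u y * Complex.exp (ξ * (2 * Complex.I * ((z - y : ℝ) : ℂ)))

/-- The kernel `∫_x^z u(y) e^{2iξ(y-x)} dy`. -/
noncomputable def kerRight (u : ℝ → ℂ) (x z : ℝ) (ξ : ℂ) : ℂ :=
  ∫ y in x..z, u y * Complex.exp (ξ * (2 * Complex.I * ((y - x : ℝ) : ℂ)))

theorem halfPlaneKernel_exp : HalfPlaneKernel 1 expKer := by
  refine ⟨zero_le_one, fun ξ _ => ?_, fun x z => ?_, fun x z => ?_, fun ξ hξ x z hz => ?_⟩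
  · unfold expKer; fun_prop
  · unfold expKer; fun_prop
  · unfold expKer; fun_prop
  · have := norm_cexp_two_I_mul_le_one hξ (sub_nonneg.2 hz)
    unfold expKer
    linarith

theorem halfPlaneKernel_one : HalfPlaneKernel 1 fun _ _ _ => (1 : ℂ) := by
  refine ⟨zero_le_one, fun ξ _ => continuous_const, fun x z => continuousOn_const,
    fun x z => differentiableOn_const _, fun ξ hξ x z hz => ?_⟩
  rw [norm_one]
  linarith

theorem kerLeft_eq (u : ℝ → ℂ) (hu : Continuous u) (x z : ℝ) (ξ : ℂ) :
    kerLeft u x z ξ = Complex.exp (2 * Complex.I * ξ * z) *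
      ((∫ y in (0 : ℝ)..z, u y * Complex.exp (-(2 * Complex.I * ξ * y)))
        - ∫ y in (0 : ℝ)..x, u y * Complex.exp (-(2 * Complex.I * ξ * y))) := by
  have hc : Continuous fun y : ℝ => u y * Complex.exp (-(2 * Complex.I * ξ * y)) := by fun_prop
  rw [intervalIntegral.integral_interval_sub_left (hc.intervalIntegrable _ _)
    (hc.intervalIntegrable _ _), ← intervalIntegral.integral_const_mul]
  refine intervalIntegral.integral_congr fun y _ => ?_
  rw [mul_left_comm (Complex.exp _), ← Complex.exp_add]
  congr 2
  push_cast
  ring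

theorem kerRight_eq (u : ℝ → ℂ) (hu : Continuous u) (x z : ℝ) (ξ : ℂ) :
    kerRight u x z ξ = Complex.exp (-(2 * Complex.I * ξ * x)) *
      ((∫ y in (0 : ℝ)..z, u y * Complex.exp (2 * Complex.I * ξ * y))
        - ∫ y in (0 : ℝ)..x, u y * Complex.exp (2 * Complex.I * ξ * y)) := by
  have hc : Continuous fun y : ℝ => u y * Complex.exp (2 * Complex.I * ξ * y) := by fun_prop
  rw [intervalIntegral.integral_interval_sub_left (hc.intervalIntegrable _ _)
    (hc.intervalIntegrable _ _), ← intervalIntegral.integral_const_mul]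
  refine intervalIntegral.integral_congr fun y _ => ?_
  rw [mul_left_comm (Complex.exp _), ← Complex.exp_add]
  congr 2
  push_cast
  ring

theorem hasDerivAt_primitive {f : ℝ → ℂ} (hf : Continuous f) (x : ℝ) :
    HasDerivAt (fun x => ∫ y in (0 : ℝ)..x, f y) (f x) x :=
  (hf.integral_hasStrictDerivAt 0 x).hasDerivAt

theorem continuous_primitive_zero {f : ℝ → ℂ} (hf : Continuous f) :
    Continuous fun x => ∫ y in (0 : ℝ)..x, f y :=
  continuous_iff_continuousAt.2 fun x => (hasDerivAt_primitive hf x).continuousAt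

theorem norm_integral_mul_exp_le {u : ℝ → ℂ} {C : ℝ} (hC : ∀ x, ‖u x‖ ≤ C) {ξ : ℂ}
    (hξ : 0 ≤ ξ.im) {x z : ℝ} (hz : x ≤ z) {h : ℝ → ℝ} (hh : ∀ y ∈ Set.Icc x z, 0 ≤ h y) :
    ‖∫ y in x..z, u y * Complex.exp (ξ * (2 * Complex.I * (h y : ℂ)))‖ ≤ C * (1 + (z - x)) := by
  have hC0 : 0 ≤ C := (norm_nonneg _).trans (hC 0)
  have := intervalIntegral.norm_integral_le_of_norm_le_const (a := x) (b := z) (C := C)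
    (f := fun y => u y * Complex.exp (ξ * (2 * Complex.I * (h y : ℂ)))) fun y hy => by
      rw [Set.uIoc_of_le hz] at hy
      rw [norm_mul, show ξ * (2 * Complex.I * (h y : ℂ)) = 2 * Complex.I * ξ * (h y : ℂ) by ring]
      calc _ ≤ C * 1 := mul_le_mul (hC y)
            (norm_cexp_two_I_mul_le_one hξ (hh y ⟨hy.1.le, hy.2⟩)) (norm_nonneg _) hC0
        _ = C := mul_one C
  refine this.trans ?_
  rw [abs_of_nonneg (sub_nonneg.2 hz)]
  nlinarith

theorem halfPlaneKernel_left {u : ℝ → ℂ} (hu : Continuous u) {C : ℝ} (hC : ∀ x, ‖u x‖ ≤ C) :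
    HalfPlaneKernel C (kerLeft u) := by
  refine ⟨(norm_nonneg _).trans (hC 0), fun ξ _ => ?_, fun x z => ?_, fun x z => ?_,
    fun ξ hξ x z hz => norm_integral_mul_exp_le hC hξ hz fun y hy => sub_nonneg.2 hy.2⟩
  · simp_rw [kerLeft_eq u hu]
    have := continuous_primitive_zero
      (f := fun y => u y * Complex.exp (-(2 * Complex.I * ξ * y))) (by fun_prop)
    fun_prop
  · exact (differentiable_integral_exp hu (by fun_prop) x z).continuous.continuousOn
  · exact (differentiable_integral_exp hu (by fun_prop) x z).differentiableOn

theorem halfPlaneKernel_right {u : ℝ → ℂ} (hu : Continuous u) {C : ℝ} (hC : ∀ x, ‖u x‖ ≤ C) :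
    HalfPlaneKernel C (kerRight u) := by
  refine ⟨(norm_nonneg _).trans (hC 0), fun ξ _ => ?_, fun x z => ?_, fun x z => ?_,
    fun ξ hξ x z hz => norm_integral_mul_exp_le hC hξ hz fun y hy => sub_nonneg.2 hy.1⟩
  · simp_rw [kerRight_eq u hu]
    have := continuous_primitive_zero
      (f := fun y => u y * Complex.exp (2 * Complex.I * ξ * y)) (by fun_prop)
    fun_prop
  · exact (differentiable_integral_exp hu (by fun_prop) x z).continuous.continuousOn
  · exact (differentiable_integral_exp hu (by fun_prop) x z).differentiableOn

theorem tendsto_kerLeft {u : ℝ → ℂ} (hu : Continuous u) {x z : ℝ} (hz : x ≤ z) :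
    Tendsto (kerLeft u x z) upperInfty (𝓝 0) := by
  refine (tendsto_integral_exp (f := fun s => u (z - s)) (by fun_prop) (L := z - x)
    (by linarith)).congr fun ξ => ?_
  have := intervalIntegral.integral_comp_sub_left (a := x) (b := z)
    (fun s : ℝ => u (z - s) * Complex.exp (2 * Complex.I * ξ * s)) z
  rw [sub_self] at this
  rw [← this]
  refine intervalIntegral.integral_congr fun y _ => ?_
  simp only [sub_sub_cancel]
  congr 2
  ring

theorem tendsto_kerRight {u : ℝ → ℂ} (hu : Continuous u) {x z : ℝ} (hz : x ≤ z) :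
    Tendsto (kerRight u x z) upperInfty (𝓝 0) := by
  refine (tendsto_integral_exp (f := fun s => u (s + x)) (by fun_prop) (L := z - x)
    (by linarith)).congr fun ξ => ?_
  have := intervalIntegral.integral_comp_sub_right (a := x) (b := z)
    (fun s : ℝ => u (s + x) * Complex.exp (2 * Complex.I * ξ * s)) x
  rw [sub_self] at this
  rw [← this]
  refine intervalIntegral.integral_congr fun y _ => ?_
  simp only [sub_add_cancel]
  congr 2
  ring

section TailLimits

variable {C : ℝ} {k : ℝ → ℝ → ℂ → ℂ} {ρ : ℝ → ℂ} {n : ℝ → ℂ → ℂ}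

theorem HalfPlaneKernel.integrableOn (hk : HalfPlaneKernel C k) (hρ : TailIntegrable ρ)
    (hn : HalfPlaneFamily n) {ξ : ℂ} (hξ : 0 ≤ ξ.im) (x : ℝ) :
    IntegrableOn (fun z => k x z ξ * ρ z * n z ξ) (Set.Ioi x) := by
  obtain ⟨B, hB⟩ := hn.bdd x
  refine Integrable.mono' ((hρ.integrable x).const_mul (C * (1 + |x|) * B))
    ((((hk.cont ξ hξ).comp (Continuous.prodMk_right x)).mul hρ.cont).mul
      (hn.cont ξ hξ)).aestronglyMeasurable
    ((ae_restrict_iff' measurableSet_Ioi).2 (ae_of_all _ fun z hz => ?_))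
  rw [norm_mul]
  calc _ ≤ C * (1 + |x|) * ((1 + |z|) * ‖ρ z‖) * B :=
        mul_le_mul (hk.norm_mul_le hξ le_rfl (le_of_lt hz)) (hB ξ hξ z (le_of_lt hz))
          (norm_nonneg _) (by have := hk.nonneg; positivity)
    _ = _ := by ring

theorem HalfPlaneKernel.tendsto_atTop (hk : HalfPlaneKernel C k) (hρ : TailIntegrable ρ)
    (hn : HalfPlaneFamily n) {ξ : ℂ} (hξ : 0 ≤ ξ.im) :
    Tendsto (fun x => tailOp k ρ n x ξ) atTop (𝓝 0) := by
  obtain ⟨B, hB⟩ := hn.bdd 0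
  have hi : ∀ x, IntegrableOn (fun z => C * B * ((1 + |z|) * ‖ρ z‖)) (Set.Ioi x) :=
    fun x => (hρ.integrable x).const_mul _
  refine squeeze_zero_norm' ?_ (tendsto_integral_Ioi_atTop hi)
  filter_upwards [eventually_ge_atTop 0] with x hx
  refine norm_integral_le_of_norm_le (hi x)
    ((ae_restrict_iff' measurableSet_Ioi).2 (ae_of_all _ fun z hz => ?_))
  rw [norm_mul]
  have h1 := hk.norm_mul_le (ρ := ρ) hξ hx (le_of_lt hz)
  rw [abs_zero, add_zero, mul_one] at h1
  calc _ ≤ C * ((1 + |z|) * ‖ρ z‖) * B :=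
        mul_le_mul h1 (hB ξ hξ z (hx.trans (le_of_lt hz)))
          (norm_nonneg _) (by have := hk.nonneg; positivity)
    _ = _ := by ring

/-- Dominated convergence for Volterra integrals as the spectral parameter tends to infinity. -/
theorem HalfPlaneKernel.tendsto_upperInfty (hk : HalfPlaneKernel C k) (hρ : TailIntegrable ρ)
    (hn : HalfPlaneFamily n) (x : ℝ)
    (hlim : ∀ z, x < z → Tendsto (fun ξ => k x z ξ * n z ξ) upperInfty (𝓝 0)) :
    Tendsto (tailOp k ρ n x) upperInfty (𝓝 0) := by
  obtain ⟨B, hB⟩ := hn.bdd x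
  have hint : ∫ _ in Set.Ioi x, (0 : ℂ) = 0 := by simp
  have : Tendsto (tailOp k ρ n x) upperInfty (𝓝 (∫ _ in Set.Ioi x, (0 : ℂ))) := by
    refine tendsto_integral_filter_of_dominated_convergence
      (fun z => C * (1 + |x|) * B * ((1 + |z|) * ‖ρ z‖)) ?_ ?_ ((hρ.integrable x).const_mul _) ?_
    · filter_upwards [eventually_im_nonneg] with ξ hξ
      exact (hk.integrableOn hρ hn hξ x).aestronglyMeasurable
    · filter_upwards [eventually_im_nonneg] with ξ hξ
      refine (ae_restrict_iff' measurableSet_Ioi).2 (ae_of_all _ fun z hz => ?_)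
      rw [norm_mul]
      calc _ ≤ C * (1 + |x|) * ((1 + |z|) * ‖ρ z‖) * B :=
            mul_le_mul (hk.norm_mul_le hξ le_rfl (le_of_lt hz)) (hB ξ hξ z (le_of_lt hz))
              (norm_nonneg _) (by have := hk.nonneg; positivity)
        _ = _ := by ring
    · refine (ae_restrict_iff' measurableSet_Ioi).2 (ae_of_all _ fun z hz => ?_)
      have := (hlim z hz).mul_const (ρ z)
      rw [zero_mul] at this
      exact this.congr fun ξ => by ring
  rwa [hint] at this

/-- The derivative of a Volterra integral whose kernel is a difference `Q(z) - Q(x)`. -/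
theorem hasDerivAt_integral_Ioi_sub {Q q w : ℝ → ℂ} (hQ : ∀ x, HasDerivAt Q (q x) x)
    (hw : Continuous w) (hwi : ∀ x, IntegrableOn w (Set.Ioi x))
    (hQw : ∀ x, IntegrableOn (fun z => (Q z - Q x) * w z) (Set.Ioi x)) (x : ℝ) :
    HasDerivAt (fun x => ∫ z in Set.Ioi x, (Q z - Q x) * w z)
      (-(q x * ∫ z in Set.Ioi x, w z)) x := by
  have hQc : Continuous Q := continuous_iff_continuousAt.2 fun s => (hQ s).continuousAt
  have hQwi : ∀ x, IntegrableOn (fun z => Q z * w z) (Set.Ioi x) := fun x => by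
    refine ((hQw x).add ((hwi x).const_mul (Q x))).congr (ae_of_all _ fun z => ?_)
    simp only [Pi.add_apply]
    ring
  have heq : (fun x => ∫ z in Set.Ioi x, (Q z - Q x) * w z)
      = fun x => (∫ z in Set.Ioi x, Q z * w z) - Q x * ∫ z in Set.Ioi x, w z := by
    funext x
    rw [← integral_const_mul, ← integral_sub (hQwi x) ((hwi x).const_mul (Q x))]
    exact integral_congr_ae (ae_of_all _ fun z => by simp only; ring)
  rw [heq]
  refine ((hasDerivAt_integral_Ioi (f := fun z => Q z * w z) (by fun_prop) hQwi x).sub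
    ((hQ x).mul (hasDerivAt_integral_Ioi hw hwi x))).congr_deriv ?_
  ring

end TailLimits

/-! ### The Volterra solutions of the scattering problem -/

/-- The lower left entry `r(x) = -conj u(-x)` of the potential matrix. -/
noncomputable def refl (u : ℝ → ℂ) (x : ℝ) : ℂ := -(starRingEnd ℂ) (u (-x))

section StepLikeLemmas

variable {A : ℝ} {u : ℝ → ℂ}

theorem continuous_refl (hu : Continuous u) : Continuous (refl u) := by
  unfold refl
  have := Complex.continuous_conj
  fun_prop

theorem StepLike.exists_bound (hu : StepLike A u) : ∃ C, ∀ x, ‖u x‖ ≤ C := by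
  have h1 : ∀ᶠ x in atBot, ‖u x‖ ≤ 1 := by
    have := hu.left.norm
    rw [norm_zero] at this
    exact (this.eventually_lt_const one_pos).mono fun x hx => hx.le
  have h2 : ∀ᶠ x in atTop, ‖u x‖ ≤ ‖(A : ℂ)‖ + 1 :=
    (hu.right.norm.eventually_lt_const (lt_add_one _)).mono fun x hx => hx.le
  obtain ⟨a, ha⟩ := eventually_atBot.1 h1
  obtain ⟨c, hc⟩ := eventually_atTop.1 h2
  obtain ⟨K, hK⟩ := (isCompact_Icc (a := a) (b := c)).exists_bound_of_continuousOn
    hu.continuous.continuousOn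
  refine ⟨max (max 1 (‖(A : ℂ)‖ + 1)) K, fun x => ?_⟩
  rcases le_total x a with h | h
  · exact (ha x h).trans ((le_max_left _ _).trans (le_max_left _ _))
  rcases le_total c x with h' | h'
  · exact (hc x h').trans ((le_max_right _ _).trans (le_max_left _ _))
  · exact (hK x ⟨h, h'⟩).trans (le_max_right _ _)

theorem tailIntegrable_of_zero {ρ : ℝ → ℂ} (hρ : Continuous ρ)
    (hi : IntegrableOn (fun z => (1 + |z|) * ‖ρ z‖) (Set.Ioi 0)) : TailIntegrable ρ := by
  refine ⟨hρ, fun x => ?_⟩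
  have hc : Continuous fun z : ℝ => (1 + |z|) * ‖ρ z‖ := by fun_prop
  rcases le_total 0 x with h | h
  · exact hi.mono_set (Set.Ioi_subset_Ioi h)
  · rw [← Set.Ioc_union_Ioi_eq_Ioi h]
    exact (hc.integrableOn_Ioc).union hi

theorem StepLike.tailIntegrable_refl (hu : StepLike A u) : TailIntegrable (refl u) := by
  refine tailIntegrable_of_zero (continuous_refl hu.continuous) ?_
  have h := (hu.close.comp_neg).integrableOn (s := Set.Ioi (0 : ℝ))
  refine h.congr_fun (fun z hz => ?_) measurableSet_Ioi
  have : ¬ (0 : ℝ) < -z := by simpa using le_of_lt hz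
  simp [refl, step, this]

theorem StepLike.tailIntegrable_sub (hu : StepLike A u) : TailIntegrable fun x => u x - A := by
  have := hu.continuous
  refine tailIntegrable_of_zero (by fun_prop) ?_
  have h := hu.close.integrableOn (s := Set.Ioi (0 : ℝ))
  refine h.congr_fun (fun z hz => ?_) measurableSet_Ioi
  simp [step, show (0 : ℝ) < z from hz]

end StepLikeLemmas

section Families

variable {n m : ℝ → ℂ → ℂ}

theorem HalfPlaneFamily.of_param {g : ℂ → ℂ} (hc : ContinuousOn g {ξ : ℂ | 0 ≤ ξ.im})
    (hd : DifferentiableOn ℂ g {ξ : ℂ | 0 < ξ.im}) {B : ℝ}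
    (hB : ∀ ξ : ℂ, 0 ≤ ξ.im → ‖g ξ‖ ≤ B) : HalfPlaneFamily fun _ ξ => g ξ :=
  ⟨fun _ _ => continuous_const, fun _ => hc, fun _ => hd, fun _ => ⟨B, fun ξ hξ _ _ => hB ξ hξ⟩⟩

theorem HalfPlaneFamily.const (c : ℂ) : HalfPlaneFamily fun _ _ => c :=
  .of_param continuousOn_const (differentiableOn_const _) fun _ _ => le_rfl

theorem HalfPlaneFamily.add (hn : HalfPlaneFamily n) (hm : HalfPlaneFamily m) :
    HalfPlaneFamily fun x ξ => n x ξ + m x ξ := by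
  refine ⟨fun ξ hξ => (hn.cont ξ hξ).add (hm.cont ξ hξ), fun x => (hn.contOn x).add (hm.contOn x),
    fun x => (hn.diffOn x).add (hm.diffOn x), fun x₀ => ?_⟩
  obtain ⟨B, hB⟩ := hn.bdd x₀
  obtain ⟨B', hB'⟩ := hm.bdd x₀
  exact ⟨B + B', fun ξ hξ x hx => (norm_add_le _ _).trans (add_le_add (hB ξ hξ x hx)
    (hB' ξ hξ x hx))⟩

theorem HalfPlaneFamily.mul (hn : HalfPlaneFamily n) (hm : HalfPlaneFamily m) :
    HalfPlaneFamily fun x ξ => n x ξ * m x ξ := by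
  refine ⟨fun ξ hξ => (hn.cont ξ hξ).mul (hm.cont ξ hξ), fun x => (hn.contOn x).mul (hm.contOn x),
    fun x => (hn.diffOn x).mul (hm.diffOn x), fun x₀ => ?_⟩
  obtain ⟨B, hB⟩ := hn.bdd x₀
  obtain ⟨B', hB'⟩ := hm.bdd x₀
  refine ⟨B * B', fun ξ hξ x hx => ?_⟩
  rw [norm_mul]
  exact mul_le_mul (hB ξ hξ x hx) (hB' ξ hξ x hx) (norm_nonneg _)
    ((norm_nonneg _).trans (hB ξ hξ x hx))

theorem HalfPlaneFamily.neg (hn : HalfPlaneFamily n) : HalfPlaneFamily fun x ξ => -n x ξ := by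
  simpa using (HalfPlaneFamily.const (-1)).mul hn

theorem HalfPlaneFamily.sub (hn : HalfPlaneFamily n) (hm : HalfPlaneFamily m) :
    HalfPlaneFamily fun x ξ => n x ξ - m x ξ := by
  simpa [sub_eq_add_neg] using hn.add hm.neg

theorem add_I_ne_zero {ξ : ℂ} (hξ : 0 ≤ ξ.im) : ξ + Complex.I ≠ 0 := by
  intro h
  have := congrArg Complex.im h
  simp at this
  linarith

theorem one_le_norm_add_I {ξ : ℂ} (hξ : 0 ≤ ξ.im) : 1 ≤ ‖ξ + Complex.I‖ := by
  refine le_trans ?_ (Complex.abs_im_le_norm _)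
  simp only [Complex.add_im, Complex.I_im]
  exact (by linarith : (1 : ℝ) ≤ ξ.im + 1).trans (le_abs_self _)

theorem norm_le_norm_add_I {ξ : ℂ} (hξ : 0 ≤ ξ.im) : ‖ξ‖ ≤ ‖ξ + Complex.I‖ := by
  rw [Complex.norm_eq_sqrt_sq_add_sq, Complex.norm_eq_sqrt_sq_add_sq]
  refine Real.sqrt_le_sqrt ?_
  simp
  nlinarith

theorem continuousOn_inv_add_I : ContinuousOn (fun ξ : ℂ => (ξ + Complex.I)⁻¹)
    {ξ : ℂ | 0 ≤ ξ.im} :=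
  ContinuousOn.inv₀ (by fun_prop) fun _ hξ => add_I_ne_zero hξ

theorem differentiableOn_inv_add_I : DifferentiableOn ℂ (fun ξ : ℂ => (ξ + Complex.I)⁻¹)
    {ξ : ℂ | 0 < ξ.im} :=
  DifferentiableOn.inv (by fun_prop) fun _ hξ => add_I_ne_zero (le_of_lt hξ)

theorem halfPlaneFamily_inv : HalfPlaneFamily fun _ ξ => (ξ + Complex.I)⁻¹ :=
  .of_param continuousOn_inv_add_I differentiableOn_inv_add_I (B := 1) fun ξ hξ => by
    rw [norm_inv]
    exact inv_le_one_of_one_le₀ (one_le_norm_add_I hξ)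

theorem halfPlaneFamily_div : HalfPlaneFamily fun _ ξ => ξ * (ξ + Complex.I)⁻¹ :=
  .of_param (continuousOn_id.mul continuousOn_inv_add_I)
    (differentiableOn_id.mul differentiableOn_inv_add_I) (B := 1) fun ξ hξ => by
    rw [norm_mul, norm_inv]
    exact mul_inv_le_one_of_le₀ (norm_le_norm_add_I hξ) (norm_nonneg _)

theorem tendsto_inv_add_I : Tendsto (fun ξ : ℂ => (ξ + Complex.I)⁻¹) upperInfty (𝓝 0) := by
  rw [tendsto_zero_iff_norm_tendsto_zero]
  refine squeeze_zero' (Eventually.of_forall fun _ => norm_nonneg _) ?_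
    (tendsto_inv_atTop_zero.comp tendsto_norm_upperInfty)
  filter_upwards [eventually_im_nonneg, tendsto_norm_upperInfty.eventually_gt_atTop 0] with ξ h h'
  rw [norm_inv]
  exact inv_anti₀ h' (norm_le_norm_add_I h)

theorem tendsto_div_add_I : Tendsto (fun ξ : ℂ => ξ * (ξ + Complex.I)⁻¹) upperInfty (𝓝 1) := by
  have h := (tendsto_const_nhds (x := (1 : ℂ))).sub (tendsto_inv_add_I.const_mul Complex.I)
  rw [mul_zero, sub_zero] at h
  refine h.congr' ?_
  filter_upwards [eventually_im_nonneg] with ξ hξ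
  have := add_I_ne_zero hξ
  field_simp
  ring

end Families

variable {A : ℝ} {u : ℝ → ℂ}

/-- The derivative in `x` of `∫_x^∞ e^{2iξ(z-x)} ρ(z) n(z) dz`. -/
theorem hasDerivAt_tailOp_expKer {ρ : ℝ → ℂ} (hρ : TailIntegrable ρ) {n : ℝ → ℂ → ℂ}
    (hn : HalfPlaneFamily n) {ξ : ℂ} (hξ : 0 ≤ ξ.im) (x : ℝ) :
    HasDerivAt (fun x => tailOp expKer ρ n x ξ)
      (-(2 * Complex.I * ξ) * tailOp expKer ρ n x ξ - ρ x * n x ξ) x := by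
  have hρc := hρ.cont
  have hnc := hn.cont ξ hξ
  have hker : ∀ x z, expKer x z ξ
      = Complex.exp (-(2 * Complex.I * ξ * x)) * Complex.exp (2 * Complex.I * ξ * z) := by
    intro x z
    rw [expKer, ← Complex.exp_add]
    congr 1
    push_cast
    ring
  have hint : ∀ x : ℝ, IntegrableOn
      (fun z : ℝ => Complex.exp (2 * Complex.I * ξ * z) * (ρ z * n z ξ)) (Set.Ioi x) := fun x => by
    refine ((halfPlaneKernel_exp.integrableOn hρ hn hξ x).const_mul
      (Complex.exp (2 * Complex.I * ξ * x))).congr (ae_of_all _ fun z => ?_)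
    have hee : Complex.exp (2 * Complex.I * ξ * x) *
        Complex.exp (-(2 * Complex.I * ξ * x)) = 1 := by
      rw [← Complex.exp_add, add_neg_cancel, Complex.exp_zero]
    beta_reduce
    rw [hker]
    linear_combination (Complex.exp (2 * Complex.I * ξ * z) * (ρ z * n z ξ)) * hee
  have heq : (fun x => tailOp expKer ρ n x ξ) = fun x : ℝ =>
      Complex.exp (-(2 * Complex.I * ξ * x)) *
        ∫ z in Set.Ioi x, Complex.exp (2 * Complex.I * ξ * z) * (ρ z * n z ξ) := by
    funext x
    rw [tailOp, ← integral_const_mul]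
    refine integral_congr_ae (ae_of_all _ fun z => ?_)
    simp only [hker]
    ring
  have he : HasDerivAt (fun x : ℝ => Complex.exp (-(2 * Complex.I * ξ * x)))
      (-(2 * Complex.I * ξ) * Complex.exp (-(2 * Complex.I * ξ * x))) x := by
    have := (((hasDerivAt_id (x : ℂ)).const_mul (2 * Complex.I * ξ)).neg.cexp).comp_ofReal
    refine this.congr_deriv ?_
    simp only [id, mul_one, Pi.neg_apply]
    ring
  have hval := congrFun heq x
  beta_reduce at hval
  rw [hval, heq]
  refine (he.mul (hasDerivAt_integral_Ioi (by fun_prop) hint x)).congr_deriv ?_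
  have : Complex.exp (-(2 * Complex.I * ξ * x)) * Complex.exp (2 * Complex.I * ξ * x) = 1 := by
    rw [← Complex.exp_add]; simp
  linear_combination (-(ρ x * n x ξ)) * this

/-- The solution normalized by `(1, 0)` at `+∞`, without its exponential factor and with the
spectral parameter reflected into the upper half-plane. -/
theorem StepLike.exists_left_family (hu : StepLike A u) : ∃ m₁ m₂ : ℝ → ℂ → ℂ,
    HalfPlaneFamily m₁ ∧ HalfPlaneFamily m₂ ∧
    (∀ η : ℂ, 0 ≤ η.im → ∀ x, HasDerivAt (fun x => m₁ x η) (u x * m₂ x η) x) ∧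
    (∀ η : ℂ, 0 ≤ η.im → ∀ x, HasDerivAt (fun x => m₂ x η)
      (refl u x * m₁ x η - 2 * Complex.I * η * m₂ x η) x) ∧
    (∀ η : ℂ, 0 ≤ η.im → Tendsto (fun x => m₁ x η) atTop (𝓝 1)) ∧
    (∀ η : ℂ, 0 ≤ η.im → Tendsto (fun x => m₂ x η) atTop (𝓝 0)) ∧
    (∀ x, Tendsto (m₁ x) upperInfty (𝓝 1)) ∧ (∀ x, Tendsto (m₂ x) upperInfty (𝓝 0)) := by
  obtain ⟨C, hC⟩ := hu.exists_bound
  have huc := hu.continuous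
  have hr := hu.tailIntegrable_refl
  have hk := halfPlaneKernel_left huc hC
  -- eliminating `m₂` leaves a scalar Volterra equation for `m₁`
  obtain ⟨N, hN, hNeq⟩ := hk.exists_solution hr (HalfPlaneFamily.const 1)
  have hM : HalfPlaneFamily (fun x ξ => -tailOp expKer (refl u) N x ξ) :=
    (halfPlaneKernel_exp.tailOp_family hr hN).neg
  have hNlim : ∀ x, Tendsto (N x) upperInfty (𝓝 1) := by
    intro x
    have h := hk.tendsto_upperInfty hr hN x fun z hz => by
      obtain ⟨B, hB⟩ := hN.bdd z
      have h1 := (tendsto_kerLeft huc hz.le).norm.mul_const B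
      rw [norm_zero, zero_mul] at h1
      refine squeeze_zero_norm' ?_ h1
      filter_upwards [eventually_im_nonneg] with ξ hξ
      rw [norm_mul]
      exact mul_le_mul_of_nonneg_left (hB ξ hξ z le_rfl) (norm_nonneg _)
    have h2 := (tendsto_const_nhds (x := (1 : ℂ))).add h
    rw [add_zero] at h2
    refine h2.congr' ?_
    filter_upwards [eventually_im_nonneg] with ξ hξ
    exact (hNeq ξ hξ x).symm
  refine ⟨N, _, hN, hM, fun η hη x => ?_, fun η hη x => ?_, fun η hη => ?_, fun η hη => ?_,
    hNlim, fun x => ?_⟩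
  · set Q : ℝ → ℂ := fun x => ∫ y in (0 : ℝ)..x, u y * Complex.exp (-(2 * Complex.I * η * y))
    have hQ : ∀ x, HasDerivAt Q (u x * Complex.exp (-(2 * Complex.I * η * x))) x := fun x =>
      hasDerivAt_primitive (f := fun y => u y * Complex.exp (-(2 * Complex.I * η * y)))
        (by fun_prop) x
    have hrc := hr.cont
    have hNc := hN.cont η hη
    have hker : ∀ x z, expKer x z η
        = Complex.exp (-(2 * Complex.I * η * x)) * Complex.exp (2 * Complex.I * η * z) := by
      intro x z
      rw [expKer, ← Complex.exp_add]
      congr 1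
      push_cast
      ring
    have hwi : ∀ x : ℝ, IntegrableOn
        (fun z : ℝ => Complex.exp (2 * Complex.I * η * z) * (refl u z * N z η)) (Set.Ioi x) :=
      fun x => by
      refine ((halfPlaneKernel_exp.integrableOn hr hN hη x).const_mul
        (Complex.exp (2 * Complex.I * η * x))).congr (ae_of_all _ fun z => ?_)
      have hee : Complex.exp (2 * Complex.I * η * x) *
          Complex.exp (-(2 * Complex.I * η * x)) = 1 := by
        rw [← Complex.exp_add, add_neg_cancel, Complex.exp_zero]
      beta_reduce
      rw [hker]
      linear_combination (Complex.exp (2 * Complex.I * η * z) * (refl u z * N z η)) * hee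
    have hQw : ∀ x z, kerLeft u x z η * refl u z * N z η
        = (Q z - Q x) * (Complex.exp (2 * Complex.I * η * z) * (refl u z * N z η)) := by
      intro x z
      rw [kerLeft_eq u huc]
      ring
    have hd := hasDerivAt_integral_Ioi_sub hQ
      (w := fun z => Complex.exp (2 * Complex.I * η * z) * (refl u z * N z η)) (by fun_prop) hwi
      (fun x => by simpa only [hQw] using hk.integrableOn hr hN hη x) x
    have heq : (fun x => N x η) = fun x => 1 + ∫ z in Set.Ioi x,
        (Q z - Q x) * (Complex.exp (2 * Complex.I * η * z) * (refl u z * N z η)) := by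
      funext x
      rw [hNeq η hη x]
      simp only [tailOp, hQw]
    rw [heq]
    refine (hd.const_add 1).congr_deriv ?_
    have : tailOp expKer (refl u) N x η = Complex.exp (-(2 * Complex.I * η * x)) *
        ∫ z in Set.Ioi x, Complex.exp (2 * Complex.I * η * z) * (refl u z * N z η) := by
      rw [tailOp, ← integral_const_mul]
      refine integral_congr_ae (ae_of_all _ fun z => ?_)
      simp only [hker]
      ring
    rw [this]
    ring
  · refine (hasDerivAt_tailOp_expKer hr hN hη x).neg.congr_deriv ?_
    ring
  · have h := (tendsto_const_nhds (x := (1 : ℂ))).add (hk.tendsto_atTop hr hN hη)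
    rw [add_zero] at h
    exact h.congr fun x => (hNeq η hη x).symm
  · simpa using (halfPlaneKernel_exp.tendsto_atTop hr hN hη).neg
  · -- the part with `N - 1` tends to zero by dominated convergence, the rest is oscillatory
    have h1 : Tendsto (tailOp expKer (refl u) (fun x ξ => N x ξ - 1) x) upperInfty (𝓝 0) := by
      refine halfPlaneKernel_exp.tendsto_upperInfty hr (hN.sub (.const 1)) x fun z hz => ?_
      have h1 := ((hNlim z).sub_const 1).norm
      rw [sub_self, norm_zero] at h1
      refine squeeze_zero_norm' ?_ h1
      filter_upwards [eventually_im_nonneg] with ξ hξ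
      rw [norm_mul]
      exact mul_le_of_le_one_left (norm_nonneg _)
        (norm_cexp_two_I_mul_le_one hξ (sub_nonneg.2 hz.le))
    have h2 := tendsto_integral_Ioi_exp hr.cont hr.integrableOn x
    have h3 := (h1.add h2).neg
    rw [add_zero, neg_zero] at h3
    refine h3.congr' ?_
    filter_upwards [eventually_im_nonneg] with ξ hξ
    rw [tailOp, tailOp,
      ← integral_add (halfPlaneKernel_exp.integrableOn hr (hN.sub (.const 1)) hξ x)]
    · congr 1
      refine integral_congr_ae (ae_of_all _ fun z => ?_)
      simp only [expKer]
      ring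
    · simpa [expKer, IntegrableOn] using halfPlaneKernel_exp.integrableOn hr (.const 1) hξ x

/-- The solution normalized by `(A/(2iξ), 1)` at `+∞`, without its exponential factor and with the
factor `ξ/(ξ+i)` that makes it bounded in the closed upper half-plane. -/
theorem StepLike.exists_right_family (hu : StepLike A u) : ∃ n₁ n₂ : ℝ → ℂ → ℂ,
    HalfPlaneFamily n₁ ∧ HalfPlaneFamily n₂ ∧
    (∀ ξ : ℂ, 0 ≤ ξ.im → ∀ x, HasDerivAt (fun x => n₁ x ξ)
      (-(2 * Complex.I * ξ) * n₁ x ξ + u x * n₂ x ξ) x) ∧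
    (∀ ξ : ℂ, 0 ≤ ξ.im → ∀ x, HasDerivAt (fun x => n₂ x ξ) (refl u x * n₁ x ξ) x) ∧
    (∀ ξ : ℂ, 0 ≤ ξ.im → Tendsto (fun x => n₁ x ξ) atTop
      (𝓝 (A / (2 * Complex.I) * (ξ + Complex.I)⁻¹))) ∧
    (∀ ξ : ℂ, 0 ≤ ξ.im → Tendsto (fun x => n₂ x ξ) atTop (𝓝 (ξ * (ξ + Complex.I)⁻¹))) ∧
    (∀ x, Tendsto (n₁ x) upperInfty (𝓝 0)) ∧ (∀ x, Tendsto (n₂ x) upperInfty (𝓝 1)) := by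
  obtain ⟨C, hC⟩ := hu.exists_bound
  have huc := hu.continuous
  have hr := hu.tailIntegrable_refl
  have hA := hu.tailIntegrable_sub
  have hk := halfPlaneKernel_right huc hC
  have h1f : HalfPlaneFamily fun _ _ => (1 : ℂ) := .const 1
  have hE := halfPlaneKernel_exp.tailOp_family hA h1f
  -- the inhomogeneity comes from the constant part `A` of `u` and the leading term of `n₂`
  set n₀ : ℝ → ℂ → ℂ := fun x ξ => A / (2 * Complex.I) * (ξ + Complex.I)⁻¹
    - ξ * (ξ + Complex.I)⁻¹ * tailOp expKer (fun x => u x - A) (fun _ _ => 1) x ξ with hn₀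
  have hn₀f : HalfPlaneFamily n₀ :=
    ((HalfPlaneFamily.const _).mul halfPlaneFamily_inv).sub (halfPlaneFamily_div.mul hE)
  obtain ⟨N, hN, hNeq⟩ := hk.exists_solution hr hn₀f
  have hM : HalfPlaneFamily (fun x ξ => ξ * (ξ + Complex.I)⁻¹
      - tailOp (fun _ _ _ => (1 : ℂ)) (refl u) N x ξ) :=
    halfPlaneFamily_div.sub (halfPlaneKernel_one.tailOp_family hr hN)
  have hNlim : ∀ x, Tendsto (N x) upperInfty (𝓝 0) := by
    intro x
    have h := hk.tendsto_upperInfty hr hN x fun z hz => by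
      obtain ⟨B, hB⟩ := hN.bdd z
      have h1 := (tendsto_kerRight huc hz.le).norm.mul_const B
      rw [norm_zero, zero_mul] at h1
      refine squeeze_zero_norm' ?_ h1
      filter_upwards [eventually_im_nonneg] with ξ hξ
      rw [norm_mul]
      exact mul_le_mul_of_nonneg_left (hB ξ hξ z le_rfl) (norm_nonneg _)
    have h0 : Tendsto (n₀ x) upperInfty (𝓝 0) := by
      have h2 := tendsto_integral_Ioi_exp hA.cont hA.integrableOn x
      have h3 := (tendsto_inv_add_I.const_mul ((A : ℂ) / (2 * Complex.I))).sub
        (tendsto_div_add_I.mul h2)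
      rw [mul_zero, mul_zero, sub_zero] at h3
      refine h3.congr fun ξ => ?_
      simp only [hn₀, tailOp, expKer, mul_one]
    have h2 := h0.add h
    rw [add_zero] at h2
    refine h2.congr' ?_
    filter_upwards [eventually_im_nonneg] with ξ hξ
    exact (hNeq ξ hξ x).symm
  refine ⟨N, _, hN, hM, fun ξ hξ x => ?_, fun ξ hξ x => ?_, fun ξ hξ => ?_, fun ξ hξ => ?_,
    hNlim, fun x => ?_⟩
  · set Q : ℝ → ℂ := fun x => ∫ y in (0 : ℝ)..x, u y * Complex.exp (2 * Complex.I * ξ * y)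
    have hQ : ∀ x, HasDerivAt Q (u x * Complex.exp (2 * Complex.I * ξ * x)) x := fun x =>
      hasDerivAt_primitive (f := fun y => u y * Complex.exp (2 * Complex.I * ξ * y))
        (by fun_prop) x
    have hrc := hr.cont
    have hNc := hN.cont ξ hξ
    have hwi : ∀ x : ℝ, IntegrableOn (fun z => refl u z * N z ξ) (Set.Ioi x) := fun x => by
      simpa using halfPlaneKernel_one.integrableOn hr hN hξ x
    have hee : ∀ x : ℝ, Complex.exp (-(2 * Complex.I * ξ * x)) *
        Complex.exp (2 * Complex.I * ξ * x) = 1 := fun x => by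
      rw [← Complex.exp_add]; simp
    have hQw : ∀ x z, kerRight u x z ξ * refl u z * N z ξ
        = Complex.exp (-(2 * Complex.I * ξ * x)) * ((Q z - Q x) * (refl u z * N z ξ)) := by
      intro x z
      rw [kerRight_eq u huc]
      ring
    have hd := hasDerivAt_integral_Ioi_sub hQ
      (w := fun z => refl u z * N z ξ) (by fun_prop) hwi
      (fun x => by
        refine ((hk.integrableOn hr hN hξ x).const_mul
          (Complex.exp (2 * Complex.I * ξ * x))).congr (ae_of_all _ fun z => ?_)
        simp only [hQw]
        linear_combination ((Q z - Q x) * (refl u z * N z ξ)) * hee x) x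
    have htl : ∀ x, tailOp (kerRight u) (refl u) N x ξ = Complex.exp (-(2 * Complex.I * ξ * x)) *
        ∫ z in Set.Ioi x, (Q z - Q x) * (refl u z * N z ξ) := by
      intro x
      rw [← integral_const_mul]
      simp only [tailOp, hQw]
    have heq : (fun x => N x ξ) = fun x => n₀ x ξ + Complex.exp (-(2 * Complex.I * ξ * x)) *
        ∫ z in Set.Ioi x, (Q z - Q x) * (refl u z * N z ξ) := by
      funext x
      rw [hNeq ξ hξ x, htl]
    have he : HasDerivAt (fun x : ℝ => Complex.exp (-(2 * Complex.I * ξ * x)))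
        (-(2 * Complex.I * ξ) * Complex.exp (-(2 * Complex.I * ξ * x))) x := by
      have := (((hasDerivAt_id (x : ℂ)).const_mul (2 * Complex.I * ξ)).neg.cexp).comp_ofReal
      refine this.congr_deriv ?_
      simp only [id, mul_one, Pi.neg_apply]
      ring
    have hn₀d : HasDerivAt (fun x => n₀ x ξ) (-(2 * Complex.I * ξ) * n₀ x ξ
        + ξ * (ξ + Complex.I)⁻¹ * u x) x := by
      refine (((hasDerivAt_tailOp_expKer hA h1f hξ x).const_mul
        (ξ * (ξ + Complex.I)⁻¹)).const_sub (A / (2 * Complex.I) * (ξ + Complex.I)⁻¹)).congr_deriv ?_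
      simp only [hn₀]
      field_simp [Complex.I_ne_zero]
      ring
    rw [hNeq ξ hξ x, htl]
    rw [heq]
    refine (hn₀d.add (he.mul hd)).congr_deriv ?_
    simp only [tailOp, one_mul]
    linear_combination (-u x * ∫ z in Set.Ioi x, refl u z * N z ξ) * hee x
  · have hrc := hr.cont
    have hNc := hN.cont ξ hξ
    have := (hasDerivAt_integral_Ioi (f := fun z => refl u z * N z ξ) (by fun_prop) (fun x => by
      simpa using halfPlaneKernel_one.integrableOn hr hN hξ x) x).const_sub
        (ξ * (ξ + Complex.I)⁻¹)
    simpa [tailOp] using this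
  · have h1 := (halfPlaneKernel_exp.tendsto_atTop hA h1f hξ).const_mul (ξ * (ξ + Complex.I)⁻¹)
    have h2 := (tendsto_const_nhds (x := (A : ℂ) / (2 * Complex.I) * (ξ + Complex.I)⁻¹)).sub h1
    have h := h2.add (hk.tendsto_atTop hr hN hξ)
    rw [add_zero, mul_zero, sub_zero] at h
    exact h.congr fun x => (hNeq ξ hξ x).symm
  · simpa using (halfPlaneKernel_one.tendsto_atTop hr hN hξ).const_sub (ξ * (ξ + Complex.I)⁻¹)
  · have h := halfPlaneKernel_one.tendsto_upperInfty hr hN x fun z hz => by simpa using hNlim z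
    simpa using tendsto_div_add_I.sub h

/-! ### Analytic continuation across the real axis and Liouville's theorem -/

/-- The integral of `f` along the boundary of the rectangle `[a, b] × [c, d]`. -/
noncomputable def rectBoundary (f : ℂ → ℂ) (a b c d : ℝ) : ℂ :=
  (∫ x : ℝ in a..b, f (x + c * Complex.I)) - (∫ x : ℝ in a..b, f (x + d * Complex.I))
    + Complex.I • (∫ y : ℝ in c..d, f (b + y * Complex.I))
    - Complex.I • (∫ y : ℝ in c..d, f (a + y * Complex.I))

/-- A function that is continuous on an open set and holomorphic there off the real axis is
holomorphic: a rectangle that crosses the real axis is cut along it. -/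
theorem differentiableOn_of_continuousOn_of_off_real {f : ℂ → ℂ} {U : Set ℂ} (hU : IsOpen U)
    (hc : ContinuousOn f U) (hd : ∀ ξ ∈ U, ξ.im ≠ 0 → DifferentiableAt ℂ f ξ) :
    DifferentiableOn ℂ f U := by
  refine (Complex.isConservativeOn_and_continuousOn_iff_isDifferentiableOn hU).1 ⟨?_, hc⟩
  have hmem : ∀ {a b c d : ℝ}, (Set.uIcc a b ×ℂ Set.uIcc c d ⊆ U) → ∀ x ∈ Set.uIcc a b,
      ∀ y ∈ Set.uIcc c d, (x : ℂ) + y * Complex.I ∈ U := by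
    intro a b c d h x hx y hy
    exact h (by simp [Complex.mem_reProdIm, hx, hy])
  have h1 : ∀ a b c d : ℝ, (Set.uIcc a b ×ℂ Set.uIcc c d ⊆ U) →
      (0 : ℝ) ∉ Set.Ioo (min c d) (max c d) → rectBoundary f a b c d = 0 := by
    intro a b c d h h0
    have := Complex.integral_boundary_rect_eq_zero_of_continuousOn_of_differentiableOn f
      (⟨a, c⟩ : ℂ) (⟨b, d⟩ : ℂ) (hc.mono h) (fun ξ hξ => by
        rw [Complex.mem_reProdIm] at hξ
        refine (hd ξ (h ?_) fun h' => h0 (h' ▸ hξ.2)).differentiableWithinAt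
        rw [Complex.mem_reProdIm]
        exact ⟨Set.Ioo_subset_Icc_self hξ.1, Set.Ioo_subset_Icc_self hξ.2⟩)
    simpa [rectBoundary] using this
  have h2 : ∀ a b c d : ℝ, (Set.uIcc a b ×ℂ Set.uIcc c d ⊆ U) → rectBoundary f a b c d = 0 := by
    intro a b c d h
    by_cases h0 : (0 : ℝ) ∈ Set.Ioo (min c d) (max c d)
    · have h0' : (0 : ℝ) ∈ Set.uIcc c d := Set.Ioo_subset_Icc_self h0
      have hc0 : Set.uIcc c 0 ⊆ Set.uIcc c d := Set.uIcc_subset_uIcc_left h0'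
      have hd0 : Set.uIcc 0 d ⊆ Set.uIcc c d := Set.uIcc_subset_uIcc_right h0'
      have e1 := h1 a b c 0 (fun ξ hξ => h ⟨hξ.1, hc0 hξ.2⟩) (by
        rcases le_total c 0 with h | h <;> simp [h])
      have e2 := h1 a b 0 d (fun ξ hξ => h ⟨hξ.1, hd0 hξ.2⟩) (by
        rcases le_total d 0 with h | h <;> simp [h])
      have hint : ∀ x ∈ Set.uIcc a b, ∀ s t : ℝ, Set.uIcc s t ⊆ Set.uIcc c d →
          IntervalIntegrable (fun y : ℝ => f (x + y * Complex.I)) volume s t := by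
        intro x hx s t hst
        refine ContinuousOn.intervalIntegrable (hc.comp (by fun_prop) fun y hy => ?_)
        exact hmem h x hx y (hst hy)
      have eb := intervalIntegral.integral_add_adjacent_intervals
        (hint b Set.right_mem_uIcc c 0 hc0) (hint b Set.right_mem_uIcc 0 d hd0)
      have ea := intervalIntegral.integral_add_adjacent_intervals
        (hint a Set.left_mem_uIcc c 0 hc0) (hint a Set.left_mem_uIcc 0 d hd0)
      unfold rectBoundary at e1 e2 ⊢
      rw [← ea, ← eb]
      simp only [smul_eq_mul] at e1 e2 ⊢
      linear_combination e1 + e2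
    · exact h1 a b c d h h0
  intro z w hzw
  have := h2 z.re w.re z.im w.im hzw
  rw [eq_neg_iff_add_eq_zero, Complex.wedgeIntegral_add_wedgeIntegral_eq]
  exact this

/-- The filter of neighbourhoods of infinity in the closed lower half-plane. -/
noncomputable abbrev lowerInfty : Filter ℂ := cocompact ℂ ⊓ 𝓟 {ξ : ℂ | ξ.im ≤ 0}

/-- An entire function with `f(ξ)/ξ → c` at infinity is affine. -/
theorem eq_affine_of_tendsto {f : ℂ → ℂ} (hf : Differentiable ℂ f) {c : ℂ}
    (hlim : Tendsto (fun ξ => f ξ * ξ⁻¹) (cocompact ℂ) (𝓝 c)) (ξ : ℂ) : f ξ = c * ξ + f 0 := by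
  have hd : Differentiable ℂ (dslope f 0) := by
    rw [← differentiableOn_univ] at hf ⊢
    exact (Complex.differentiableOn_dslope univ_mem).2 hf
  have hinv : Tendsto (fun ξ : ℂ => ξ⁻¹) (cocompact ℂ) (𝓝 0) :=
    tendsto_inv₀_cobounded.mono_left (Metric.cobounded_eq_cocompact (α := ℂ)).ge
  have ht : Tendsto (dslope f 0) (cocompact ℂ) (𝓝 c) := by
    have h := hlim.sub (hinv.const_mul (f 0))
    rw [mul_zero, sub_zero] at h
    refine h.congr' ?_
    have : {(0 : ℂ)}ᶜ ∈ cocompact ℂ := isCompact_singleton.compl_mem_cocompact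
    filter_upwards [this] with ξ hξ
    rw [dslope_of_ne _ hξ, slope_def_field, sub_zero]
    ring
  have h := hd.apply_eq_of_tendsto_cocompact ξ ht
  by_cases hξ : ξ = 0
  · simp [hξ]
  · rw [dslope_of_ne _ hξ, slope_def_field, sub_zero, div_eq_iff hξ] at h
    linear_combination h

/-- Two functions, analytic in the upper and in the lower half-plane, that have equal boundary
values on `ℝ \ {0}`, are bounded near `0` and asymptotic to `cξ` at infinity, are the same affine
function. -/
theorem eq_affine_of_glue {f g : ℂ → ℂ} {c : ℂ}
    (hf : ContinuousOn f {ξ : ℂ | 0 ≤ ξ.im ∧ ξ ≠ 0}) (hfd : DifferentiableOn ℂ f {ξ : ℂ | 0 < ξ.im})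
    (hg : ContinuousOn g {ξ : ℂ | ξ.im ≤ 0 ∧ ξ ≠ 0}) (hgd : DifferentiableOn ℂ g {ξ : ℂ | ξ.im < 0})
    (hfg : ∀ ξ : ℂ, ξ.im = 0 → ξ ≠ 0 → f ξ = g ξ) {B : ℝ}
    (hfB : ∀ᶠ ξ in 𝓝 (0 : ℂ), 0 ≤ ξ.im → ξ ≠ 0 → ‖f ξ‖ ≤ B)
    (hgB : ∀ᶠ ξ in 𝓝 (0 : ℂ), ξ.im ≤ 0 → ξ ≠ 0 → ‖g ξ‖ ≤ B)
    (hfc : Tendsto (fun ξ => f ξ * ξ⁻¹) upperInfty (𝓝 c))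
    (hgc : Tendsto (fun ξ => g ξ * ξ⁻¹) lowerInfty (𝓝 c)) :
    ∃ d : ℂ, (∀ ξ : ℂ, 0 ≤ ξ.im → ξ ≠ 0 → f ξ = c * ξ + d) ∧
      ∀ ξ : ℂ, ξ.im ≤ 0 → ξ ≠ 0 → g ξ = c * ξ + d := by
  classical
  set F : ℂ → ℂ := fun ξ => if 0 ≤ ξ.im then f ξ else g ξ with hF
  have hFf : ∀ ξ : ℂ, 0 ≤ ξ.im → F ξ = f ξ := fun ξ h => if_pos h
  have hFg : ∀ ξ : ℂ, ξ.im ≤ 0 → ξ ≠ 0 → F ξ = g ξ := fun ξ h h0 => by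
    by_cases h' : 0 ≤ ξ.im
    · rw [hFf ξ h', hfg ξ (le_antisymm h h') h0]
    · exact if_neg h'
  have hup : ∀ ξ : ℂ, 0 < ξ.im → {w : ℂ | 0 < w.im} ∈ 𝓝 ξ := fun ξ h =>
    (isOpen_lt continuous_const Complex.continuous_im).mem_nhds h
  have hlo : ∀ ξ : ℂ, ξ.im < 0 → {w : ℂ | w.im < 0} ∈ 𝓝 ξ := fun ξ h =>
    (isOpen_lt Complex.continuous_im continuous_const).mem_nhds h
  have hdiff : ∀ ξ : ℂ, ξ.im ≠ 0 → DifferentiableAt ℂ F ξ := by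
    intro ξ hξ
    rcases lt_or_gt_of_ne hξ with h | h
    · refine (hgd.differentiableAt (hlo ξ h)).congr_of_eventuallyEq ?_
      filter_upwards [hlo ξ h] with w hw
      exact if_neg (not_le.2 hw)
    · refine (hfd.differentiableAt (hup ξ h)).congr_of_eventuallyEq ?_
      filter_upwards [hup ξ h] with w hw
      exact if_pos (le_of_lt hw)
  have hcont : ContinuousOn F {(0 : ℂ)}ᶜ := by
    intro ξ hξ
    by_cases him : ξ.im = 0
    · have h1 : ContinuousWithinAt F {ξ : ℂ | 0 ≤ ξ.im ∧ ξ ≠ 0} ξ :=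
        (hf ξ ⟨him.ge, hξ⟩).congr (fun w hw => hFf w hw.1) (hFf ξ him.ge)
      have h2 : ContinuousWithinAt F {ξ : ℂ | ξ.im ≤ 0 ∧ ξ ≠ 0} ξ :=
        (hg ξ ⟨him.le, hξ⟩).congr (fun w hw => hFg w hw.1 hw.2) (hFg ξ him.le hξ)
      refine (h1.union h2).mono fun w hw => ?_
      rcases le_total 0 w.im with h | h
      · exact Or.inl ⟨h, hw⟩
      · exact Or.inr ⟨h, hw⟩
    · exact (hdiff ξ him).continuousAt.continuousWithinAt
  have hd : DifferentiableOn ℂ F {(0 : ℂ)}ᶜ :=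
    differentiableOn_of_continuousOn_of_off_real isOpen_compl_singleton hcont
      fun ξ _ h => hdiff ξ h
  -- remove the singularity at the origin
  obtain ⟨s, hs, hsB⟩ : ∃ s ∈ 𝓝 (0 : ℂ), ∀ ξ ∈ s, ξ ≠ 0 → ‖F ξ‖ ≤ B := by
    refine ⟨_, hfB.and hgB, fun ξ hξ h0 => ?_⟩
    rcases le_total 0 ξ.im with h | h
    · rw [hFf ξ h]; exact hξ.1 h h0
    · rw [hFg ξ h h0]; exact hξ.2 h h0
  set G := Function.update F 0 (limUnder (𝓝[≠] 0) F) with hG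
  have hGd : Differentiable ℂ G := by
    have h1 : DifferentiableOn ℂ G s := by
      refine Complex.differentiableOn_update_limUnder_of_bddAbove hs (hd.mono fun ξ hξ => hξ.2) ?_
      refine ⟨B, ?_⟩
      rintro _ ⟨ξ, hξ, rfl⟩
      exact hsB ξ hξ.1 hξ.2
    intro ξ
    by_cases h0 : ξ = 0
    · rw [h0]; exact h1.differentiableAt hs
    · refine (hd.differentiableAt (isOpen_compl_singleton.mem_nhds h0)).congr_of_eventuallyEq ?_
      filter_upwards [isOpen_compl_singleton.mem_nhds h0] with w hw
      exact Function.update_of_ne hw _ _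
  have hGF : ∀ ξ : ℂ, ξ ≠ 0 → G ξ = F ξ := fun ξ h => Function.update_of_ne h _ _
  have h0c : ∀ᶠ ξ in cocompact ℂ, ξ ≠ 0 := isCompact_singleton.compl_mem_cocompact
  have hlim : Tendsto (fun ξ => G ξ * ξ⁻¹) (cocompact ℂ) (𝓝 c) := by
    have hle : cocompact ℂ ≤ upperInfty ⊔ lowerInfty := by
      rw [← inf_sup_left, sup_principal]
      refine le_inf le_rfl (le_principal_iff.2 (univ_mem' fun ξ => ?_))
      exact (le_total 0 ξ.im).imp id id
    refine Tendsto.mono_left (tendsto_sup.2 ⟨?_, ?_⟩) hle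
    · refine hfc.congr' ?_
      filter_upwards [eventually_im_nonneg, h0c.filter_mono inf_le_left] with ξ h h0
      rw [hGF ξ h0, hFf ξ h]
    · refine hgc.congr' ?_
      have : ∀ᶠ ξ in lowerInfty, ξ.im ≤ 0 :=
        eventually_inf_principal.2 (Eventually.of_forall fun _ h => h)
      filter_upwards [this, h0c.filter_mono inf_le_left] with ξ h h0
      rw [hGF ξ h0, hFg ξ h h0]
  refine ⟨G 0, fun ξ h h0 => ?_, fun ξ h h0 => ?_⟩
  · rw [← eq_affine_of_tendsto hGd hlim, hGF ξ h0, hFf ξ h]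
  · rw [← eq_affine_of_tendsto hGd hlim, hGF ξ h0, hFg ξ h h0]

/-! ### Jost solutions: uniqueness, symmetry, existence -/

section Jost

variable {A : ℝ} {u : ℝ → ℂ} {ξ : ℂ}

theorem continuous_laxX (hu : Continuous u) (ξ : ℂ) : Continuous (laxX u ξ) := by
  have h := continuous_refl hu
  refine continuous_matrix fun i j => ?_
  fin_cases i <;> fin_cases j
  · exact continuous_const
  · exact hu
  · exact h
  · exact continuous_const

theorem laxX_trace (u : ℝ → ℂ) (ξ : ℂ) (x : ℝ) : laxX u ξ x 0 0 + laxX u ξ x 1 1 = 0 := by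
  simp [laxX]

theorem solvesLaxX_iff {v : ℝ → Fin 2 → ℂ} : SolvesLaxX u ξ v ↔ ∀ x,
    HasDerivAt (fun x => v x 0) (-Complex.I * ξ * v x 0 + u x * v x 1) x ∧
    HasDerivAt (fun x => v x 1) (refl u x * v x 0 + Complex.I * ξ * v x 1) x := by
  refine forall_congr' fun x => ?_
  rw [hasDerivAt_pi, Fin.forall_fin_two]
  simp [laxX, refl, Matrix.mulVec, dotProduct, Fin.sum_univ_two]

theorem SolvesLaxX.smul {v : ℝ → Fin 2 → ℂ} (hv : SolvesLaxX u ξ v) (c : ℂ) :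
    SolvesLaxX u ξ fun x => c • v x := fun x => by
  rw [Matrix.mulVec_smul]
  exact (hv x).const_smul c

theorem wr_eq_of_solvesLaxX {v w : ℝ → Fin 2 → ℂ} (hv : SolvesLaxX u ξ v) (hw : SolvesLaxX u ξ w)
    (x y : ℝ) : wr (v x) (w x) = wr (v y) (w y) :=
  wr_eq_of_hasDerivAt (laxX_trace u ξ) hv hw x y

theorem solvesLaxX_unique (hu : Continuous u) {v w : ℝ → Fin 2 → ℂ} (hv : SolvesLaxX u ξ v)
    (hw : SolvesLaxX u ξ w) {x₀ : ℝ} (h : v x₀ = w x₀) : v = w :=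
  linear_ode_unique (continuous_laxX hu ξ) (laxX_trace u ξ) hv hw h

/-- Solutions with vanishing Wronskian are proportional. -/
theorem exists_eq_smul_of_solvesLaxX (hu : Continuous u) {v w : ℝ → Fin 2 → ℂ}
    (hv : SolvesLaxX u ξ v) (hw : SolvesLaxX u ξ w) (hw0 : w 0 ≠ 0) (h : wr (v 0) (w 0) = 0) :
    ∃ c : ℂ, ∀ x, v x = c • w x := by
  obtain ⟨c, hc⟩ := exists_eq_smul_of_wr_eq_zero hw0 h
  exact ⟨c, fun x => congrFun (solvesLaxX_unique hu hv (hw.smul c) hc) x⟩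

/-- A solution is determined by its leading behaviour `g v → c` in a direction in which `1/g` stays
bounded, since the difference of two candidates is a multiple of either of them. -/
theorem solvesLaxX_unique_of_tendsto (hu : Continuous u) {l : Filter ℝ} [l.NeBot] {g : ℝ → ℂ}
    (hg : ∀ᶠ x in l, 1 ≤ ‖g x‖) {c : Fin 2 → ℂ} (hc : c ≠ 0)
    {v w : ℝ → Fin 2 → ℂ} (hv : SolvesLaxX u ξ v) (hw : SolvesLaxX u ξ w)
    (hvl : Tendsto (fun x => g x • v x) l (𝓝 c)) (hwl : Tendsto (fun x => g x • w x) l (𝓝 c)) :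
    v = w := by
  set d : ℝ → Fin 2 → ℂ := fun x => v x - w x with hd
  have hds : SolvesLaxX u ξ d := fun x => by
    have := (hv x).sub (hw x)
    rwa [← Matrix.mulVec_sub] at this
  have hdl : Tendsto (fun x => g x • d x) l (𝓝 0) := by
    have := hvl.sub hwl
    rw [sub_self] at this
    exact this.congr fun x => (smul_sub _ _ _).symm
  have hwr : wr (d 0) (w 0) = 0 := by
    have h1 : Tendsto (fun x => wr (g x • d x) (g x • w x)) l (𝓝 0) := by
      simpa [wr] using tendsto_wr hdl hwl
    have h2 : Tendsto (fun _ : ℝ => wr (d 0) (w 0)) l (𝓝 0) := by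
      refine squeeze_zero_norm' ?_ (tendsto_zero_iff_norm_tendsto_zero.1 h1)
      filter_upwards [hg] with x hx
      rw [wr_smul_left, wr_smul_right, wr_eq_of_solvesLaxX hds hw 0 x, ← mul_assoc, norm_mul,
        norm_mul]
      exact le_mul_of_one_le_left (norm_nonneg _) (by nlinarith)
    exact tendsto_nhds_unique tendsto_const_nhds h2
  have hw0 : w 0 ≠ 0 := by
    intro h
    have : w = fun x => (0 : ℂ) • w x := solvesLaxX_unique hu hw (hw.smul 0) (x₀ := 0) (by simp [h])
    have hz : ∀ x, w x = 0 := fun x => by rw [this]; simp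
    refine hc (tendsto_nhds_unique hwl ?_)
    simp [hz]
  obtain ⟨a, ha⟩ := exists_eq_smul_of_solvesLaxX hu hds hw hw0 hwr
  have hac : a • c = 0 := by
    refine tendsto_nhds_unique (hwl.const_smul a) (hdl.congr fun x => ?_)
    rw [ha, smul_comm]
  have ha0 : a = 0 := (smul_eq_zero.1 hac).resolve_right hc
  funext x
  have := ha x
  rw [ha0, zero_smul, hd] at this
  exact sub_eq_zero.1 this

theorem one_le_norm_exp_of_re_nonneg {z : ℂ} (h : 0 ≤ z.re) : 1 ≤ ‖Complex.exp z‖ := by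
  rw [Complex.norm_exp]; exact Real.one_le_exp h

theorem eventually_one_le_exp_atBot (hξ : 0 ≤ ξ.im) :
    ∀ᶠ x : ℝ in atBot, 1 ≤ ‖Complex.exp (Complex.I * ξ * x)‖ := by
  filter_upwards [eventually_le_atBot 0] with x hx
  refine one_le_norm_exp_of_re_nonneg ?_
  simp; nlinarith

theorem eventually_one_le_exp_neg_atBot (hξ : ξ.im ≤ 0) :
    ∀ᶠ x : ℝ in atBot, 1 ≤ ‖Complex.exp (-(Complex.I * ξ * x))‖ := by
  filter_upwards [eventually_le_atBot 0] with x hx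
  refine one_le_norm_exp_of_re_nonneg ?_
  simp; nlinarith

theorem eventually_one_le_exp_atTop (hξ : ξ.im ≤ 0) :
    ∀ᶠ x : ℝ in atTop, 1 ≤ ‖Complex.exp (Complex.I * ξ * x)‖ := by
  filter_upwards [eventually_ge_atTop 0] with x hx
  refine one_le_norm_exp_of_re_nonneg ?_
  simp; nlinarith

theorem eventually_one_le_exp_neg_atTop (hξ : 0 ≤ ξ.im) :
    ∀ᶠ x : ℝ in atTop, 1 ≤ ‖Complex.exp (-(Complex.I * ξ * x))‖ := by
  filter_upwards [eventually_ge_atTop 0] with x hx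
  refine one_le_norm_exp_of_re_nonneg ?_
  simp; nlinarith

theorem vec_one_left_ne (c : ℂ) : ![1, c] ≠ (0 : Fin 2 → ℂ) := fun h => by
  simpa using congrFun h 0

theorem vec_one_right_ne (c : ℂ) : ![c, 1] ≠ (0 : Fin 2 → ℂ) := fun h => by
  simpa using congrFun h 1

theorem jostMinus₁_eq (hu : Continuous u) (hξ : 0 ≤ ξ.im) {v : ℝ → Fin 2 → ℂ}
    (hv : IsJostMinus₁ A u ξ v) : jostMinus₁ A u ξ = v :=
  have h : IsJostMinus₁ A u ξ (jostMinus₁ A u ξ) := Classical.epsilon_spec ⟨v, hv⟩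
  solvesLaxX_unique_of_tendsto hu (eventually_one_le_exp_atBot hξ) (vec_one_left_ne _) h.1 hv.1
    h.2 hv.2

theorem jostMinus₂_eq (hu : Continuous u) (hξ : ξ.im ≤ 0) {v : ℝ → Fin 2 → ℂ}
    (hv : IsJostMinus₂ u ξ v) : jostMinus₂ u ξ = v :=
  have h : IsJostMinus₂ u ξ (jostMinus₂ u ξ) := Classical.epsilon_spec ⟨v, hv⟩
  solvesLaxX_unique_of_tendsto hu (eventually_one_le_exp_neg_atBot hξ) (vec_one_right_ne _) h.1 hv.1
    h.2 hv.2

theorem jostPlus₁_eq (hu : Continuous u) (hξ : ξ.im ≤ 0) {v : ℝ → Fin 2 → ℂ}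
    (hv : IsJostPlus₁ u ξ v) : jostPlus₁ u ξ = v :=
  have h : IsJostPlus₁ u ξ (jostPlus₁ u ξ) := Classical.epsilon_spec ⟨v, hv⟩
  solvesLaxX_unique_of_tendsto hu (eventually_one_le_exp_atTop hξ) (vec_one_left_ne _) h.1 hv.1
    h.2 hv.2

theorem jostPlus₂_eq (hu : Continuous u) (hξ : 0 ≤ ξ.im) {v : ℝ → Fin 2 → ℂ}
    (hv : IsJostPlus₂ A u ξ v) : jostPlus₂ A u ξ = v :=
  have h : IsJostPlus₂ A u ξ (jostPlus₂ A u ξ) := Classical.epsilon_spec ⟨v, hv⟩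
  solvesLaxX_unique_of_tendsto hu (eventually_one_le_exp_neg_atTop hξ) (vec_one_right_ne _) h.1 hv.1
    h.2 hv.2

/-- The nonlocal symmetry `v(x) ↦ σ₁ conj v(-x)` of the scattering problem; it maps solutions for
`ξ` to solutions for `-conj ξ`. -/
noncomputable def flipConj (v : ℝ → Fin 2 → ℂ) (x : ℝ) : Fin 2 → ℂ :=
  ![(starRingEnd ℂ) (v (-x) 1), (starRingEnd ℂ) (v (-x) 0)]

theorem hasDerivAt_conj_comp_neg {f : ℝ → ℂ} {f' : ℂ} {x : ℝ} (hf : HasDerivAt f f' (-x)) :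
    HasDerivAt (fun x => (starRingEnd ℂ) (f (-x))) (-(starRingEnd ℂ) f') x := by
  have h1 : HasDerivAt (fun x : ℝ => f (-x)) (-f') x := by
    have h := hf.scomp x (hasDerivAt_neg x)
    rw [neg_one_smul] at h
    exact h
  simpa using h1.star

theorem SolvesLaxX.flipConj {v : ℝ → Fin 2 → ℂ} (hv : SolvesLaxX u ξ v) :
    SolvesLaxX u (-(starRingEnd ℂ) ξ) (flipConj v) := by
  rw [solvesLaxX_iff] at hv ⊢
  intro x
  obtain ⟨h0, h1⟩ := hv (-x)
  constructor
  · refine (hasDerivAt_conj_comp_neg h1).congr_deriv ?_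
    simp [NonlocalLPD.flipConj, refl]
  · refine (hasDerivAt_conj_comp_neg h0).congr_deriv ?_
    simp [NonlocalLPD.flipConj, refl]

theorem tendsto_flipConj {l l' : Filter ℝ} (hl : Tendsto (fun x : ℝ => -x) l l') {g g' : ℝ → ℂ}
    (hgg : ∀ x, g' x = (starRingEnd ℂ) (g (-x))) {v : ℝ → Fin 2 → ℂ} {c c' : Fin 2 → ℂ}
    (h0 : c' 0 = (starRingEnd ℂ) (c 1)) (h1 : c' 1 = (starRingEnd ℂ) (c 0))
    (h : Tendsto (fun x => g x • v x) l' (𝓝 c)) :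
    Tendsto (fun x => g' x • flipConj v x) l (𝓝 c') := by
  rw [tendsto_pi_nhds] at h ⊢
  rw [Fin.forall_fin_two]
  have hc := Complex.continuous_conj
  constructor
  · rw [h0]
    refine ((hc.tendsto _).comp ((h 1).comp hl)).congr fun x => ?_
    simp [flipConj, hgg]
  · rw [h1]
    refine ((hc.tendsto _).comp ((h 0).comp hl)).congr fun x => ?_
    simp [flipConj, hgg]

theorem IsJostPlus₁.flipConj {v : ℝ → Fin 2 → ℂ} (hv : IsJostPlus₁ u ξ v) :
    IsJostMinus₂ u (-(starRingEnd ℂ) ξ) (flipConj v) := by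
  refine ⟨hv.1.flipConj, tendsto_flipConj tendsto_neg_atBot_atTop (fun x => ?_) ?_ ?_ hv.2⟩
  · rw [← Complex.exp_conj]; simp
  · simp
  · simp

theorem hasDerivAt_cexp_mul (c : ℂ) (x : ℝ) :
    HasDerivAt (fun x : ℝ => Complex.exp (c * x)) (c * Complex.exp (c * x)) x := by
  have := (((hasDerivAt_id (x : ℂ)).const_mul c).cexp).comp_ofReal
  refine this.congr_deriv ?_
  simp only [id, mul_one]
  ring

theorem exp_mul_exp_neg (z : ℂ) : Complex.exp z * Complex.exp (-z) = 1 := by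
  rw [← Complex.exp_add, add_neg_cancel, Complex.exp_zero]

/-- The Jost solution `φ₊⁽¹⁾` from the Volterra solution. -/
theorem isJostPlus₁_of_family {m₁ m₂ : ℝ → ℂ}
    (h1 : ∀ x, HasDerivAt m₁ (u x * m₂ x) x)
    (h2 : ∀ x, HasDerivAt m₂ (refl u x * m₁ x + 2 * Complex.I * ξ * m₂ x) x)
    (hl1 : Tendsto m₁ atTop (𝓝 1)) (hl2 : Tendsto m₂ atTop (𝓝 0)) :
    IsJostPlus₁ u ξ fun x : ℝ => Complex.exp (-(Complex.I * ξ * x)) • ![m₁ x, m₂ x] := by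
  have he : ∀ x : ℝ, HasDerivAt (fun x : ℝ => Complex.exp (-(Complex.I * ξ * x)))
      (-(Complex.I * ξ) * Complex.exp (-(Complex.I * ξ * x))) x := fun x => by
    have := hasDerivAt_cexp_mul (-(Complex.I * ξ)) x
    simpa only [neg_mul] using this
  refine ⟨solvesLaxX_iff.2 fun x => ⟨?_, ?_⟩, ?_⟩
  · refine ((he x).mul (h1 x)).congr_deriv ?_
    simp; ring
  · refine ((he x).mul (h2 x)).congr_deriv ?_
    simp; ring
  · have : Tendsto (fun x => ![m₁ x, m₂ x]) atTop (𝓝 ![1, 0]) := by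
      rw [tendsto_pi_nhds, Fin.forall_fin_two]
      exact ⟨hl1, hl2⟩
    refine this.congr fun x => ?_
    rw [smul_smul, exp_mul_exp_neg, one_smul]

/-- The Jost solution `φ₊⁽²⁾` from the Volterra solution. -/
theorem isJostPlus₂_of_family {n₁ n₂ : ℝ → ℂ} (hξ : 0 ≤ ξ.im) (hξ0 : ξ ≠ 0)
    (h1 : ∀ x, HasDerivAt n₁ (-(2 * Complex.I * ξ) * n₁ x + u x * n₂ x) x)
    (h2 : ∀ x, HasDerivAt n₂ (refl u x * n₁ x) x)
    (hl1 : Tendsto n₁ atTop (𝓝 (A / (2 * Complex.I) * (ξ + Complex.I)⁻¹)))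
    (hl2 : Tendsto n₂ atTop (𝓝 (ξ * (ξ + Complex.I)⁻¹))) :
    IsJostPlus₂ A u ξ fun x : ℝ =>
      (Complex.exp (Complex.I * ξ * x) * ((ξ + Complex.I) / ξ)) • ![n₁ x, n₂ x] := by
  have he := fun x : ℝ => (hasDerivAt_cexp_mul (Complex.I * ξ) x).mul_const ((ξ + Complex.I) / ξ)
  have hI := add_I_ne_zero hξ
  refine ⟨solvesLaxX_iff.2 fun x => ⟨?_, ?_⟩, ?_⟩
  · refine ((he x).mul (h1 x)).congr_deriv ?_
    simp; ring
  · refine ((he x).mul (h2 x)).congr_deriv ?_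
    simp; ring
  · have : Tendsto (fun x => ((ξ + Complex.I) / ξ) • ![n₁ x, n₂ x]) atTop
        (𝓝 ![(A : ℂ) / (2 * Complex.I * ξ), 1]) := by
      rw [tendsto_pi_nhds, Fin.forall_fin_two]
      constructor
      · have := hl1.const_mul ((ξ + Complex.I) / ξ)
        have hv : (ξ + Complex.I) / ξ * (A / (2 * Complex.I) * (ξ + Complex.I)⁻¹)
            = (A : ℂ) / (2 * Complex.I * ξ) := by field_simp
        rw [hv] at this
        simpa using this
      · have := hl2.const_mul ((ξ + Complex.I) / ξ)
        have hv : (ξ + Complex.I) / ξ * (ξ * (ξ + Complex.I)⁻¹) = 1 := by field_simp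
        rw [hv] at this
        simpa using this
    refine this.congr fun x => ?_
    rw [smul_smul, ← mul_assoc, mul_comm (Complex.exp _), exp_mul_exp_neg, one_mul]

end Jost

/-- The analytic description of the Jost solutions `φ₊⁽¹⁾`, `φ₋⁽²⁾`, `φ₊⁽²⁾` by Volterra
solutions. -/
theorem StepLike.exists_jost {A : ℝ} {u : ℝ → ℂ} (hu : StepLike A u) :
    ∃ m₁ m₂ n₁ n₂ : ℝ → ℂ → ℂ, (HalfPlaneFamily m₁ ∧ HalfPlaneFamily m₂ ∧
      HalfPlaneFamily n₁ ∧ HalfPlaneFamily n₂) ∧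
    ((∀ x, Tendsto (m₁ x) upperInfty (𝓝 1)) ∧ (∀ x, Tendsto (m₂ x) upperInfty (𝓝 0)) ∧
      (∀ x, Tendsto (n₁ x) upperInfty (𝓝 0)) ∧ (∀ x, Tendsto (n₂ x) upperInfty (𝓝 1))) ∧
    (∀ ξ : ℂ, ξ.im ≤ 0 → IsJostPlus₁ u ξ fun x : ℝ =>
      Complex.exp (-(Complex.I * ξ * x)) • ![m₁ x (-ξ), m₂ x (-ξ)]) ∧
    (∀ ξ : ℂ, ξ.im ≤ 0 → IsJostMinus₂ u ξ fun x : ℝ => Complex.exp (Complex.I * ξ * x) •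
      ![(starRingEnd ℂ) (m₂ (-x) ((starRingEnd ℂ) ξ)),
        (starRingEnd ℂ) (m₁ (-x) ((starRingEnd ℂ) ξ))]) ∧
    (∀ ξ : ℂ, 0 ≤ ξ.im → ξ ≠ 0 → IsJostPlus₂ A u ξ fun x : ℝ =>
      (Complex.exp (Complex.I * ξ * x) * ((ξ + Complex.I) / ξ)) • ![n₁ x ξ, n₂ x ξ]) := by
  obtain ⟨m₁, m₂, hm₁, hm₂, hd₁, hd₂, hl₁, hl₂, hi₁, hi₂⟩ := hu.exists_left_family
  obtain ⟨n₁, n₂, hn₁, hn₂, hd₁', hd₂', hl₁', hl₂', hi₁', hi₂'⟩ := hu.exists_right_family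
  have hplus : ∀ ξ : ℂ, ξ.im ≤ 0 → IsJostPlus₁ u ξ fun x : ℝ =>
      Complex.exp (-(Complex.I * ξ * x)) • ![m₁ x (-ξ), m₂ x (-ξ)] := by
    intro ξ hξ
    have hξ' : 0 ≤ (-ξ).im := by simpa using hξ
    refine isJostPlus₁_of_family (hd₁ _ hξ') (fun x => ?_) (hl₁ _ hξ') (hl₂ _ hξ')
    refine (hd₂ _ hξ' x).congr_deriv ?_
    ring
  refine ⟨m₁, m₂, n₁, n₂, ⟨hm₁, hm₂, hn₁, hn₂⟩, ⟨hi₁, hi₂, hi₁', hi₂'⟩, hplus,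
    fun ξ hξ => ?_, fun ξ hξ hξ0 => ?_⟩
  · have h := (hplus (-(starRingEnd ℂ) ξ) (by simpa using hξ)).flipConj
    simp only [map_neg, Complex.conj_conj, neg_neg] at h
    convert h using 1
    funext x
    have : Complex.exp (Complex.I * ξ * x) = (starRingEnd ℂ)
        (Complex.exp (-(Complex.I * -(starRingEnd ℂ) ξ * ((-x : ℝ) : ℂ)))) := by
      rw [← Complex.exp_conj]; simp
    ext i
    fin_cases i
    · simp [flipConj, this]
    · simp [flipConj, this]
  · exact isJostPlus₂_of_family hξ hξ0 (hd₁' ξ hξ) (hd₂' ξ hξ) (hl₁' ξ hξ) (hl₂' ξ hξ)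

/-! ### Reflectionless data: the column `φ₊⁽²⁾` is rational in `ξ` -/

section LowerHalfPlane

variable {n : ℝ → ℂ → ℂ} {x : ℝ} {c : ℂ}

theorem HalfPlaneFamily.continuousOn_comp_neg (hn : HalfPlaneFamily n) (x : ℝ) :
    ContinuousOn (fun ξ => n x (-ξ)) {ξ : ℂ | ξ.im ≤ 0} :=
  (hn.contOn x).comp continuous_neg.continuousOn fun ξ hξ => by simpa using hξ

theorem HalfPlaneFamily.differentiableOn_comp_neg (hn : HalfPlaneFamily n) (x : ℝ) :
    DifferentiableOn ℂ (fun ξ => n x (-ξ)) {ξ : ℂ | ξ.im < 0} :=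
  (hn.diffOn x).comp differentiable_neg.differentiableOn fun ξ hξ => by simpa using hξ

theorem HalfPlaneFamily.continuousOn_conj (hn : HalfPlaneFamily n) (x : ℝ) :
    ContinuousOn (fun ξ => (starRingEnd ℂ) (n x ((starRingEnd ℂ) ξ))) {ξ : ℂ | ξ.im ≤ 0} :=
  Complex.continuous_conj.comp_continuousOn
    ((hn.contOn x).comp Complex.continuous_conj.continuousOn fun ξ hξ => by simpa using hξ)

theorem HalfPlaneFamily.differentiableOn_conj (hn : HalfPlaneFamily n) (x : ℝ) :
    DifferentiableOn ℂ (fun ξ => (starRingEnd ℂ) (n x ((starRingEnd ℂ) ξ))) {ξ : ℂ | ξ.im < 0} := by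
  intro ξ hξ
  have hmem : (starRingEnd ℂ) ξ ∈ {ξ : ℂ | 0 < ξ.im} := by simpa using hξ
  have h := ((hn.diffOn x).differentiableAt
    ((isOpen_lt continuous_const Complex.continuous_im).mem_nhds hmem))
  have := h.conj_conj
  rw [Complex.conj_conj] at this
  exact this.differentiableWithinAt

theorem tendsto_neg_lowerInfty : Tendsto (fun ξ : ℂ => -ξ) lowerInfty upperInfty := by
  refine tendsto_inf.2 ⟨?_, ?_⟩
  · exact (Homeomorph.neg ℂ).isClosedEmbedding.tendsto_cocompact.mono_left inf_le_left
  · exact tendsto_principal.2 (eventually_inf_principal.2 (Eventually.of_forall fun ξ hξ => by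
      simpa using hξ))

theorem tendsto_conj_lowerInfty :
    Tendsto (fun ξ : ℂ => (starRingEnd ℂ) ξ) lowerInfty upperInfty := by
  refine tendsto_inf.2 ⟨?_, ?_⟩
  · exact Complex.conjCLE.toHomeomorph.isClosedEmbedding.tendsto_cocompact.mono_left inf_le_left
  · exact tendsto_principal.2 (eventually_inf_principal.2 (Eventually.of_forall fun ξ hξ => by
      simpa using hξ))

theorem tendsto_conj_comp_lowerInfty (h : Tendsto (n x) upperInfty (𝓝 c)) :
    Tendsto (fun ξ => (starRingEnd ℂ) (n x ((starRingEnd ℂ) ξ))) lowerInfty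
      (𝓝 ((starRingEnd ℂ) c)) :=
  (Complex.continuous_conj.tendsto _).comp (h.comp tendsto_conj_lowerInfty)

end LowerHalfPlane

section Reflectionless

variable {A : ℝ} {u : ℝ → ℂ} {ξ : ℂ}

/-- The Wronskian of the two Jost solutions at `+∞` is `1`. -/
theorem wr_eq_one_of_isJostPlus {v w : ℝ → Fin 2 → ℂ} (hv : IsJostPlus₁ u ξ v)
    (hw : IsJostPlus₂ A u ξ w) (x : ℝ) : wr (v x) (w x) = 1 := by
  have h := tendsto_wr hv.2 hw.2
  have h1 : wr ![1, 0] ![(A : ℂ) / (2 * Complex.I * ξ), 1] = 1 := by simp [wr]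
  rw [h1] at h
  refine tendsto_nhds_unique tendsto_const_nhds (h.congr fun y => ?_)
  rw [wr_smul_left, wr_smul_right, ← mul_assoc, exp_mul_exp_neg, one_mul]
  exact wr_eq_of_solvesLaxX hv.1 hw.1 y x

theorem ne_zero_of_wr_eq_one {v w : Fin 2 → ℂ} (h : wr v w = 1) : w ≠ 0 := by
  rintro rfl
  simp [wr] at h

/-- If `b` vanishes at a real point then `φ₋⁽²⁾ = a₂ φ₊⁽²⁾` there. -/
theorem isJostMinus₂_eq_smul (hu : Continuous u) {s : ℝ} {v w z : ℝ → Fin 2 → ℂ}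
    (hv : IsJostPlus₁ u s v) (hw : IsJostPlus₂ A u s w) (hz : IsJostMinus₂ u s z)
    (hb : b A u s = 0) (x : ℝ) : z x = a₂ u s • w x := by
  have h0 : (s : ℂ).im = 0 := Complex.ofReal_im s
  have hwr := wr_eq_one_of_isJostPlus hv hw
  rw [b, jostMinus₂_eq hu h0.le hz, jostPlus₂_eq hu h0.ge hw] at hb
  obtain ⟨c, hc⟩ := exists_eq_smul_of_solvesLaxX hu hz.1 hw.1 (ne_zero_of_wr_eq_one (hwr 0)) hb
  have ha : a₂ u s = c := by
    rw [a₂, jostPlus₁_eq hu h0.le hv, jostMinus₂_eq hu h0.le hz, hc, wr_smul_right, hwr, mul_one]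
  rw [hc, ha]

theorem tendsto_mul_add_I_div {f : ℂ → ℂ} {c : ℂ} (h : Tendsto f upperInfty (𝓝 c)) :
    Tendsto (fun ξ => (ξ + Complex.I) * f ξ * ξ⁻¹) upperInfty (𝓝 c) := by
  have h1 : Tendsto (fun ξ : ℂ => 1 + Complex.I * ξ⁻¹) upperInfty (𝓝 1) := by
    simpa using (tendsto_inv_upperInfty.const_mul Complex.I).const_add 1
  have h2 := h1.mul h
  rw [one_mul] at h2
  refine h2.congr' ?_
  filter_upwards [tendsto_norm_upperInfty.eventually_gt_atTop 0] with ξ hξ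
  have hξ0 : ξ ≠ 0 := norm_pos_iff.1 hξ
  field_simp

theorem tendsto_norm_lowerInfty : Tendsto (fun ξ : ℂ => ‖ξ‖) lowerInfty atTop :=
  (tendsto_norm_cocompact_atTop).mono_left inf_le_left

/-- For vanishing `b`, and `a₂` whose only zero is a simple one at `0`, the column
`e^{-iξx} φ₊⁽²⁾ = (c₁/ξ, 1 + c₂/ξ)` is rational in `ξ`: it continues to `e^{-iξx} φ₋⁽²⁾/a₂`
across the real axis. -/
theorem StepLike.exists_rational_jostPlus₂ (hu : StepLike A u)
    (hz : ∀ ξ : ℂ, ξ.im ≤ 0 → (a₂ u ξ = 0 ↔ ξ = 0)) {d₂ : ℂ}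
    (hd : HasDerivWithinAt (a₂ u) d₂ {ξ : ℂ | ξ.im ≤ 0} 0) (hd0 : d₂ ≠ 0)
    (hb : ∀ s : ℝ, s ≠ 0 → b A u s = 0) : ∃ c₁ c₂ : ℝ → ℂ, ∀ ξ : ℂ, 0 ≤ ξ.im → ξ ≠ 0 →
      IsJostPlus₂ A u ξ fun x => Complex.exp (Complex.I * ξ * x) • ![c₁ x / ξ, 1 + c₂ x / ξ] := by
  obtain ⟨m₁, m₂, n₁, n₂, ⟨hm₁, hm₂, hn₁, hn₂⟩, ⟨hl₁, hl₂, hl₁', hl₂'⟩, hp₁, hq₂, hp₂⟩ :=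
    hu.exists_jost
  have hc := hu.continuous
  have ha : ∀ ξ : ℂ, ξ.im ≤ 0 → a₂ u ξ = m₁ 0 (-ξ) * (starRingEnd ℂ) (m₁ 0 ((starRingEnd ℂ) ξ))
      - m₂ 0 (-ξ) * (starRingEnd ℂ) (m₂ 0 ((starRingEnd ℂ) ξ)) := fun ξ hξ => by
    rw [a₂, jostPlus₁_eq hc hξ (hp₁ ξ hξ), jostMinus₂_eq hc hξ (hq₂ ξ hξ)]
    simp [wr]
  have hac : ContinuousOn (a₂ u) {ξ : ℂ | ξ.im ≤ 0} :=
    (((hm₁.continuousOn_comp_neg 0).mul (hm₁.continuousOn_conj 0)).sub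
      ((hm₂.continuousOn_comp_neg 0).mul (hm₂.continuousOn_conj 0))).congr ha
  have had : DifferentiableOn ℂ (a₂ u) {ξ : ℂ | ξ.im < 0} :=
    (((hm₁.differentiableOn_comp_neg 0).mul (hm₁.differentiableOn_conj 0)).sub
      ((hm₂.differentiableOn_comp_neg 0).mul (hm₂.differentiableOn_conj 0))).congr
      fun ξ hξ => ha ξ (le_of_lt hξ)
  have hal : Tendsto (a₂ u) lowerInfty (𝓝 1) := by
    have h := (((hl₁ 0).comp tendsto_neg_lowerInfty).mul (tendsto_conj_comp_lowerInfty (hl₁ 0))).sub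
      (((hl₂ 0).comp tendsto_neg_lowerInfty).mul (tendsto_conj_comp_lowerInfty (hl₂ 0)))
    simp only [map_one, map_zero, mul_one, mul_zero, sub_zero] at h
    refine h.congr' (eventually_inf_principal.2 (Eventually.of_forall fun ξ hξ => ?_))
    exact (ha ξ hξ).symm
  have hane : ∀ ξ : ℂ, ξ.im ≤ 0 → ξ ≠ 0 → a₂ u ξ ≠ 0 := fun ξ h h0 h' => h0 ((hz ξ h).1 h')
  -- the zero of `a₂` at the origin is simple
  have hlow : ∀ᶠ ξ in 𝓝 (0 : ℂ), ξ.im ≤ 0 → ‖d₂‖ / 2 * ‖ξ‖ ≤ ‖a₂ u ξ‖ := by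
    have h := (hasDerivWithinAt_iff_isLittleO.1 hd).def (half_pos (norm_pos_iff.2 hd0))
    rw [eventually_nhdsWithin_iff] at h
    filter_upwards [h] with ξ h hξ
    have h1 := h hξ
    rw [(hz 0 (by simp)).2 rfl, sub_zero, sub_zero, smul_eq_mul] at h1
    have h2 := norm_sub_norm_le (ξ * d₂) (a₂ u ξ)
    rw [norm_sub_rev, norm_mul] at h2
    nlinarith
  -- gluing one component of `φ₊⁽²⁾`, given by `n`, to one of `φ₋⁽²⁾/a₂`, given by `p`
  have key : ∀ (n p : ℝ → ℂ → ℂ) (c : ℂ) (x : ℝ), HalfPlaneFamily n → HalfPlaneFamily p →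
      Tendsto (n x) upperInfty (𝓝 c) → Tendsto (p (-x)) upperInfty (𝓝 ((starRingEnd ℂ) c)) →
      (∀ s : ℝ, s ≠ 0 → (s + Complex.I) * n x s
        = s * ((starRingEnd ℂ) (p (-x) ((starRingEnd ℂ) s)) / a₂ u s)) →
      ∃ d : ℂ, ∀ ξ : ℂ, 0 ≤ ξ.im → ξ ≠ 0 → (ξ + Complex.I) * n x ξ = c * ξ + d := by
    intro n p c x hn hp hnl hpl hnp
    obtain ⟨B, hB⟩ := hn.bdd x
    obtain ⟨B', hB'⟩ := hp.bdd (-x)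
    have hBx := fun ξ hξ => hB ξ hξ x le_rfl
    have hBx' := fun ξ hξ => hB' ξ hξ (-x) le_rfl
    have hB0 : 0 ≤ B := (norm_nonneg _).trans (hBx 0 le_rfl)
    have hd2 : 0 < ‖d₂‖ := norm_pos_iff.2 hd0
    refine (eq_affine_of_glue (c := c) (f := fun ξ => (ξ + Complex.I) * n x ξ)
      (g := fun ξ => ξ * ((starRingEnd ℂ) (p (-x) ((starRingEnd ℂ) ξ)) / a₂ u ξ))
      (B := max (2 * B) (B' / (‖d₂‖ / 2)))
      (((continuous_id.add continuous_const).continuousOn.mul (hn.contOn x)).mono fun ξ h => h.1)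
      ((differentiable_id.add_const _).differentiableOn.mul (hn.diffOn x))
      (continuousOn_id.mul (((hp.continuousOn_conj (-x)).mono fun ξ h => h.1).div
        (hac.mono fun ξ h => h.1) fun ξ h => hane ξ h.1 h.2))
      (differentiableOn_id.mul ((hp.differentiableOn_conj (-x)).div had
        fun ξ h => hane ξ (le_of_lt h) (by rintro rfl; simp at h)))
      (fun ξ h h0 => by
        have : ξ = (ξ.re : ℂ) := Complex.ext (by simp) (by simp [h])
        rw [this]
        refine hnp _ ?_
        rintro h'
        exact h0 (by rw [this, h']; simp)) ?_ ?_
      (tendsto_mul_add_I_div hnl) ?_).imp fun d hd => hd.1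
    · filter_upwards [Metric.ball_mem_nhds (0 : ℂ) one_pos] with ξ h1 h2 h3
      refine le_trans ?_ (le_max_left _ _)
      rw [norm_mul]
      have : ‖ξ + Complex.I‖ ≤ 2 := (norm_add_le _ _).trans (by
        rw [mem_ball_zero_iff] at h1; rw [Complex.norm_I]; linarith)
      exact mul_le_mul this (hBx ξ h2) (norm_nonneg _) (by norm_num)
    · filter_upwards [hlow] with ξ h1 h2 h3
      refine le_trans ?_ (le_max_right _ _)
      have h4 : 0 < ‖ξ‖ := norm_pos_iff.2 h3
      have h5 := h1 h2
      have h6 : ‖p (-x) ((starRingEnd ℂ) ξ)‖ ≤ B' := hBx' _ (by simpa using h2)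
      rw [norm_mul, norm_div, RCLike.norm_conj, ← mul_div_assoc]
      have h7 : 0 < ‖a₂ u ξ‖ := norm_pos_iff.2 (hane ξ h2 h3)
      rw [div_le_div_iff₀ h7 (by positivity)]
      have h8 : 0 ≤ ‖p (-x) ((starRingEnd ℂ) ξ)‖ := norm_nonneg _
      calc ‖ξ‖ * ‖p (-x) ((starRingEnd ℂ) ξ)‖ * (‖d₂‖ / 2)
          = (‖d₂‖ / 2 * ‖ξ‖) * ‖p (-x) ((starRingEnd ℂ) ξ)‖ := by ring
        _ ≤ ‖a₂ u ξ‖ * B' := mul_le_mul h5 h6 h8 h7.le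
        _ = B' * ‖a₂ u ξ‖ := mul_comm _ _
    · have h := (tendsto_conj_comp_lowerInfty hpl).div hal one_ne_zero
      rw [Complex.conj_conj, div_one] at h
      refine h.congr' ?_
      filter_upwards [tendsto_norm_lowerInfty.eventually_gt_atTop 0] with ξ hξ
      have hξ0 : ξ ≠ 0 := norm_pos_iff.1 hξ
      simp only [Pi.div_apply]
      field_simp
  have hreal : ∀ (s : ℝ), s ≠ 0 → ∀ x : ℝ,
      (s + Complex.I) * n₁ x s
        = s * ((starRingEnd ℂ) (m₂ (-x) ((starRingEnd ℂ) s)) / a₂ u s) ∧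
      (s + Complex.I) * n₂ x s
        = s * ((starRingEnd ℂ) (m₁ (-x) ((starRingEnd ℂ) s)) / a₂ u s) := by
    intro s hs x
    have h0 : (s : ℂ).im = 0 := Complex.ofReal_im s
    have hs' : (s : ℂ) ≠ 0 := Complex.ofReal_ne_zero.2 hs
    have h := isJostMinus₂_eq_smul hc (hp₁ s h0.le) (hp₂ s h0.ge hs') (hq₂ s h0.le) (hb s hs) x
    have hne := hane s h0.le hs'
    have he := Complex.exp_ne_zero (Complex.I * s * x)
    have e1 := congrFun h 0
    have e2 := congrFun h 1
    simp only [Pi.smul_apply, smul_eq_mul, Matrix.cons_val_zero, Matrix.cons_val_one] at e1 e2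
    constructor
    · apply mul_left_cancel₀ he
      rw [← mul_div_assoc, ← mul_div_assoc, mul_left_comm _ (s : ℂ), e1]
      field_simp
    · apply mul_left_cancel₀ he
      rw [← mul_div_assoc, ← mul_div_assoc, mul_left_comm _ (s : ℂ), e2]
      field_simp
  choose c₁ hc₁ using fun x => key n₁ m₂ 0 x hn₁ hm₂ (hl₁' x) (by simpa using hl₂ (-x))
    fun s hs => (hreal s hs x).1
  choose c₂ hc₂ using fun x => key n₂ m₁ 1 x hn₂ hm₁ (hl₂' x) (by simpa using hl₁ (-x))
    fun s hs => (hreal s hs x).2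
  refine ⟨c₁, c₂, fun ξ hξ hξ0 => ?_⟩
  convert hp₂ ξ hξ hξ0 using 1
  funext x
  rw [← smul_smul]
  congr 1
  have h1 := hc₁ x ξ hξ hξ0
  have h2 := hc₂ x ξ hξ hξ0
  ext i
  fin_cases i
  · change c₁ x / ξ = (ξ + Complex.I) / ξ * n₁ x ξ
    rw [div_mul_eq_mul_div, h1]
    ring
  · change 1 + c₂ x / ξ = (ξ + Complex.I) / ξ * n₂ x ξ
    rw [div_mul_eq_mul_div, h2]
    field_simp

end Reflectionless

/-! ### Inversion: reflectionless data are one-soliton profiles -/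

theorem eq_of_hasDerivAt_zero {f : ℝ → ℂ} (h : ∀ x, HasDerivAt f 0 x) (x y : ℝ) : f x = f y :=
  is_const_of_deriv_eq_zero (fun x => (h x).differentiableAt) (fun x => (h x).deriv) x y

/-- The uniqueness theorem for a scalar linear equation. -/
theorem eq_zero_of_hasDerivAt_mul {f g : ℝ → ℂ} (hg : Continuous g)
    (hf : ∀ x, HasDerivAt f (g x * f x) x) {x₀ : ℝ} (h0 : f x₀ = 0) (x : ℝ) : f x = 0 := by
  have hG : ∀ x, HasDerivAt (fun x => ∫ y in x₀..x, g y) (g x) x := fun x =>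
    intervalIntegral.integral_hasDerivAt_right (hg.intervalIntegrable _ _)
      hg.stronglyMeasurable.stronglyMeasurableAtFilter hg.continuousAt
  have h := eq_of_hasDerivAt_zero (f := fun x => f x * Complex.exp (-∫ y in x₀..x, g y))
    (fun x => ((hf x).mul (hG x).neg.cexp).congr_deriv (by ring)) x x₀
  simp only [h0, zero_mul] at h
  exact (mul_eq_zero.1 h).resolve_right (Complex.exp_ne_zero _)

section Profile

variable {A : ℝ} {c₁ c₂ : ℝ → ℂ}

/-- A first integral of the reduced system `c₁' = 2i c₁c₂`, `c₂' = 2i c₁ conj c₁(-x)`, which turns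
the second equation into a Riccati equation. The constant `iκ₀` is the other first integral
`conj c₂(-x) - c₂(x)`. -/
theorem exists_profile_relation {l : ℂ}
    (h₁ : ∀ x, HasDerivAt c₁ (2 * Complex.I * c₁ x * c₂ x) x)
    (h₂ : ∀ x, HasDerivAt c₂ (2 * Complex.I * (starRingEnd ℂ) (c₁ (-x)) * c₁ x) x)
    (l₁ : Tendsto c₁ atTop (𝓝 l)) (l₁' : Tendsto c₁ atBot (𝓝 0))
    (l₂ : Tendsto c₂ atTop (𝓝 0)) : ∃ κ₀ : ℝ,
      ∀ x, c₁ x * (starRingEnd ℂ) (c₁ (-x)) = c₂ x ^ 2 + Complex.I * κ₀ * c₂ x := by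
  have he : ∀ x, HasDerivAt (fun x => (starRingEnd ℂ) (c₂ (-x)))
      (2 * Complex.I * (starRingEnd ℂ) (c₁ (-x)) * c₁ x) x := fun x => by
    refine (hasDerivAt_conj_comp_neg (h₂ (-x))).congr_deriv ?_
    simp [Complex.conj_ofNat]
    ring
  obtain ⟨K, hK⟩ : ∃ K, ∀ x, (starRingEnd ℂ) (c₂ (-x)) = c₂ x + K := by
    refine ⟨(starRingEnd ℂ) (c₂ (-0)) - c₂ 0, fun x => ?_⟩
    have := eq_of_hasDerivAt_zero (f := fun x => (starRingEnd ℂ) (c₂ (-x)) - c₂ x)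
      (fun x => ((he x).sub (h₂ x)).congr_deriv (sub_self _)) x 0
    rw [← this]
    ring
  have hKK : K.re = 0 := by
    have h := hK (-0)
    rw [neg_neg, ← Complex.conj_conj (c₂ (-0)), hK 0] at h
    have h2 := congrArg Complex.re h
    simp at h2
    linarith
  have hKi : K = Complex.I * (K.im : ℝ) := Complex.ext (by simp [hKK]) (by simp)
  have hC : ∀ x, HasDerivAt (fun x => (starRingEnd ℂ) (c₁ (-x)))
      (2 * Complex.I * (starRingEnd ℂ) (c₁ (-x)) * (c₂ x + K)) x := fun x => by
    refine (hasDerivAt_conj_comp_neg (h₁ (-x))).congr_deriv ?_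
    simp only [map_mul, Complex.conj_ofNat, Complex.conj_I, hK]
    ring
  refine ⟨K.im, fun x => ?_⟩
  rw [← hKi]
  have hd : ∀ x, HasDerivAt
      (fun x => c₁ x * (starRingEnd ℂ) (c₁ (-x)) - (c₂ x ^ 2 + K * c₂ x)) 0 x := fun x => by
    refine (((h₁ x).mul (hC x)).sub (((h₂ x).pow 2).add ((h₂ x).const_mul K))).congr_deriv ?_
    simp only [Nat.cast_ofNat]
    ring
  have hl : Tendsto (fun x => c₁ x * (starRingEnd ℂ) (c₁ (-x)) - (c₂ x ^ 2 + K * c₂ x)) atTop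
      (𝓝 0) := by
    have hc := (Complex.continuous_conj.tendsto _).comp (l₁'.comp tendsto_neg_atTop_atBot)
    have := (l₁.mul hc).sub ((l₂.pow 2).add (l₂.const_mul K))
    simpa using this
  have h := tendsto_nhds_unique (tendsto_const_nhds.congr fun y => eq_of_hasDerivAt_zero hd x y) hl
  exact sub_eq_zero.1 h

/-- The solutions of the reduced system that connect `0` to `A/(2i)`. Both `1/c₂` and `c₁/c₂` solve
linear equations, and the limits at `±∞` force `2κ₀ = A`. -/
theorem exists_profile (hA : 0 < A)
    (h₁ : ∀ x, HasDerivAt c₁ (2 * Complex.I * c₁ x * c₂ x) x)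
    (h₂ : ∀ x, HasDerivAt c₂ (2 * Complex.I * (starRingEnd ℂ) (c₁ (-x)) * c₁ x) x)
    (l₁ : Tendsto c₁ atTop (𝓝 (A / (2 * Complex.I)))) (l₁' : Tendsto c₁ atBot (𝓝 0))
    (l₂ : Tendsto c₂ atTop (𝓝 0)) : ∃ κ : ℂ, ‖κ‖ = 1 ∧
      ∀ x : ℝ, 2 * Complex.I * c₁ x * (1 - κ * Complex.exp (-(A * x))) = A := by
  have hAC : (A : ℂ) ≠ 0 := Complex.ofReal_ne_zero.2 hA.ne'
  have hlne : (A : ℂ) / (2 * Complex.I) ≠ 0 := by simp [hAC]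
  obtain ⟨κ₀, hκ₀⟩ := exists_profile_relation h₁ h₂ l₁ l₁' l₂
  have h₂' : ∀ x, HasDerivAt c₂ (2 * Complex.I * (c₂ x + Complex.I * κ₀) * c₂ x) x := fun x => by
    refine (h₂ x).congr_deriv ?_
    linear_combination 2 * Complex.I * hκ₀ x
  have hcont : Continuous c₂ := continuous_iff_continuousAt.2 fun x => (h₂ x).continuousAt
  -- if `c₂` had a zero it would vanish identically and `c₁` would be constant
  have hne : ∀ x, c₂ x ≠ 0 := by
    intro x₀ hx₀
    have hz := eq_zero_of_hasDerivAt_mul (by fun_prop) h₂' hx₀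
    have hconst := fun x y => eq_of_hasDerivAt_zero (f := c₁)
      (fun x => (h₁ x).congr_deriv (by rw [hz]; ring)) x y
    have e1 := tendsto_nhds_unique (tendsto_const_nhds.congr fun y => hconst 0 y) l₁
    have e2 := tendsto_nhds_unique (tendsto_const_nhds.congr fun y => hconst 0 y) l₁'
    exact hlne (e1.symm.trans e2)
  have hexp : ∀ x : ℝ, HasDerivAt (fun x : ℝ => Complex.exp (-(2 * κ₀) * x))
      (-(2 * κ₀) * Complex.exp (-(2 * κ₀) * x)) x := fun x => hasDerivAt_cexp_mul _ x
  have hI : Complex.I * Complex.I = -1 := Complex.I_mul_I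
  -- the Riccati equation is linear for `1 / c₂`
  have hwinv : ∀ x, HasDerivAt (fun x => (c₂ x)⁻¹)
      (-(2 * Complex.I) + 2 * κ₀ * (c₂ x)⁻¹) x := fun x => by
    refine ((h₂' x).inv (hne x)).congr_deriv ?_
    have := hne x
    field_simp
    linear_combination (-κ₀ : ℂ) * hI
  -- `c₁ / c₂` grows like `exp (2κ₀x)`
  obtain ⟨k, hk⟩ : ∃ k, ∀ x : ℝ, c₁ x * (c₂ x)⁻¹ * Complex.exp (-(2 * κ₀) * x) = k := by
    refine ⟨_, fun x => eq_of_hasDerivAt_zero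
      (f := fun x : ℝ => c₁ x * (c₂ x)⁻¹ * Complex.exp (-(2 * κ₀) * x))
      (fun x => (((h₁ x).mul (hwinv x)).mul (hexp x)).congr_deriv ?_) x 0⟩
    have := hne x
    simp only [Pi.mul_apply]
    field_simp
    ring
  have hinvtop : Tendsto (fun x => ‖(c₂ x)⁻¹‖) atTop atTop := by
    have := tendsto_norm_inv_nhdsNE_zero_atTop (α := ℂ)
    exact this.comp (tendsto_nhdsWithin_iff.2 ⟨l₂, Eventually.of_forall hne⟩)
  have hκne : κ₀ ≠ 0 := by
    rintro rfl
    simp only [Complex.ofReal_zero, mul_zero, neg_zero, zero_mul, Complex.exp_zero, mul_one] at hk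
    have hc : Tendsto c₁ atTop (𝓝 (k * 0)) := (l₂.const_mul k).congr fun x => by
      rw [← hk x, inv_mul_cancel_right₀ (hne x)]
    rw [mul_zero] at hc
    exact hlne (tendsto_nhds_unique l₁ hc)
  have hκneC : (κ₀ : ℂ) ≠ 0 := Complex.ofReal_ne_zero.2 hκne
  obtain ⟨B, hB⟩ : ∃ B, ∀ x : ℝ, (c₂ x)⁻¹ * Complex.exp (-(2 * κ₀) * x)
      - Complex.I / κ₀ * Complex.exp (-(2 * κ₀) * x) = B := by
    refine ⟨_, fun x => eq_of_hasDerivAt_zero (f := fun x : ℝ => (c₂ x)⁻¹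
      * Complex.exp (-(2 * κ₀) * x) - Complex.I / κ₀ * Complex.exp (-(2 * κ₀) * x))
      (fun x => (((hwinv x).mul (hexp x)).sub ((hexp x).const_mul _)).congr_deriv ?_) x 0⟩
    field_simp
    ring
  have hE : ∀ x : ℝ, Complex.exp (-(2 * κ₀) * x) * Complex.exp (2 * κ₀ * x) = 1 := fun x => by
    rw [← Complex.exp_add, ← Complex.exp_zero]; ring_nf
  have hw : ∀ x : ℝ, (c₂ x)⁻¹ = Complex.I / κ₀ + B * Complex.exp (2 * κ₀ * x) := fun x => by
    rw [← hB x]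
    linear_combination (-(c₂ x)⁻¹ + Complex.I / κ₀) * hE x
  have hnorm : ∀ c x : ℝ, ‖Complex.exp (c * x)‖ = Real.exp (c * x) := fun c x => by
    rw [← Complex.ofReal_mul, Complex.norm_exp_ofReal]
  have hbig : ¬ ∃ M, ∀ x : ℝ, 0 ≤ x → ‖(c₂ x)⁻¹‖ ≤ M := by
    rintro ⟨M, hM⟩
    obtain ⟨x, hx1, hx2⟩ := ((hinvtop.eventually_gt_atTop M).and (eventually_ge_atTop 0)).exists
    exact absurd (hM x hx2) (not_le.2 hx1)
  have hB0 : B ≠ 0 := by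
    rintro rfl
    exact hbig ⟨‖Complex.I / κ₀‖, fun x _ => by rw [hw]; simp⟩
  have hκpos : 0 < κ₀ := by
    by_contra hneg
    refine hbig ⟨‖Complex.I / κ₀‖ + ‖B‖, fun x hx => ?_⟩
    rw [hw]
    refine (norm_add_le _ _).trans (add_le_add le_rfl ?_)
    rw [norm_mul]
    have := hnorm (2 * κ₀) x
    push_cast at this
    rw [this]
    refine mul_le_of_le_one_right (norm_nonneg _) (Real.exp_le_one_iff.2 ?_)
    nlinarith
  set κ : ℂ := -Complex.I / (κ₀ * B) with hκ
  have hκB : κ * (κ₀ * B) = -Complex.I := by rw [hκ]; field_simp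
  have hden : ∀ x : ℝ, c₂ x * (B * Complex.exp (2 * κ₀ * x)) *
      (1 - κ * Complex.exp (-(2 * κ₀) * x)) = 1 := fun x => by
    have h := mul_inv_cancel₀ (hne x)
    rw [hw] at h
    have h3 : κ * B = -Complex.I / κ₀ := by rw [hκ]; field_simp
    linear_combination h - c₂ x * (κ * B) * hE x - c₂ x * h3
  have hc₁ : ∀ x : ℝ, c₁ x * (1 - κ * Complex.exp (-(2 * κ₀) * x)) = k / B := fun x => by
    have h1 : c₁ x = k * c₂ x * Complex.exp (2 * κ₀ * x) := by
      linear_combination c₂ x * Complex.exp (2 * κ₀ * x) * hk x - c₁ x *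
        (Complex.exp (-(2 * κ₀) * x) * Complex.exp (2 * κ₀ * x)) * mul_inv_cancel₀ (hne x)
        - c₁ x * hE x
    rw [h1, eq_div_iff hB0]
    linear_combination k * hden x
  have hElim : Tendsto (fun x : ℝ => Complex.exp (-(2 * κ₀) * x)) atTop (𝓝 0) := by
    rw [tendsto_zero_iff_norm_tendsto_zero]
    have : Tendsto (fun x : ℝ => Real.exp (-(2 * κ₀) * x)) atTop (𝓝 0) :=
      Real.tendsto_exp_atBot.comp (tendsto_id.const_mul_atTop_of_neg (by linarith))
    refine this.congr fun x => ?_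
    rw [← hnorm]
    push_cast
    rfl
  have hkB : k / B = A / (2 * Complex.I) := by
    have h := l₁.mul ((hElim.const_mul κ).const_sub 1)
    rw [mul_zero, sub_zero, mul_one] at h
    exact tendsto_nhds_unique (tendsto_const_nhds.congr fun x => (hc₁ x).symm) h
  have hfin : ∀ x : ℝ, 2 * Complex.I * c₁ x * (1 - κ * Complex.exp (-(2 * κ₀) * x)) = A :=
    fun x => by
      have h := hc₁ x
      rw [hkB, eq_div_iff (by simp)] at h
      linear_combination h
  -- the quadratic relation at an arbitrary point
  have hrel : ∀ x : ℝ, (A : ℂ) ^ 2 / 4 * (1 - κ * Complex.exp (-(2 * κ₀) * x))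
      = -κ₀ ^ 2 * κ * Complex.exp (-(2 * κ₀) * x) + κ₀ ^ 2 * (κ * (starRingEnd ℂ) κ) := fun x => by
    set E := Complex.exp (-(2 * κ₀) * x) with hEdef
    have hEE := hE x
    rw [← hEdef] at hEE
    set E' := Complex.exp (2 * κ₀ * x) with hEdef'
    have f1 := hfin x
    have f2 : 2 * Complex.I * (starRingEnd ℂ) (c₁ (-x)) * (1 - (starRingEnd ℂ) κ * E') = -A := by
      have h := congrArg (starRingEnd ℂ) (hfin (-x))
      have he : (starRingEnd ℂ) (Complex.exp (-(2 * κ₀) * ((-x : ℝ) : ℂ))) = E' := by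
        rw [← Complex.exp_conj, hEdef']
        simp [Complex.conj_ofNat]
      simp only [map_mul, map_sub, map_one, Complex.conj_ofNat, Complex.conj_I, he,
        Complex.conj_ofReal] at h
      linear_combination -h
    have f3 := hκ₀ x
    have f4 : c₂ x * (1 - κ * E) = Complex.I * κ₀ * κ * E := by
      have h := hden x
      rw [← hEdef, ← hEdef'] at h
      have e1 : B * E' * (Complex.I * κ₀ * κ * E) = 1 := by
        linear_combination Complex.I * E * E' * hκB - E * E' * hI + hEE
      have e2 : B * E' ≠ 0 := mul_ne_zero hB0 (Complex.exp_ne_zero _)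
      apply mul_left_cancel₀ e2
      linear_combination h - e1
    have hD : (1 - κ * E) ≠ 0 := by
      intro h
      rw [← hEdef, h, mul_zero] at f1
      exact hAC f1.symm
    have g1 : (c₂ x ^ 2 + Complex.I * κ₀ * c₂ x) * (1 - κ * E) ^ 2 = -κ₀ ^ 2 * κ * E := by
      linear_combination (c₂ x * (1 - κ * E) + Complex.I * κ₀ * κ * E +
        Complex.I * κ₀ * (1 - κ * E)) * f4 + κ₀ ^ 2 * κ * E * hI
    have g2 : (A : ℂ) ^ 2 / 4 * (1 - κ * E) = (c₂ x ^ 2 + Complex.I * κ₀ * c₂ x) *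
        (1 - κ * E) ^ 2 * (1 - (starRingEnd ℂ) κ * E') := by
      rw [← f3]
      rw [← hEdef] at f1
      linear_combination (1 - κ * E) / 4 * (2 * Complex.I * (starRingEnd ℂ) (c₁ (-x)) *
        (1 - (starRingEnd ℂ) κ * E')) * f1 + (1 - κ * E) / 4 * A * f2
        - (c₁ x * (starRingEnd ℂ) (c₁ (-x))) *
        (1 - κ * E) ^ 2 * (1 - (starRingEnd ℂ) κ * E') * hI
    rw [g2, g1]
    linear_combination κ₀ ^ 2 * κ * (starRingEnd ℂ) κ * hEE
  have hκne0 : κ ≠ 0 := by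
    intro h
    rw [h, zero_mul] at hκB
    simpa using hκB.symm
  have hlimrel : (A : ℂ) ^ 2 / 4 = κ₀ ^ 2 * (κ * (starRingEnd ℂ) κ) := by
    have h1 := ((hElim.const_mul κ).const_sub 1).const_mul ((A : ℂ) ^ 2 / 4)
    have h2 := (hElim.const_mul (-κ₀ ^ 2 * κ)).add_const (κ₀ ^ 2 * (κ * (starRingEnd ℂ) κ))
    have := tendsto_nhds_unique h1 (h2.congr fun x => (hrel x).symm)
    simpa using this
  have hsq : (A : ℂ) ^ 2 / 4 = κ₀ ^ 2 := by
    have h := hrel 0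
    simp only [Complex.ofReal_zero, mul_zero, Complex.exp_zero, mul_one] at h
    apply mul_right_cancel₀ hκne0
    linear_combination hlimrel - h
  have hκA : 2 * κ₀ = A := by
    have : A ^ 2 / 4 = κ₀ ^ 2 := by exact_mod_cast hsq
    nlinarith
  refine ⟨κ, ?_, fun x => ?_⟩
  · rw [Complex.mul_conj, hsq] at hlimrel
    have : κ₀ ^ 2 = κ₀ ^ 2 * Complex.normSq κ := by exact_mod_cast hlimrel
    have h2 : Complex.normSq κ = 1 := by
      have h3 : κ₀ ^ 2 ≠ 0 := pow_ne_zero 2 hκne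
      exact mul_left_cancel₀ h3 (by rw [← this, mul_one])
    rw [Complex.norm_def, h2, Real.sqrt_one]
  · have h := hfin x
    have hcast : (2 : ℂ) * κ₀ = A := by exact_mod_cast hκA
    rwa [hcast, neg_mul] at h

end Profile

/-- Data with vanishing `b`, for which the only zero of `a₂` is a simple one at `0`, are one-soliton
profiles. -/
theorem StepLike.exists_eq_profile {A : ℝ} (hA : 0 < A) {u : ℝ → ℂ} (hu : StepLike A u)
    (hz : ∀ ξ : ℂ, ξ.im ≤ 0 → (a₂ u ξ = 0 ↔ ξ = 0)) {d₂ : ℂ}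
    (hd : HasDerivWithinAt (a₂ u) d₂ {ξ : ℂ | ξ.im ≤ 0} 0) (hd0 : d₂ ≠ 0)
    (hb : ∀ s : ℝ, s ≠ 0 → b A u s = 0) : ∃ κ : ℂ, ‖κ‖ = 1 ∧
      ∀ x : ℝ, u x * (1 - κ * Complex.exp (-(A * x))) = A := by
  obtain ⟨c₁, c₂, hJ⟩ := hu.exists_rational_jostPlus₂ hz hd hd0 hb
  have hd : ∀ ξ : ℂ, 0 ≤ ξ.im → ξ ≠ 0 → ∀ x,
      HasDerivAt c₁ (-(2 * Complex.I * ξ) * c₁ x + u x * (ξ + c₂ x)) x ∧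
      HasDerivAt c₂ (refl u x * c₁ x) x := by
    intro ξ hξ hξ0 x
    obtain ⟨e1, e2⟩ := solvesLaxX_iff.1 (hJ ξ hξ hξ0).1 x
    have he := (hasDerivAt_cexp_mul (-(Complex.I * ξ)) x).mul_const ξ
    have hE : ∀ x : ℝ, Complex.exp (-(Complex.I * ξ) * x) * Complex.exp (Complex.I * ξ * x) = 1 :=
      fun x => by rw [neg_mul, mul_comm, exp_mul_exp_neg]
    constructor
    · refine HasDerivAt.congr_of_eventuallyEq ((he.mul e1).congr_deriv ?_)
        (Eventually.of_forall fun y => ?_)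
      rotate_left
      · change c₁ y = Complex.exp (-(Complex.I * ξ) * y) * ξ * (Complex.exp (Complex.I * ξ * y) *
          (c₁ y / ξ))
        have := hE y
        rw [neg_mul] at this
        field_simp
        linear_combination -c₁ y * this
      · simp only [Pi.smul_apply, smul_eq_mul, Matrix.cons_val_zero, Matrix.cons_val_one]
        have := hE x
        rw [neg_mul] at this
        field_simp
        linear_combination (-(2 * Complex.I * ξ * c₁ x) + u x * (ξ + c₂ x)) * this
    · refine HasDerivAt.congr_of_eventuallyEq (((he.mul e2).sub_const ξ).congr_deriv ?_)
        (Eventually.of_forall fun y => ?_)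
      rotate_left
      · change c₂ y = Complex.exp (-(Complex.I * ξ) * y) * ξ * (Complex.exp (Complex.I * ξ * y) *
          (1 + c₂ y / ξ)) - ξ
        have := hE y
        rw [neg_mul] at this
        field_simp
        linear_combination -(ξ + c₂ y) * this
      · simp only [Pi.smul_apply, smul_eq_mul, Matrix.cons_val_zero, Matrix.cons_val_one]
        have := hE x
        rw [neg_mul] at this
        field_simp
        linear_combination refl u x * c₁ x * this
  -- comparing the coefficients of `ξ`
  have hu1 : ∀ x, u x = 2 * Complex.I * c₁ x := fun x => by
    have h1 := (hd 1 (by simp) one_ne_zero x).1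
    have h2 := (hd 2 (by simp) two_ne_zero x).1
    linear_combination h2.unique h1
  have hlim := tendsto_pi_nhds.1 (hJ 1 (by simp) one_ne_zero).2
  have hexp : ∀ x : ℝ, Complex.exp (-(Complex.I * 1 * x)) * Complex.exp (Complex.I * 1 * x) = 1 :=
    fun x => by rw [mul_comm, exp_mul_exp_neg]
  refine (exists_profile (c₁ := c₁) (c₂ := c₂) hA (fun x => ?_) (fun x => ?_) ?_ ?_ ?_).imp
    fun κ h => ⟨h.1, fun x => by rw [hu1]; exact h.2 x⟩
  · refine (hd 1 (by simp) one_ne_zero x).1.congr_deriv ?_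
    rw [hu1]; ring
  · refine (hd 1 (by simp) one_ne_zero x).2.congr_deriv ?_
    simp [refl, hu1, Complex.conj_ofNat]
  · have h := hlim 0
    simp only [Matrix.cons_val_zero, mul_one (2 * Complex.I)] at h
    refine h.congr fun x => ?_
    change Complex.exp _ * (Complex.exp _ * (c₁ x / 1)) = c₁ x
    rw [← mul_assoc, hexp, one_mul, div_one]
  · have h := hu.left.const_mul (1 / (2 * Complex.I))
    rw [mul_zero] at h
    refine h.congr fun x => ?_
    rw [hu1]
    field_simp
  · have h := (hlim 1).sub_const 1
    rw [show ![(A : ℂ) / (2 * Complex.I * 1), 1] 1 - 1 = 0 from sub_self 1] at h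
    refine h.congr fun x => ?_
    change Complex.exp _ * (Complex.exp _ * (1 + c₂ x / 1)) - 1 = c₂ x
    rw [← mul_assoc, hexp]
    ring

/-! ### The scattering data of the one-soliton profiles -/

/-- The differential characterization of the one-soliton profiles `A/(1 - κ e^{-Ax})`, `|κ| = 1`:
the nonlocal partner is the local function `u - A`, and `u` solves a Riccati equation. -/
structure IsProfile (A : ℝ) (u : ℝ → ℂ) : Prop where
  hasDerivAt : ∀ x, HasDerivAt u (u x * (A - u x)) x
  refl_eq : ∀ x, refl u x = u x - A

section Data

variable {A : ℝ} {u : ℝ → ℂ} {ξ κ : ℂ}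

theorem isProfile_of_eq (hA : 0 < A) (hκ : ‖κ‖ = 1)
    (h : ∀ x : ℝ, u x * (1 - κ * Complex.exp (-(A * x))) = A) : IsProfile A u := by
  have hAC : (A : ℂ) ≠ 0 := Complex.ofReal_ne_zero.2 hA.ne'
  have hne : ∀ x : ℝ, 1 - κ * Complex.exp (-(A * x)) ≠ 0 := fun x h0 => by
    have := h x
    rw [h0, mul_zero] at this
    exact hAC this.symm
  have hu : ∀ x : ℝ, u x = A * (1 - κ * Complex.exp (-(A * x)))⁻¹ := fun x => by
    exact (eq_mul_inv_iff_mul_eq₀ (hne x)).2 (h x)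
  have hE : ∀ x : ℝ, HasDerivAt (fun x : ℝ => 1 - κ * Complex.exp (-(A * x)))
      (κ * A * Complex.exp (-(A * x))) x := fun x => by
    have := ((hasDerivAt_cexp_mul (-(A : ℂ)) x).const_mul κ).const_sub 1
    simp only [neg_mul] at this
    exact this.congr_deriv (by ring)
  constructor
  · intro x
    have hd := ((hE x).inv (hne x)).const_mul (A : ℂ)
    refine (hd.congr_of_eventuallyEq (Eventually.of_forall hu)).congr_deriv ?_
    rw [hu]
    have := hne x
    field_simp
    ring
  · intro x
    have h1 := congrArg (starRingEnd ℂ) (h (-x))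
    have hexp : (starRingEnd ℂ) (Complex.exp (-(A * ((-x : ℝ) : ℂ)))) = Complex.exp (A * x) := by
      rw [← Complex.exp_conj]; simp
    simp only [map_mul, map_sub, map_one, Complex.conj_ofReal, hexp] at h1
    have hκκ : κ * (starRingEnd ℂ) κ = 1 := by
      rw [Complex.mul_conj, Complex.normSq_eq_norm_sq, hκ]; simp
    have hEE := exp_mul_exp_neg (A * x)
    have h2 := h x
    have hκ0 : κ ≠ 0 := by rintro rfl; simp at hκ
    unfold refl
    set E := Complex.exp (-(A * x))
    set E' := Complex.exp (A * x)
    set w := (starRingEnd ℂ) (u (-x))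
    have h3 : w * (1 - κ * E) = -A * κ * E := by
      linear_combination -κ * E * h1 - w * E * E' * hκκ - w * hEE
    apply mul_right_cancel₀ (hne x)
    linear_combination -h3 - h2

theorem IsProfile.continuous (hp : IsProfile A u) : Continuous u :=
  continuous_iff_continuousAt.2 fun x => (hp.hasDerivAt x).continuousAt

theorem IsProfile.solves₁ (hp : IsProfile A u) (c : ℂ) : SolvesLaxX u ξ fun x =>
    (c * Complex.exp (-(Complex.I * ξ) * x)) •
      ![ξ - Complex.I / 2 * u x, -(Complex.I / 2) * (A - u x)] := by
  rw [solvesLaxX_iff]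
  intro x
  have he := (hasDerivAt_cexp_mul (-(Complex.I * ξ)) x).const_mul c
  have hI : Complex.I ^ 2 = -1 := Complex.I_sq
  have hd := hp.hasDerivAt x
  constructor
  · refine (he.mul ((hd.const_mul (Complex.I / 2)).const_sub ξ)).congr_deriv ?_
    simp
    ring
  · refine (he.mul ((hd.const_sub (A : ℂ)).const_mul (-(Complex.I / 2)))).congr_deriv ?_
    simp [hp.refl_eq]
    linear_combination c * Complex.exp (-(Complex.I * ξ * x)) * ξ * (A - u x) * hI

theorem IsProfile.solves₂ (hp : IsProfile A u) (c : ℂ) : SolvesLaxX u ξ fun x =>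
    (c * Complex.exp (Complex.I * ξ * x)) •
      ![-(Complex.I / 2) * u x, ξ + Complex.I / 2 * (u x - A)] := by
  rw [solvesLaxX_iff]
  intro x
  have he := (hasDerivAt_cexp_mul (Complex.I * ξ) x).const_mul c
  have hI : Complex.I ^ 2 = -1 := Complex.I_sq
  have hd := hp.hasDerivAt x
  constructor
  · refine (he.mul (hd.const_mul (-(Complex.I / 2)))).congr_deriv ?_
    simp
    linear_combination -c * Complex.exp (Complex.I * ξ * x) * ξ * u x * hI
  · refine (he.mul (((hd.sub_const (A : ℂ)).const_mul (Complex.I / 2)).const_add ξ)).congr_deriv ?_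
    simp [hp.refl_eq]
    ring

theorem tendsto_vec {l : Filter ℝ} {f g : ℝ → ℂ} {a c : ℂ} (hf : Tendsto f l (𝓝 a))
    (hg : Tendsto g l (𝓝 c)) : Tendsto (fun x => ![f x, g x]) l (𝓝 ![a, c]) := by
  rw [tendsto_pi_nhds, Fin.forall_fin_two]
  exact ⟨hf, hg⟩

theorem sub_ne_zero_of_im_nonpos (hA : 0 < A) (hξ : ξ.im ≤ 0) : ξ - Complex.I * A / 2 ≠ 0 := by
  intro h
  have := congrArg Complex.im h
  simp at this
  linarith

/-- Cancelling the exponential factors in the asymptotics of a Jost solution. -/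
theorem tendsto_exp_smul {l : Filter ℝ} {c z : ℂ} {v : ℝ → Fin 2 → ℂ} {a a' : Fin 2 → ℂ}
    (h : Tendsto v l (𝓝 a)) (ha : c • a = a') :
    Tendsto (fun x : ℝ => Complex.exp (z * x) • (c * Complex.exp (-z * x)) • v x) l (𝓝 a') := by
  rw [← ha]
  refine (h.const_smul c).congr fun x => ?_
  rw [smul_smul, mul_left_comm, neg_mul, exp_mul_exp_neg, mul_one]

theorem vec_smul (c a d : ℂ) : c • ![a, d] = ![c * a, c * d] := by
  ext i; fin_cases i <;> rfl

theorem IsProfile.isJostPlus₂ (hp : IsProfile A u) (hr : Tendsto u atTop (𝓝 (A : ℂ)))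
    (hξ : ξ ≠ 0) : IsJostPlus₂ A u ξ fun x => (ξ⁻¹ * Complex.exp (Complex.I * ξ * x)) •
      ![-(Complex.I / 2) * u x, ξ + Complex.I / 2 * (u x - A)] := by
  refine ⟨hp.solves₂ _, ?_⟩
  have h := tendsto_vec (hr.const_mul (-(Complex.I / 2)))
    (((hr.sub_const (A : ℂ)).const_mul (Complex.I / 2)).const_add ξ)
  have := tendsto_exp_smul (z := -(Complex.I * ξ)) (c := ξ⁻¹) h
    (a' := ![(A : ℂ) / (2 * Complex.I * ξ), 1]) (by
      rw [vec_smul]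
      congr 1
      · have hI := Complex.I_ne_zero
        field_simp
        linear_combination -(A : ℂ) * Complex.I_sq
      · simp [hξ])
  simpa only [neg_neg, neg_mul] using this

theorem IsProfile.isJostMinus₁ (hp : IsProfile A u) (hl : Tendsto u atBot (𝓝 0))
    (hξ : ξ ≠ 0) : IsJostMinus₁ A u ξ fun x => (ξ⁻¹ * Complex.exp (-(Complex.I * ξ) * x)) •
      ![ξ - Complex.I / 2 * u x, -(Complex.I / 2) * (A - u x)] := by
  refine ⟨hp.solves₁ _, ?_⟩
  have h := tendsto_vec ((hl.const_mul (Complex.I / 2)).const_sub ξ)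
    ((hl.const_sub (A : ℂ)).const_mul (-(Complex.I / 2)))
  refine tendsto_exp_smul (z := Complex.I * ξ) h ?_
  rw [vec_smul]
  congr 1
  · simp [hξ]
  · congr 1
    have hI := Complex.I_ne_zero
    field_simp
    linear_combination -(A : ℂ) * Complex.I_sq

theorem IsProfile.isJostPlus₁ (hp : IsProfile A u) (hr : Tendsto u atTop (𝓝 (A : ℂ)))
    (hξ : ξ - Complex.I * A / 2 ≠ 0) : IsJostPlus₁ u ξ fun x =>
      ((ξ - Complex.I * A / 2)⁻¹ * Complex.exp (-(Complex.I * ξ) * x)) •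
      ![ξ - Complex.I / 2 * u x, -(Complex.I / 2) * (A - u x)] := by
  refine ⟨hp.solves₁ _, ?_⟩
  have h := tendsto_vec ((hr.const_mul (Complex.I / 2)).const_sub ξ)
    ((hr.const_sub (A : ℂ)).const_mul (-(Complex.I / 2)))
  refine tendsto_exp_smul (z := Complex.I * ξ) h ?_
  rw [vec_smul]
  congr 1
  · rw [show ξ - Complex.I / 2 * A = ξ - Complex.I * A / 2 by ring, inv_mul_cancel₀ hξ]
  · simp

theorem IsProfile.isJostMinus₂ (hp : IsProfile A u) (hl : Tendsto u atBot (𝓝 0))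
    (hξ : ξ - Complex.I * A / 2 ≠ 0) : IsJostMinus₂ u ξ fun x =>
      ((ξ - Complex.I * A / 2)⁻¹ * Complex.exp (Complex.I * ξ * x)) •
      ![-(Complex.I / 2) * u x, ξ + Complex.I / 2 * (u x - A)] := by
  refine ⟨hp.solves₂ _, ?_⟩
  have h := tendsto_vec (hl.const_mul (-(Complex.I / 2)))
    (((hl.sub_const (A : ℂ)).const_mul (Complex.I / 2)).const_add ξ)
  have := tendsto_exp_smul (z := -(Complex.I * ξ)) (c := (ξ - Complex.I * A / 2)⁻¹) h
    (a' := ![0, 1]) (by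
      rw [vec_smul]
      congr 1
      · simp
      · rw [show ξ + Complex.I / 2 * (0 - A) = ξ - Complex.I * A / 2 by ring, inv_mul_cancel₀ hξ])
  simpa only [neg_neg, neg_mul] using this

theorem IsProfile.a₁_eq (hp : IsProfile A u) (hl : Tendsto u atBot (𝓝 0))
    (hr : Tendsto u atTop (𝓝 (A : ℂ))) (hξ : 0 ≤ ξ.im) (hξ0 : ξ ≠ 0) :
    a₁ A u ξ = (ξ - Complex.I * A / 2) / ξ := by
  rw [a₁, jostMinus₁_eq hp.continuous hξ (hp.isJostMinus₁ hl hξ0),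
    jostPlus₂_eq hp.continuous hξ (hp.isJostPlus₂ hr hξ0)]
  simp [wr]
  field_simp
  ring

theorem IsProfile.a₂_eq (hp : IsProfile A u) (hl : Tendsto u atBot (𝓝 0))
    (hr : Tendsto u atTop (𝓝 (A : ℂ))) (hA : 0 < A) (hξ : ξ.im ≤ 0) :
    a₂ u ξ = ξ / (ξ - Complex.I * A / 2) := by
  have h := sub_ne_zero_of_im_nonpos hA hξ
  rw [a₂, jostPlus₁_eq hp.continuous hξ (hp.isJostPlus₁ hr h),
    jostMinus₂_eq hp.continuous hξ (hp.isJostMinus₂ hl h)]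
  simp only [wr, vec_smul, Matrix.cons_val_zero, Matrix.cons_val_one, Complex.ofReal_zero, mul_zero,
    Complex.exp_zero, mul_one]
  generalize hz : ξ - Complex.I * A / 2 = z at h
  have hA2 : Complex.I * A = 2 * (ξ - z) := by rw [← hz]; ring
  field_simp
  linear_combination -2 * ξ * hA2

/-- The parameter `κ` of the profile is the norming constant at the zero `iA/2` of `a₁`. -/
theorem IsProfile.isNorming (hp : IsProfile A u) (hl : Tendsto u atBot (𝓝 0))
    (hr : Tendsto u atTop (𝓝 (A : ℂ))) (hA : 0 < A)
    (h : ∀ x : ℝ, u x * (1 - κ * Complex.exp (-(A * x))) = A) : IsNorming A u (A / 2) κ := by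
  have hAC : (A : ℂ) ≠ 0 := Complex.ofReal_ne_zero.2 hA.ne'
  have him : 0 ≤ (Complex.I * ((A / 2 : ℝ) : ℂ)).im := by simp; positivity
  have h0 : Complex.I * ((A / 2 : ℝ) : ℂ) ≠ 0 := by simp [hA.ne']
  intro x
  rw [jostMinus₁_eq hp.continuous him (hp.isJostMinus₁ hl h0),
    jostPlus₂_eq hp.continuous him (hp.isJostPlus₂ hr h0)]
  have e2 : Complex.I * (Complex.I * ((A / 2 : ℝ) : ℂ)) = -(A / 2) := by
    push_cast
    linear_combination (A / 2 : ℂ) * Complex.I_sq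
  simp only [e2, neg_mul, neg_neg]
  have hEE : Complex.exp (A / 2 * x) * Complex.exp (-(A * x)) = Complex.exp (-(A / 2 * x)) := by
    rw [← Complex.exp_add]; ring_nf
  have hx := h x
  have key : Complex.exp (A / 2 * x) * (A - u x) = -(κ * Complex.exp (-(A / 2 * x)) * u x) := by
    rw [← hEE]
    linear_combination -Complex.exp (A / 2 * x) * hx
  rw [vec_smul, vec_smul, vec_smul]
  congr 1
  · push_cast
    linear_combination (Complex.I * (A / 2))⁻¹ * (Complex.I / 2) * key
  · congr 1
    push_cast
    linear_combination -(Complex.I * (A / 2))⁻¹ * (Complex.I / 2) * key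

theorem IsProfile.deriv_a₁ (hp : IsProfile A u) (hl : Tendsto u atBot (𝓝 0))
    (hr : Tendsto u atTop (𝓝 (A : ℂ))) (hA : 0 < A) :
    deriv (a₁ A u) (Complex.I * A / 2) = -2 * Complex.I / A := by
  have hAC : (A : ℂ) ≠ 0 := Complex.ofReal_ne_zero.2 hA.ne'
  have h0 : Complex.I * A / 2 ≠ 0 := by simp [hA.ne']
  have hmem : {ξ : ℂ | 0 < ξ.im} ∈ 𝓝 (Complex.I * A / 2) :=
    (isOpen_lt continuous_const Complex.continuous_im).mem_nhds (by simp; positivity)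
  have heq : a₁ A u =ᶠ[𝓝 (Complex.I * A / 2)] fun ξ => (ξ - Complex.I * A / 2) / ξ := by
    filter_upwards [hmem] with ξ hξ
    exact hp.a₁_eq hl hr (le_of_lt hξ) (by rintro rfl; simp at hξ)
  rw [heq.deriv_eq]
  have := ((hasDerivAt_id (Complex.I * A / 2)).sub_const (Complex.I * A / 2)).div
    (hasDerivAt_id (Complex.I * A / 2)) h0
  refine this.deriv.trans ?_
  simp only [id, sub_self, one_mul, mul_one, sub_zero]
  have hI := Complex.I_ne_zero
  field_simp
  linear_combination Complex.I_sq

/-- The numbers in Case 2 are read off from `a₁ = (ξ - iA/2)/ξ` and `a₂ = ξ/(ξ - iA/2)`. -/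
theorem Case2.data_of_isProfile {ξ₁ : ℝ} {a₁₁ d₂ : ℂ} (hc : Case2 A u ξ₁ a₁₁ d₂)
    (hp : IsProfile A u) (hl : Tendsto u atBot (𝓝 0)) (hr : Tendsto u atTop (𝓝 (A : ℂ)))
    (hA : 0 < A) : ξ₁ = A / 2 ∧ a₁₁ = -(Complex.I * A / 2) ∧ d₂ = 2 * Complex.I / A := by
  have hAC : (A : ℂ) ≠ 0 := Complex.ofReal_ne_zero.2 hA.ne'
  have h0 : Complex.I * A / 2 ≠ 0 := by simp [hA.ne']
  have him : 0 ≤ (Complex.I * A / 2).im := by simp; positivity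
  refine ⟨?_, ?_, ?_⟩
  · have := (hc.zero_a₁ _ him h0).1 (by rw [hp.a₁_eq hl hr him h0]; simp)
    have := congrArg Complex.im this
    simp at this
    exact this.symm
  · have h1 : Tendsto (fun ξ : ℂ => ξ - Complex.I * A / 2) (𝓝[{ξ : ℂ | 0 ≤ ξ.im ∧ ξ ≠ 0}] 0)
        (𝓝 (0 - Complex.I * A / 2)) :=
      ((continuous_id.sub continuous_const).tendsto 0).mono_left nhdsWithin_le_nhds
    rw [zero_sub] at h1
    have hne : (𝓝[{ξ : ℂ | 0 ≤ ξ.im ∧ ξ ≠ 0}] (0 : ℂ)).NeBot := by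
      have ht : Tendsto (fun s : ℝ => (s : ℂ)) (𝓝[≠] 0) (𝓝[{ξ : ℂ | 0 ≤ ξ.im ∧ ξ ≠ 0}] 0) := by
        refine tendsto_nhdsWithin_iff.2 ⟨?_, ?_⟩
        · exact (Complex.continuous_ofReal.tendsto' 0 0 (by simp)).mono_left nhdsWithin_le_nhds
        · filter_upwards [self_mem_nhdsWithin] with s hs
          exact ⟨by simp, Complex.ofReal_ne_zero.2 hs⟩
      exact ht.neBot
    refine tendsto_nhds_unique hc.lim_a₁ (h1.congr' ?_)
    filter_upwards [self_mem_nhdsWithin] with ξ hξ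
    rw [hp.a₁_eq hl hr hξ.1 hξ.2, mul_div_cancel₀ _ hξ.2]
  · have hd : HasDerivAt (fun ξ : ℂ => ξ / (ξ - Complex.I * A / 2)) (2 * Complex.I / A) 0 := by
      have := (hasDerivAt_id (0 : ℂ)).div ((hasDerivAt_id (0 : ℂ)).sub_const (Complex.I * A / 2))
        (by simpa using hA.ne')
      refine this.congr_deriv ?_
      simp only [id, zero_sub, one_mul, mul_one, sub_zero]
      have hI := Complex.I_ne_zero
      field_simp
      linear_combination -Complex.I_sq
    have hd' : HasDerivWithinAt (a₂ u) (2 * Complex.I / A) {ξ : ℂ | ξ.im ≤ 0} 0 :=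
      hd.hasDerivWithinAt.congr (fun ξ hξ => hp.a₂_eq hl hr hA hξ) (hp.a₂_eq hl hr hA (by simp))
    have hconv : Convex ℝ {ξ : ℂ | ξ.im ≤ 0} := convex_halfSpace_im_le 0
    have huniq : UniqueDiffWithinAt ℂ {ξ : ℂ | ξ.im ≤ 0} 0 := by
      have : UniqueDiffWithinAt ℝ {ξ : ℂ | ξ.im ≤ 0} 0 := by
        refine uniqueDiffWithinAt_convex hconv ?_ (subset_closure (by simp))
        refine ⟨-Complex.I, mem_interior_iff_mem_nhds.2 ?_⟩
        refine mem_of_superset ((isOpen_lt Complex.continuous_im continuous_const).mem_nhds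
          (show (-Complex.I).im < 0 by simp)) fun ξ (hξ : ξ.im < 0) => hξ.le
      exact this.mono_field
    exact huniq.eq_deriv _ hc.deriv_a₂ hd'

end Data

/-! ### Functions without jump across the real axis -/

section NoJump

/-- Estimates pass to the continuous extension to boundary points. -/
theorem norm_extendFrom_mul_sub_le {S W : Set ℂ} {h k : ℂ → ℂ} {ξ c y : ℂ} {B : ℝ}
    (hξ : ξ ∈ closure S) (hW : IsOpen W) (hξW : ξ ∈ W) (hy : Tendsto h (𝓝[S] ξ) (𝓝 y))
    (hk : ContinuousAt k ξ) (hB : ∀ ζ ∈ S, ζ ∈ W → ‖h ζ * k ζ - c‖ ≤ B) :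
    ‖extendFrom S h ξ * k ξ - c‖ ≤ B := by
  have : (𝓝[S] ξ).NeBot := mem_closure_iff_nhdsWithin_neBot.1 hξ
  rw [extendFrom_eq hξ hy]
  refine le_of_tendsto (((hy.mul (hk.tendsto.mono_left nhdsWithin_le_nhds)).sub_const c).norm) ?_
  filter_upwards [self_mem_nhdsWithin, mem_nhdsWithin_of_mem_nhds (hW.mem_nhds hξW)] with ζ h1 h2
  exact hB ζ h1 h2

theorem eventually_norm_extendFrom_le {S T : Set ℂ} {h : ℂ → ℂ} (hT : ∀ ξ ∈ T, ξ ∈ closure S)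
    (hlim : ∀ ξ ∈ T, ξ ≠ 0 → ∃ y, Tendsto h (𝓝[S] ξ) (𝓝 y))
    (hO : h =O[𝓝[S] 0] fun _ => (1 : ℂ)) : ∃ B : ℝ, ∀ᶠ ξ in 𝓝 (0 : ℂ), ξ ∈ T → ξ ≠ 0 →
      ‖extendFrom S h ξ‖ ≤ B := by
  obtain ⟨B, hB⟩ := hO.bound
  obtain ⟨W, hW, h0, hWB⟩ := mem_nhdsWithin.1 hB
  refine ⟨B, ?_⟩
  filter_upwards [hW.mem_nhds h0] with ξ hξ hT' hξ0
  obtain ⟨y, hy⟩ := hlim ξ hT' hξ0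
  have := norm_extendFrom_mul_sub_le (k := fun _ => 1) (c := 0) (B := B) (hT ξ hT') hW hξ hy
    continuousAt_const fun ζ h1 h2 => by simpa using hWB ⟨h2, h1⟩
  simpa using this

theorem tendsto_extendFrom {S T : Set ℂ} {h : ℂ → ℂ} {c : ℂ} (hT : ∀ ξ ∈ T, ξ ∈ closure S)
    (hlim : ∀ ξ ∈ T, ξ ≠ 0 → ∃ y, Tendsto h (𝓝[S] ξ) (𝓝 y))
    (hc : Tendsto (fun ξ => h ξ * ξ⁻¹) (cocompact ℂ ⊓ 𝓟 S) (𝓝 c)) :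
    Tendsto (fun ξ => extendFrom S h ξ * ξ⁻¹) (cocompact ℂ ⊓ 𝓟 T) (𝓝 c) := by
  rw [Metric.tendsto_nhds]
  intro ε hε
  have h1 := Metric.tendsto_nhds.1 hc (ε / 2) (half_pos hε)
  rw [eventually_inf_principal, ← Metric.cobounded_eq_cocompact, ← comap_norm_atTop,
    eventually_comap] at h1
  obtain ⟨R, hR⟩ := eventually_atTop.1 h1
  rw [eventually_inf_principal]
  filter_upwards [tendsto_norm_cocompact_atTop.eventually_gt_atTop (max R 0)] with ξ hξ hξT
  have hξ0 : ξ ≠ 0 := norm_pos_iff.1 ((le_max_right _ _).trans_lt hξ)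
  obtain ⟨y, hy⟩ := hlim ξ hξT hξ0
  have := norm_extendFrom_mul_sub_le (k := fun ξ => ξ⁻¹) (c := c) (B := ε / 2) (hT ξ hξT)
    (isOpen_lt continuous_const continuous_norm) hξ hy (continuousAt_inv₀ hξ0)
    fun ζ h1 (h2 : max R 0 < ‖ζ‖) => by
      have := hR ‖ζ‖ ((le_max_left _ _).trans h2.le) ζ rfl h1
      rw [dist_eq_norm] at this
      exact this.le
  rw [dist_eq_norm]
  linarith

/-- A function that is analytic off the real axis, has no jump across `ℝ \ {0}`, is bounded near `0`
and grows at most linearly is affine. -/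
theorem eq_affine_of_no_jump {h : ℂ → ℂ} {c : ℂ} (hd : DifferentiableOn ℂ h {ξ : ℂ | ξ.im ≠ 0})
    (hj : ∀ s : ℝ, s ≠ 0 → ∃ y, Tendsto h (𝓝[{ξ : ℂ | 0 < ξ.im}] (s : ℂ)) (𝓝 y) ∧
      Tendsto h (𝓝[{ξ : ℂ | ξ.im < 0}] (s : ℂ)) (𝓝 y))
    (h0 : h =O[𝓝[{ξ : ℂ | 0 < ξ.im}] 0] fun _ => (1 : ℂ))
    (h0' : h =O[𝓝[{ξ : ℂ | ξ.im < 0}] 0] fun _ => (1 : ℂ))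
    (hc : Tendsto (fun ξ => h ξ * ξ⁻¹) (cocompact ℂ ⊓ 𝓟 {ξ : ℂ | ξ.im ≠ 0}) (𝓝 c)) :
    ∃ d : ℂ, ∀ ξ : ℂ, ξ.im ≠ 0 → h ξ = c * ξ + d := by
  set U : Set ℂ := {ξ : ℂ | 0 < ξ.im} with hU
  set L : Set ℂ := {ξ : ℂ | ξ.im < 0} with hL
  have hUo : IsOpen U := isOpen_lt continuous_const Complex.continuous_im
  have hLo : IsOpen L := isOpen_lt Complex.continuous_im continuous_const
  have hUc : ∀ ξ ∈ {ξ : ℂ | 0 ≤ ξ.im}, ξ ∈ closure U := fun ξ hξ => by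
    rw [hU, Complex.closure_setOfPred_lt_im]; exact hξ
  have hLc : ∀ ξ ∈ {ξ : ℂ | ξ.im ≤ 0}, ξ ∈ closure L := fun ξ hξ => by
    rw [hL, Complex.closure_setOfPred_im_lt]; exact hξ
  have hcont : ∀ ξ : ℂ, ξ.im ≠ 0 → ContinuousAt h ξ := fun ξ hξ =>
    (hd.differentiableAt ((isOpen_ne_fun Complex.continuous_im continuous_const).mem_nhds
      hξ)).continuousAt
  have hreal : ∀ ξ : ℂ, ξ.im = 0 → ξ ≠ 0 → ∃ y, Tendsto h (𝓝[U] ξ) (𝓝 y) ∧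
      Tendsto h (𝓝[L] ξ) (𝓝 y) := fun ξ him hne => by
    have hξ : ξ = (ξ.re : ℂ) := Complex.ext (by simp) (by simp [him])
    rw [hξ]
    exact hj _ fun h' => hne (by rw [hξ, h', Complex.ofReal_zero])
  have hlimU : ∀ ξ ∈ {ξ : ℂ | 0 ≤ ξ.im}, ξ ≠ 0 → ∃ y, Tendsto h (𝓝[U] ξ) (𝓝 y) := by
    intro ξ hξ hne
    rcases eq_or_ne ξ.im 0 with him | him
    · exact (hreal ξ him hne).imp fun y h => h.1
    · exact ⟨_, (hcont ξ him).tendsto.mono_left nhdsWithin_le_nhds⟩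
  have hlimL : ∀ ξ ∈ {ξ : ℂ | ξ.im ≤ 0}, ξ ≠ 0 → ∃ y, Tendsto h (𝓝[L] ξ) (𝓝 y) := by
    intro ξ hξ hne
    rcases eq_or_ne ξ.im 0 with him | him
    · exact (hreal ξ him hne).imp fun y h => h.2
    · exact ⟨_, (hcont ξ him).tendsto.mono_left nhdsWithin_le_nhds⟩
  have hextU : ∀ ξ ∈ U, extendFrom U h ξ = h ξ := fun ξ (hξ : 0 < ξ.im) =>
    extendFrom_eq (subset_closure hξ)
      ((hcont ξ (ne_of_gt hξ)).tendsto.mono_left nhdsWithin_le_nhds)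
  have hextL : ∀ ξ ∈ L, extendFrom L h ξ = h ξ := fun ξ (hξ : ξ.im < 0) =>
    extendFrom_eq (subset_closure hξ)
      ((hcont ξ (ne_of_lt hξ)).tendsto.mono_left nhdsWithin_le_nhds)
  obtain ⟨B, hB⟩ := eventually_norm_extendFrom_le hUc hlimU h0
  obtain ⟨B', hB'⟩ := eventually_norm_extendFrom_le hLc hlimL h0'
  obtain ⟨d, hd1, hd2⟩ := eq_affine_of_glue (f := extendFrom U h) (g := extendFrom L h) (c := c)
    (continuousOn_extendFrom (fun ξ hξ => hUc ξ hξ.1) fun ξ hξ => hlimU ξ hξ.1 hξ.2)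
    ((hd.mono fun ξ (hξ : 0 < ξ.im) => ne_of_gt hξ).congr hextU)
    (continuousOn_extendFrom (fun ξ hξ => hLc ξ hξ.1) fun ξ hξ => hlimL ξ hξ.1 hξ.2)
    ((hd.mono fun ξ (hξ : ξ.im < 0) => ne_of_lt hξ).congr hextL)
    (fun ξ him hne => by
      obtain ⟨y, hy1, hy2⟩ := hreal ξ him hne
      rw [extendFrom_eq (hUc ξ him.ge) hy1, extendFrom_eq (hLc ξ him.le) hy2])
    (B := max B B')
    (hB.mono fun ξ h1 h2 h3 => (h1 h2 h3).trans (le_max_left _ _))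
    (hB'.mono fun ξ h1 h2 h3 => (h1 h2 h3).trans (le_max_right _ _))
    (tendsto_extendFrom hUc hlimU (hc.mono_left (inf_le_inf_left _ (principal_mono.2
      fun ξ (hξ : 0 < ξ.im) => ne_of_gt hξ))))
    (tendsto_extendFrom hLc hlimL (hc.mono_left (inf_le_inf_left _ (principal_mono.2
      fun ξ (hξ : ξ.im < 0) => ne_of_lt hξ))))
  refine ⟨d, fun ξ hξ => ?_⟩
  rcases lt_or_gt_of_ne hξ with him | him
  · rw [← hextL ξ him]
    exact hd2 ξ him.le (by rintro rfl; simp at him)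
  · rw [← hextU ξ him]
    exact hd1 ξ him.le (by rintro rfl; simp at him)

end NoJump

/-! ### The Riemann-Hilbert problem -/

section RH

variable {A γ α x t : ℝ} {u : ℝ → ℂ} {ξ : ℂ}

/-- The exponential in the denominator of the soliton. -/
noncomputable def expo (A γ α x t : ℝ) : ℂ :=
  Complex.exp (-A * x + Complex.I / 2 * A ^ 2 * t + Complex.I * A ^ 4 * γ * t + Complex.I * α)

theorem den_eq : den A γ α x t = 1 - expo A γ α x t := rfl

theorem conj_expo_neg_mul (A γ α x t : ℝ) :
    (starRingEnd ℂ) (expo A γ α (-x) t) * expo A γ α x t = 1 := by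
  unfold expo
  rw [← Complex.exp_conj, ← Complex.exp_add, ← Complex.exp_zero]
  congr 1
  simp [Complex.conj_ofNat]
  ring

theorem conj_den_neg_mul (A γ α x t : ℝ) :
    (starRingEnd ℂ) (den A γ α (-x) t) * expo A γ α x t = -den A γ α x t := by
  rw [den_eq, den_eq, map_sub, map_one, sub_mul, conj_expo_neg_mul]
  ring

theorem den_neg_ne_zero (h : den A γ α x t ≠ 0) : den A γ α (-x) t ≠ 0 := by
  intro h0
  have := conj_den_neg_mul A γ α x t
  rw [h0, map_zero, zero_mul] at this
  exact h (neg_eq_zero.1 this.symm)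

theorem solF_mul_den (h : den A γ α x t ≠ 0) :
    solF A γ α x t * den A γ α x t = A / (2 * Complex.I) := by
  rw [solF, div_mul_cancel₀ _ h]

/-- The symmetry `x ↦ -x` inverts the exponential up to conjugation. -/
theorem conj_solF_neg (h : den A γ α x t ≠ 0) :
    (starRingEnd ℂ) (solF A γ α (-x) t) = expo A γ α x t * solF A γ α x t := by
  have h1 := congrArg (starRingEnd ℂ) (solF_mul_den (den_neg_ne_zero h))
  have h2 := conj_den_neg_mul A γ α x t
  have h3 := solF_mul_den h
  have h4 : (starRingEnd ℂ) ((A : ℂ) / (2 * Complex.I)) = -(A / (2 * Complex.I)) := by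
    simp [Complex.conj_ofNat, div_neg]
  rw [h4, map_mul] at h1
  apply mul_right_cancel₀ h
  linear_combination -expo A γ α x t * h1 - expo A γ α x t * h3
    + (starRingEnd ℂ) (solF A γ α (-x) t) * h2

theorem expo_mul_solF (h : den A γ α x t ≠ 0) :
    expo A γ α x t * solF A γ α x t = solF A γ α x t + Complex.I * A / 2 := by
  have h3 := solF_mul_den h
  rw [den_eq] at h3
  have h4 : (A : ℂ) / (2 * Complex.I) = -(Complex.I * A / 2) := by
    have := Complex.I_ne_zero
    field_simp
    linear_combination (A : ℂ) * Complex.I_sq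
  rw [h4] at h3
  linear_combination -h3

theorem jump_eq_one (hb : ∀ s : ℝ, s ≠ 0 → b A u s = 0) {s : ℝ} (hs : s ≠ 0) :
    jump A γ u x t s = 1 := by
  ext i j
  fin_cases i <;> fin_cases j <;> simp [jump, hb s hs, hb (-s) (neg_ne_zero.2 hs)]

theorem isBigO_inv_sub (c : ℂ) :
    (fun ξ : ℂ => (ξ - c)⁻¹) =O[cocompact ℂ] fun ξ => ξ⁻¹ := by
  refine IsBigO.of_bound 2 ?_
  filter_upwards [tendsto_norm_cocompact_atTop.eventually_gt_atTop (2 * ‖c‖)] with ξ hξ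
  have h0 : 0 < ‖ξ‖ := (by positivity : (0 : ℝ) ≤ 2 * ‖c‖).trans_lt hξ
  have h1 := norm_sub_norm_le ξ c
  rw [norm_inv, norm_inv, ← div_eq_mul_inv, inv_eq_one_div]
  rw [div_le_div_iff₀ (by linarith) h0]
  linarith

/-- The residue coefficient of the explicit data. -/
theorem residue_coeff (hA : 0 < A) :
    Complex.exp (Complex.I * α) / (-2 * Complex.I / A) * Complex.exp (-2 * ((A / 2 : ℝ) : ℂ) * x
      + 2 * Complex.I * ((A / 2 : ℝ) : ℂ) ^ 2 * t
      + 16 * Complex.I * ((A / 2 : ℝ) : ℂ) ^ 4 * γ * t)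
      = expo A γ α x t * (Complex.I * A / 2) := by
  have hAC : (A : ℂ) ≠ 0 := Complex.ofReal_ne_zero.2 hA.ne'
  have hI := Complex.I_ne_zero
  rw [div_mul_eq_mul_div, ← Complex.exp_add]
  have : Complex.I * α + (-2 * ((A / 2 : ℝ) : ℂ) * x + 2 * Complex.I * ((A / 2 : ℝ) : ℂ) ^ 2 * t
      + 16 * Complex.I * ((A / 2 : ℝ) : ℂ) ^ 4 * γ * t) = -A * x + Complex.I / 2 * A ^ 2 * t
      + Complex.I * A ^ 4 * γ * t + Complex.I * α := by
    push_cast; ring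
  rw [this, ← expo]
  field_simp
  linear_combination -expo A γ α x t * Complex.I_sq

theorem isBigO_nhdsWithin_self {f : ℂ → ℂ} {c : ℂ} {S : Set ℂ} (hf : DifferentiableAt ℂ f 0)
    (hc : f 0 = c) : (fun ξ => f ξ - c) =O[𝓝[S] 0] fun ξ => ξ := by
  have := hf.isBigO_sub.mono (nhdsWithin_le_nhds (s := S))
  simpa [hc] using this

theorem I_mul_half (A : ℝ) : Complex.I * ((A / 2 : ℝ) : ℂ) = Complex.I * A / 2 := by
  push_cast; ring

/-- Existence for the Riemann-Hilbert problem of a one-soliton profile. -/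
theorem isRHSolution_solM (hA : 0 < A)
    (hd₁ : deriv (a₁ A u) (Complex.I * A / 2) = -2 * Complex.I / A)
    (hb : ∀ s : ℝ, s ≠ 0 → b A u s = 0) (hden : den A γ α x t ≠ 0) :
    IsRHSolution A γ u (A / 2) (-(Complex.I * A / 2)) (2 * Complex.I / A)
      (Complex.exp (Complex.I * α)) x t (solM A γ α x t) := by
  have hAC : (A : ℂ) ≠ 0 := Complex.ofReal_ne_zero.2 hA.ne'
  have hI := Complex.I_ne_zero
  have hi0 : Complex.I * A / 2 ≠ 0 := by simp [hA.ne']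
  set F := solF A γ α x t with hF
  set G := (starRingEnd ℂ) (solF A γ α (-x) t) with hG
  have hGF : G = F + Complex.I * A / 2 := by rw [hG, conj_solF_neg hden, expo_mul_solF hden]
  have hzF := expo_mul_solF hden
  rw [← hF] at hzF
  have hsub : ∀ ξ : ℂ, ξ ≠ Complex.I * ((A / 2 : ℝ) : ℂ) → ξ - Complex.I * A / 2 ≠ 0 :=
    fun ξ h h' => h (by rw [I_mul_half]; exact sub_eq_zero.1 h')
  have hne0 : ∀ ξ : ℂ, ξ.im ≠ 0 → ξ ≠ 0 := fun ξ h h' => h (by rw [h']; rfl)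
  refine ⟨fun i => ?_, fun i => ?_, ?_, fun i j => ?_, fun i => ?_, ?_⟩
  · fin_cases i
    · change DifferentiableOn ℂ (fun ξ => (ξ + F) / (ξ - Complex.I * A / 2)) _
      exact DifferentiableOn.div (by fun_prop) (by fun_prop) fun ξ hξ => hsub ξ hξ.2
    · change DifferentiableOn ℂ (fun ξ => -G / (ξ - Complex.I * A / 2)) _
      exact DifferentiableOn.div (by fun_prop) (by fun_prop) fun ξ hξ => hsub ξ hξ.2
  · fin_cases i
    · change DifferentiableOn ℂ (fun ξ => F / ξ) _
      exact DifferentiableOn.div (by fun_prop) (by fun_prop) fun ξ hξ => hne0 ξ hξ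
    · change DifferentiableOn ℂ (fun ξ => (ξ - G) / ξ) _
      exact DifferentiableOn.div (by fun_prop) (by fun_prop) fun ξ hξ => hne0 ξ hξ
  · refine ⟨fun s => solM A γ α x t s, fun s => solM A γ α x t s, fun s hs => ?_⟩
    have hs' : (s : ℂ) ≠ 0 := Complex.ofReal_ne_zero.2 hs
    have hs'' : (s : ℂ) - Complex.I * A / 2 ≠ 0 := fun h => by
      have := congrArg Complex.im h
      simp at this
      exact hA.ne' this
    have hc : ContinuousAt (solM A γ α x t) s := by
      refine continuousAt_pi.2 fun i => continuousAt_pi.2 fun j => ?_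
      fin_cases i <;> fin_cases j
      · change ContinuousAt (fun ξ => (ξ + F) / (ξ - Complex.I * A / 2)) _
        exact ContinuousAt.div (by fun_prop) (by fun_prop) hs''
      · change ContinuousAt (fun ξ => F / ξ) _
        exact ContinuousAt.div (by fun_prop) (by fun_prop) hs'
      · change ContinuousAt (fun ξ => -G / (ξ - Complex.I * A / 2)) _
        exact ContinuousAt.div (by fun_prop) (by fun_prop) hs''
      · change ContinuousAt (fun ξ => (ξ - G) / ξ) _
        exact ContinuousAt.div (by fun_prop) (by fun_prop) hs'
    exact ⟨hc.tendsto.mono_left nhdsWithin_le_nhds, hc.tendsto.mono_left nhdsWithin_le_nhds, by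
      rw [jump_eq_one hb hs, mul_one]⟩
  · have hne : ∀ᶠ ξ : ℂ in cocompact ℂ, ξ ≠ 0 ∧ ξ ≠ Complex.I * ((A / 2 : ℝ) : ℂ) :=
      eventually_and.2 ⟨isCompact_singleton.compl_mem_cocompact,
        isCompact_singleton.compl_mem_cocompact⟩
    refine IsBigO.mono ?_ inf_le_left
    fin_cases i <;> fin_cases j
    · refine ((isBigO_inv_sub (Complex.I * A / 2)).const_mul_left
        (F + Complex.I * A / 2)).congr' ?_ EventuallyEq.rfl
      filter_upwards [hne] with ξ hξ
      have := hsub ξ hξ.2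
      change _ = (ξ + F) / (ξ - Complex.I * A / 2) - 1
      rw [div_sub_one this, div_eq_mul_inv]
      ring
    · refine ((isBigO_refl (fun ξ : ℂ => ξ⁻¹) _).const_mul_left F).congr_left fun ξ => ?_
      change _ = F / ξ - 0
      rw [sub_zero]
      exact (div_eq_mul_inv _ _).symm
    · refine ((isBigO_inv_sub (Complex.I * A / 2)).const_mul_left (-G)).congr_left fun ξ => ?_
      change _ = -G / (ξ - Complex.I * A / 2) - 0
      rw [sub_zero]
      exact (div_eq_mul_inv _ _).symm
    · refine ((isBigO_refl (fun ξ : ℂ => ξ⁻¹) _).const_mul_left (-G)).congr' ?_ EventuallyEq.rfl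
      filter_upwards [hne] with ξ hξ
      change _ = (ξ - G) / ξ - 1
      rw [div_sub_one hξ.1, div_eq_mul_inv]
      ring
  · rw [I_mul_half, hd₁, residue_coeff hA]
    fin_cases i
    · have h1 : Tendsto (fun ξ : ℂ => ξ + F) (𝓝[≠] (Complex.I * A / 2))
          (𝓝 (Complex.I * A / 2 + F)) :=
        ((continuous_id.add continuous_const).tendsto _).mono_left nhdsWithin_le_nhds
      have hv : expo A γ α x t * (Complex.I * A / 2) * (F / (Complex.I * A / 2))
          = Complex.I * A / 2 + F := by
        rw [mul_assoc, mul_div_cancel₀ _ hi0, hzF]; ring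
      change Tendsto (fun ξ => (ξ - Complex.I * A / 2) * ((ξ + F) / (ξ - Complex.I * A / 2))) _
        (𝓝 (expo A γ α x t * (Complex.I * A / 2) * (F / (Complex.I * A / 2))))
      rw [hv]
      refine h1.congr' ?_
      filter_upwards [self_mem_nhdsWithin] with ξ hξ
      rw [mul_div_cancel₀ _ (sub_ne_zero.2 hξ)]
    · have hv : expo A γ α x t * (Complex.I * A / 2) * ((Complex.I * A / 2 - G) /
          (Complex.I * A / 2)) = -G := by
        rw [mul_assoc, mul_div_cancel₀ _ hi0, hGF]
        linear_combination -hzF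
      change Tendsto (fun ξ => (ξ - Complex.I * A / 2) * (-G / (ξ - Complex.I * A / 2))) _
        (𝓝 (expo A γ α x t * (Complex.I * A / 2) * ((Complex.I * A / 2 - G) /
          (Complex.I * A / 2))))
      rw [hv]
      refine tendsto_const_nhds.congr' ?_
      filter_upwards [self_mem_nhdsWithin] with ξ hξ
      rw [mul_div_cancel₀ _ (sub_ne_zero.2 hξ)]
  · refine ⟨![fun y => solF A γ α y t, fun y => -(starRingEnd ℂ) (solF A γ α (-y) t)], ?_⟩
    have hz : (0 : ℂ) - Complex.I * A / 2 ≠ 0 := by rw [zero_sub]; exact neg_ne_zero.2 hi0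
    have hdiff : ∀ c e : ℂ, DifferentiableAt ℂ (fun ξ => (c * ξ + e) / (ξ - Complex.I * A / 2)) 0 :=
      fun c e => DifferentiableAt.div (by fun_prop) (by fun_prop) hz
    have hcol1 : ∀ (S : Set ℂ) (v : ℂ), (F / (0 - Complex.I * A / 2) = v →
        (fun ξ => (ξ + F) / (ξ - Complex.I * A / 2) - v) =O[𝓝[S] 0] fun ξ => ξ) ∧
        (-G / (0 - Complex.I * A / 2) = v →
        (fun ξ => -G / (ξ - Complex.I * A / 2) - v) =O[𝓝[S] 0] fun ξ => ξ) := fun S v =>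
      ⟨fun h => by
        have := isBigO_nhdsWithin_self (S := S) (hdiff 1 F) (c := v) (by simpa using h)
        simpa using this, fun h => by
        have := isBigO_nhdsWithin_self (S := S) (hdiff 0 (-G)) (c := v) (by simpa using h)
        simpa using this⟩
    have hcol2 : ∀ (S : Set ℂ), (∀ ξ ∈ S, ξ ≠ 0) → ∀ v : ℂ,
        (F = v → (fun ξ => ξ * (F / ξ) - v) =O[𝓝[S] 0] fun ξ => ξ) ∧
        (-G = v → (fun ξ => ξ * ((ξ - G) / ξ) - v) =O[𝓝[S] 0] fun ξ => ξ) := fun S hS v =>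
      ⟨fun h => by
        refine (isBigO_zero (fun ξ : ℂ => ξ) (𝓝[S] (0 : ℂ))).congr' ?_ EventuallyEq.rfl
        filter_upwards [self_mem_nhdsWithin] with ξ hξ
        rw [mul_div_cancel₀ _ (hS ξ hξ), h, sub_self], fun h => by
        refine (isBigO_refl (fun ξ : ℂ => ξ) (𝓝[S] (0 : ℂ))).congr' ?_ EventuallyEq.rfl
        filter_upwards [self_mem_nhdsWithin] with ξ hξ
        rw [mul_div_cancel₀ _ (hS ξ hξ), ← h]
        ring⟩
    have hU : ∀ ξ ∈ {ξ : ℂ | 0 < ξ.im}, ξ ≠ 0 := fun ξ hξ => hne0 ξ (ne_of_gt hξ)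
    have hL : ∀ ξ ∈ {ξ : ℂ | ξ.im < 0}, ξ ≠ 0 := fun ξ hξ => hne0 ξ (ne_of_lt hξ)
    have hFx : -(starRingEnd ℂ) (-(starRingEnd ℂ) (solF A γ α (- -x) t)) = F := by
      simp [hF]
    have hrat : ∀ w : ℂ, w / (0 - Complex.I * A / 2) = 2 * Complex.I / A * w := fun w => by
      rw [zero_sub]
      field_simp
      linear_combination -w * Complex.I_sq
    rw [Fin.forall_fin_two]
    refine ⟨⟨(hcol1 _ _).1 (by rw [zero_sub]; rfl), (hcol2 _ hU _).1 hFx.symm,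
      (hcol1 _ _).1 ?_, (hcol2 _ hL _).1 ?_⟩, ⟨(hcol1 _ _).2 (by rw [zero_sub]; rfl),
      (hcol2 _ hU _).2 rfl, (hcol1 _ _).2 ?_, (hcol2 _ hL _).2 ?_⟩⟩
    · rw [hrat]
      exact congrArg _ hFx.symm
    · change F = 2 * Complex.I / A * (F / (2 * Complex.I / A))
      field_simp
    · rw [hrat]; rfl
    · change -G = 2 * Complex.I / A * (-G / (2 * Complex.I / A))
      field_simp

end RH

/-! ### Uniqueness for the Riemann-Hilbert problem -/

section RHUnique

variable {A γ α x t : ℝ} {u : ℝ → ℂ} {ξ : ℂ} {M : ℂ → Matrix (Fin 2) (Fin 2) ℂ}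

theorem tendsto_of_isBigO_self {l : Filter ℂ} (hl : l ≤ 𝓝 0) {f : ℂ → ℂ} {c : ℂ}
    (h : (fun ξ => f ξ - c) =O[l] fun ξ => ξ) : Tendsto f l (𝓝 c) := by
  have h1 : Tendsto (fun ξ : ℂ => ξ) l (𝓝 0) := tendsto_id.mono_left hl
  simpa using (h.trans_tendsto h1).add_const c

theorem neBot_nhdsWithin_upper : (𝓝[{ξ : ℂ | 0 < ξ.im}] (0 : ℂ)).NeBot := by
  rw [← mem_closure_iff_nhdsWithin_neBot, Complex.closure_setOfPred_lt_im]
  simp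

theorem neBot_nhdsWithin_lower : (𝓝[{ξ : ℂ | ξ.im < 0}] (0 : ℂ)).NeBot := by
  rw [← mem_closure_iff_nhdsWithin_neBot, Complex.closure_setOfPred_im_lt]
  simp

theorem tendsto_of_isBigO_inv {l : Filter ℂ} (hl : l ≤ cocompact ℂ) {f : ℂ → ℂ} {c : ℂ}
    (h : (fun ξ => f ξ - c) =O[l] fun ξ => ξ⁻¹) : Tendsto f l (𝓝 c) := by
  have h1 : Tendsto (fun ξ : ℂ => ξ⁻¹) l (𝓝 0) :=
    (tendsto_inv₀_cobounded.mono_left (Metric.cobounded_eq_cocompact (α := ℂ)).ge).mono_left hl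
  simpa using (h.trans_tendsto h1).add_const c

/-- For vanishing reflection coefficient `ξ M_{i2}` has no jump, hence is affine. -/
theorem IsRHSolution.exists_col₂ {ξ₁ : ℝ} {a₁₁ d₂ r₁ : ℂ}
    (hM : IsRHSolution A γ u ξ₁ a₁₁ d₂ r₁ x t M)
    (hb : ∀ s : ℝ, s ≠ 0 → b A u s = 0) (i : Fin 2) :
    ∃ c : ℂ, ∀ ξ : ℂ, ξ.im ≠ 0 → ξ * M ξ i 1 = (1 : Matrix (Fin 2) (Fin 2) ℂ) i 1 * ξ + c := by
  obtain ⟨f, hf⟩ := hM.singularity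
  obtain ⟨Mp, Mm, hJ⟩ := hM.jump_cond
  refine eq_affine_of_no_jump (h := fun ξ => ξ * M ξ i 1)
    (differentiableOn_id.mul (hM.analytic₂ i)) (fun s hs => ?_) ?_ ?_ ?_
  · obtain ⟨h1, h2, h3⟩ := hJ s hs
    rw [jump_eq_one hb hs, mul_one] at h3
    have hid : ∀ S : Set ℂ, Tendsto (fun ξ : ℂ => ξ) (𝓝[S] (s : ℂ)) (𝓝 s) := fun S =>
      tendsto_id.mono_left nhdsWithin_le_nhds
    have e1 := tendsto_pi_nhds.1 (tendsto_pi_nhds.1 h1 i) 1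
    have e2 := tendsto_pi_nhds.1 (tendsto_pi_nhds.1 h2 i) 1
    rw [← h3] at e2
    exact ⟨_, (hid _).mul e1, (hid _).mul e2⟩
  · exact (tendsto_of_isBigO_self nhdsWithin_le_nhds (hf i).2.1).isBigO_one ℂ
  · exact (tendsto_of_isBigO_self nhdsWithin_le_nhds (hf i).2.2.2).isBigO_one ℂ
  · refine (tendsto_of_isBigO_inv inf_le_left (hM.normalization i 1)).congr' ?_
    rw [EventuallyEq, eventually_inf_principal]
    refine Eventually.of_forall fun ξ (hξ : ξ.im ≠ 0) => ?_
    have : ξ ≠ 0 := by rintro rfl; simp at hξ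
    field_simp

/-- For vanishing reflection coefficient `(ξ - iξ₁) M_{i1}` has no jump and a removable singularity
at `iξ₁`, hence is affine. -/
theorem IsRHSolution.exists_col₁ {ξ₁ : ℝ} (hξ₁ : 0 < ξ₁) {a₁₁ d₂ r₁ : ℂ}
    (hM : IsRHSolution A γ u ξ₁ a₁₁ d₂ r₁ x t M)
    (hb : ∀ s : ℝ, s ≠ 0 → b A u s = 0) (i : Fin 2) :
    ∃ c : ℂ, (∀ ξ : ℂ, ξ.im ≠ 0 → ξ ≠ Complex.I * ξ₁ → (ξ - Complex.I * ξ₁) * M ξ i 0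
        = (1 : Matrix (Fin 2) (Fin 2) ℂ) i 0 * ξ + c) ∧
      r₁ / deriv (a₁ A u) (Complex.I * ξ₁)
        * Complex.exp (-2 * ξ₁ * x + 2 * Complex.I * ξ₁ ^ 2 * t + 16 * Complex.I * ξ₁ ^ 4 * γ * t)
        * M (Complex.I * ξ₁) i 1
        = (1 : Matrix (Fin 2) (Fin 2) ℂ) i 0 * (Complex.I * ξ₁) + c := by
  classical
  obtain ⟨f, hf⟩ := hM.singularity
  obtain ⟨Mp, Mm, hJ⟩ := hM.jump_cond
  have hres := hM.residue i
  set R := r₁ / deriv (a₁ A u) (Complex.I * ξ₁)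
        * Complex.exp (-2 * ξ₁ * x + 2 * Complex.I * ξ₁ ^ 2 * t + 16 * Complex.I * ξ₁ ^ 4 * γ * t)
        * M (Complex.I * ξ₁) i 1
  set p : ℂ := Complex.I * ξ₁ with hp
  have hpim : p.im = ξ₁ := by simp [hp]
  have hpim0 : p.im ≠ 0 := by rw [hpim]; exact hξ₁.ne'
  set h := Function.update (fun ξ => (ξ - p) * M ξ i 0) p R with hh
  have hne : ∀ ξ, ξ ≠ p → h ξ = (ξ - p) * M ξ i 0 := fun ξ hξ => Function.update_of_ne hξ _ _
  have hopen : IsOpen {ξ : ℂ | ξ.im ≠ 0} := isOpen_ne_fun Complex.continuous_im continuous_const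
  have hd : DifferentiableOn ℂ h {ξ : ℂ | ξ.im ≠ 0} := by
    refine (Complex.differentiableOn_compl_singleton_and_continuousAt_iff
      (hopen.mem_nhds hpim0)).1 ⟨?_, continuousAt_update_same.2 hres⟩
    refine (((differentiable_id.sub_const p).differentiableOn.mul (hM.analytic₁ i)).mono
      fun ξ hξ => ⟨hξ.1, hξ.2⟩).congr fun ξ hξ => hne ξ hξ.2
  have hev : ∀ ξ₀ : ℂ, ξ₀.im = 0 → ∀ S : Set ℂ, ∀ᶠ ξ in 𝓝[S] ξ₀, (ξ - p) * M ξ i 0 = h ξ := by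
    intro ξ₀ h0 S
    have : ξ₀ ≠ p := fun h' => hpim0 (by rw [← h', h0])
    filter_upwards [mem_nhdsWithin_of_mem_nhds (isOpen_ne.mem_nhds this)] with ξ hξ
    exact (hne ξ hξ).symm
  have hid : ∀ (ξ₀ : ℂ) (S : Set ℂ), Tendsto (fun ξ : ℂ => ξ - p) (𝓝[S] ξ₀) (𝓝 (ξ₀ - p)) :=
    fun ξ₀ S => ((continuous_id.sub continuous_const).tendsto _).mono_left nhdsWithin_le_nhds
  obtain ⟨c, hc⟩ := eq_affine_of_no_jump (h := h) (c := (1 : Matrix (Fin 2) (Fin 2) ℂ) i 0) hd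
    (fun s hs => by
      obtain ⟨h1, h2, h3⟩ := hJ s hs
      rw [jump_eq_one hb hs, mul_one] at h3
      have e1 := tendsto_pi_nhds.1 (tendsto_pi_nhds.1 h1 i) 0
      have e2 := tendsto_pi_nhds.1 (tendsto_pi_nhds.1 h2 i) 0
      rw [← h3] at e2
      exact ⟨_, ((hid _ _).mul e1).congr' (hev s (by simp) _),
        ((hid _ _).mul e2).congr' (hev s (by simp) _)⟩)
    ((((hid _ _).mul (tendsto_of_isBigO_self nhdsWithin_le_nhds (hf i).1)).congr'
      (hev 0 (by simp) _)).isBigO_one ℂ)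
    ((((hid _ _).mul (tendsto_of_isBigO_self nhdsWithin_le_nhds (hf i).2.2.1)).congr'
      (hev 0 (by simp) _)).isBigO_one ℂ)
    (by
      have h1 := tendsto_of_isBigO_inv inf_le_left (hM.normalization i 0)
      have hinv : Tendsto (fun ξ : ℂ => 1 - p * ξ⁻¹)
          (cocompact ℂ ⊓ 𝓟 {ξ : ℂ | ξ.im ≠ 0}) (𝓝 1) := by
        have : Tendsto (fun ξ : ℂ => ξ⁻¹) (cocompact ℂ ⊓ 𝓟 {ξ : ℂ | ξ.im ≠ 0}) (𝓝 0) :=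
          (tendsto_inv₀_cobounded.mono_left
            (Metric.cobounded_eq_cocompact (α := ℂ)).ge).mono_left inf_le_left
        simpa using (this.const_mul p).const_sub 1
      have h2 := hinv.mul h1
      rw [one_mul] at h2
      refine h2.congr' ?_
      have hpc : ∀ᶠ ξ in cocompact ℂ, ξ ≠ p := isCompact_singleton.compl_mem_cocompact
      rw [EventuallyEq, eventually_inf_principal]
      filter_upwards [hpc] with ξ hξp (hξ : ξ.im ≠ 0)
      have : ξ ≠ 0 := by rintro rfl; simp at hξ
      rw [hne ξ hξp]
      field_simp)
  refine ⟨c, fun ξ hξ hξp => ?_, ?_⟩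
  · rw [← hne ξ hξp]; exact hc ξ hξ
  · rw [← hc p hpim0, hh, Function.update_self]

/-- Uniqueness for the Riemann-Hilbert problem: the conditions at `0` and at `iA/2` determine the
constant terms of the affine functions `ξ M_{i2}` and `(ξ - iA/2) M_{i1}`. -/
theorem eq_solM_of_isRHSolution (hA : 0 < A)
    (hd₁ : deriv (a₁ A u) (Complex.I * A / 2) = -2 * Complex.I / A)
    (hb : ∀ s : ℝ, s ≠ 0 → b A u s = 0) (hden : den A γ α x t ≠ 0)
    (hM : IsRHSolution A γ u (A / 2) (-(Complex.I * A / 2)) (2 * Complex.I / A)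
      (Complex.exp (Complex.I * α)) x t M) (hξ : ξ.im ≠ 0)
    (hξp : ξ ≠ Complex.I * ((A / 2 : ℝ) : ℂ)) : M ξ = solM A γ α x t ξ := by
  have hAC : (A : ℂ) ≠ 0 := Complex.ofReal_ne_zero.2 hA.ne'
  have hi0 : Complex.I * A / 2 ≠ 0 := by simp [hA.ne']
  have him : (Complex.I * A / 2).im ≠ 0 := by simp [hA.ne']
  choose c hc using fun i => hM.exists_col₂ hb i
  choose e he heR using fun i => hM.exists_col₁ (half_pos hA) hb i
  obtain ⟨f, hf⟩ := hM.singularity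
  simp only [I_mul_half, hd₁, residue_coeff hA] at he heR
  -- the constant terms are the limits at the origin
  have hlim1 : ∀ (S : Set ℂ), (∀ ξ ∈ S, ξ.im ≠ 0) → (𝓝[S] (0 : ℂ)).NeBot → ∀ i v,
      Tendsto (fun ξ => M ξ i 0) (𝓝[S] 0) (𝓝 v) → -(Complex.I * A / 2) * v = e i := by
    intro S hS hne i v hv
    have h1 : Tendsto (fun ξ : ℂ => ξ - Complex.I * A / 2) (𝓝[S] 0) (𝓝 (0 - Complex.I * A / 2)) :=
      ((continuous_id.sub continuous_const).tendsto _).mono_left nhdsWithin_le_nhds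
    have h2 : Tendsto (fun ξ : ℂ => (1 : Matrix (Fin 2) (Fin 2) ℂ) i 0 * ξ + e i) (𝓝[S] 0)
        (𝓝 (e i)) := by
      have : Continuous fun ξ : ℂ => (1 : Matrix (Fin 2) (Fin 2) ℂ) i 0 * ξ + e i := by fun_prop
      exact (this.tendsto' 0 _ (by simp)).mono_left nhdsWithin_le_nhds
    have h3 := h1.mul hv
    rw [zero_sub] at h3
    refine tendsto_nhds_unique h3 (h2.congr' ?_)
    filter_upwards [self_mem_nhdsWithin,
      mem_nhdsWithin_of_mem_nhds (isOpen_ne.mem_nhds hi0.symm)] with ξ h4 h5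
    exact (he i ξ (hS ξ h4) h5).symm
  have hlim2 : ∀ i v, Tendsto (fun ξ => ξ * M ξ i 1) (𝓝[{ξ : ℂ | 0 < ξ.im}] 0) (𝓝 v) →
      v = c i := by
    intro i v hv
    have := neBot_nhdsWithin_upper
    have h2 : Tendsto (fun ξ : ℂ => (1 : Matrix (Fin 2) (Fin 2) ℂ) i 1 * ξ + c i)
        (𝓝[{ξ : ℂ | 0 < ξ.im}] 0) (𝓝 (c i)) := by
      have : Continuous fun ξ : ℂ => (1 : Matrix (Fin 2) (Fin 2) ℂ) i 1 * ξ + c i := by fun_prop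
      exact (this.tendsto' 0 _ (by simp)).mono_left nhdsWithin_le_nhds
    refine tendsto_nhds_unique hv (h2.congr' ?_)
    filter_upwards [self_mem_nhdsWithin] with ξ h4
    exact (hc i ξ (ne_of_gt h4)).symm
  -- both constants belong to `conj f_{1-i}(-x)`, by the conditions from above and from below
  have hce : ∀ i, c i = e i := fun i => by
    have h1 := hlim2 i _ (tendsto_of_isBigO_self nhdsWithin_le_nhds (hf i).2.1)
    have h2 := hlim1 {ξ : ℂ | ξ.im < 0} (fun ξ hξ => ne_of_lt hξ) neBot_nhdsWithin_lower i _
      (tendsto_of_isBigO_self nhdsWithin_le_nhds (hf i).2.2.1)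
    rw [h1] at h2
    rw [← h2]
    field_simp
    linear_combination c i * Complex.I_sq
  -- the residue condition
  have hrel : ∀ i, expo A γ α x t * ((1 : Matrix (Fin 2) (Fin 2) ℂ) i 1 * (Complex.I * A / 2) + c i)
      = (1 : Matrix (Fin 2) (Fin 2) ℂ) i 0 * (Complex.I * A / 2) + c i := fun i => by
    have h1 := heR i
    rw [← hc i _ him, hce, ← h1]
    ring
  have hF := solF_mul_den hden
  have hG := conj_solF_neg hden
  have hI2 : (A : ℂ) / (2 * Complex.I) = -(Complex.I * A / 2) := by
    have := Complex.I_ne_zero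
    field_simp
    linear_combination Complex.I_sq
  have hc0 : c 0 = solF A γ α x t := by
    have h1 := hrel 0
    simp only [Matrix.one_apply_eq, one_mul, Matrix.one_apply_ne (show (0 : Fin 2) ≠ 1 by decide),
      zero_mul, zero_add] at h1
    apply mul_right_cancel₀ hden
    rw [hF, hI2, den_eq]
    linear_combination -h1
  have hc1 : c 1 = -(starRingEnd ℂ) (solF A γ α (-x) t) := by
    have h1 := hrel 1
    simp only [Matrix.one_apply_eq, one_mul, Matrix.one_apply_ne (show (1 : Fin 2) ≠ 0 by decide),
      zero_mul, zero_add] at h1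
    apply mul_right_cancel₀ hden
    rw [hG, neg_mul, mul_assoc, hF, hI2, den_eq]
    linear_combination -h1
  have hξ0 : ξ ≠ 0 := by rintro rfl; simp at hξ
  rw [I_mul_half] at hξp
  have hsub := sub_ne_zero.2 hξp
  ext i j
  fin_cases i <;> fin_cases j
  · change M ξ 0 0 = (ξ + solF A γ α x t) / (ξ - Complex.I * A / 2)
    rw [eq_div_iff hsub, mul_comm, he 0 ξ hξ hξp, ← hce, hc0]
    simp
  · change M ξ 0 1 = solF A γ α x t / ξ
    rw [eq_div_iff hξ0, mul_comm, hc 0 ξ hξ, hc0]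
    simp
  · change M ξ 1 0 = -(starRingEnd ℂ) (solF A γ α (-x) t) / (ξ - Complex.I * A / 2)
    rw [eq_div_iff hsub, mul_comm, he 1 ξ hξ hξp, ← hce, hc1]
    simp
  · change M ξ 1 1 = (ξ - (starRingEnd ℂ) (solF A γ α (-x) t)) / ξ
    rw [eq_div_iff hξ0, mul_comm, hc 1 ξ hξ, hc1]
    simp [sub_eq_add_neg]

theorem tendsto_solM (A γ α x t : ℝ) :
    Tendsto (fun ξ : ℂ => 2 * Complex.I * (ξ * solM A γ α x t ξ 0 1)) (cocompact ℂ)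
      (𝓝 (soliton A γ α x t)) := by
  refine tendsto_const_nhds.congr' ?_
  have hne : ∀ᶠ ξ : ℂ in cocompact ℂ, ξ ≠ 0 := isCompact_singleton.compl_mem_cocompact
  filter_upwards [hne] with ξ hξ
  change soliton A γ α x t = 2 * Complex.I * (ξ * (solF A γ α x t / ξ))
  have := Complex.I_ne_zero
  rw [mul_div_cancel₀ _ hξ, soliton, solF]
  field_simp

end RHUnique

/-! ### The one-soliton solves the equation -/

section Soliton

variable {A γ α x t : ℝ}

/-- Where `g' = f (A - f)` and `f' = f (A - f)`, the derivatives of `g` are polynomials in `f`. -/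
theorem iteratedDeriv_of_riccati {f g : ℝ → ℂ} {U : Set ℝ} (hU : IsOpen U) {A : ℂ}
    (hf : ∀ y ∈ U, HasDerivAt f (A * f y - f y ^ 2) y)
    (hg : ∀ y ∈ U, HasDerivAt g (A * f y - f y ^ 2) y) {x : ℝ} (hx : x ∈ U) :
    iteratedDeriv 1 g x = A * f x - f x ^ 2 ∧
    iteratedDeriv 2 g x = (A - 2 * f x) * (A * f x - f x ^ 2) ∧
    iteratedDeriv 4 g x = (A ^ 3 - 14 * A ^ 2 * f x + 36 * A * f x ^ 2 - 24 * f x ^ 3)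
      * (A * f x - f x ^ 2) := by
  have step : ∀ (n : ℕ) (P P' : ℂ → ℂ), (∀ z, HasDerivAt P (P' z) z) →
      (∀ y ∈ U, iteratedDeriv n g y = P (f y)) →
      ∀ y ∈ U, iteratedDeriv (n + 1) g y = P' (f y) * (A * f y - f y ^ 2) := by
    intro n P P' hP hn y hy
    have heq : iteratedDeriv n g =ᶠ[𝓝 y] fun y => P (f y) :=
      eventually_of_mem (hU.mem_nhds hy) hn
    rw [iteratedDeriv_succ, heq.deriv_eq]
    exact ((hP (f y)).comp y (hf y hy)).deriv
  have h1 : ∀ y ∈ U, iteratedDeriv 1 g y = A * f y - f y ^ 2 := fun y hy => by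
    rw [iteratedDeriv_one]; exact (hg y hy).deriv
  have hq : ∀ (n : ℕ) (z : ℂ), HasDerivAt (fun z : ℂ => z ^ n) (n * z ^ (n - 1)) z :=
    fun n z => hasDerivAt_pow n z
  have h2 := step 1 (fun z => A * z - z ^ 2) (fun z => A - 2 * z) (fun z =>
    (((hasDerivAt_id z).const_mul A).sub (hq 2 z)).congr_deriv (by simp)) h1
  have h3 := step 2 (fun z => (A - 2 * z) * (A * z - z ^ 2))
    (fun z => A ^ 2 - 6 * A * z + 6 * z ^ 2)
    (fun z => ((((hasDerivAt_id z).const_mul 2).const_sub A).mul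
      (((hasDerivAt_id z).const_mul A).sub (hq 2 z))).congr_deriv (by simp; ring)) h2
  have h4 := step 3 (fun z => (A ^ 2 - 6 * A * z + 6 * z ^ 2) * (A * z - z ^ 2))
    (fun z => A ^ 3 - 14 * A ^ 2 * z + 36 * A * z ^ 2 - 24 * z ^ 3)
    (fun z => (((((hasDerivAt_id z).const_mul (6 * A)).const_sub (A ^ 2)).add
      ((hq 2 z).const_mul 6)).mul
      (((hasDerivAt_id z).const_mul A).sub (hq 2 z))).congr_deriv (by simp; ring)) h3
  exact ⟨h1 x hx, h2 x hx, h4 x hx⟩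

theorem contDiff_expo : ContDiff ℝ (⊤ : ℕ∞) fun p : ℝ × ℝ => expo A γ α p.1 p.2 := by
  unfold expo
  have h1 : ContDiff ℝ (⊤ : ℕ∞) fun p : ℝ × ℝ => (p.1 : ℂ) :=
    Complex.ofRealCLM.contDiff.comp contDiff_fst
  have h2 : ContDiff ℝ (⊤ : ℕ∞) fun p : ℝ × ℝ => (p.2 : ℂ) :=
    Complex.ofRealCLM.contDiff.comp contDiff_snd
  refine ContDiff.cexp ?_
  fun_prop

theorem contDiffAt_soliton (h : den A γ α x t ≠ 0) :
    ContDiffAt ℝ (⊤ : ℕ∞) (fun p : ℝ × ℝ => soliton A γ α p.1 p.2) (x, t) := by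
  have hd : ContDiff ℝ (⊤ : ℕ∞) fun p : ℝ × ℝ => den A γ α p.1 p.2 :=
    contDiff_const.sub contDiff_expo
  have := (contDiffAt_const (c := (A : ℂ))).mul ((hd.contDiffAt (x := (x, t))).inv h)
  simp only [soliton, div_eq_mul_inv]
  exact this

theorem soliton_mul_den (h : den A γ α x t ≠ 0) : soliton A γ α x t * den A γ α x t = A :=
  div_mul_cancel₀ _ h

/-- The nonlocal partner of the soliton is a local function of it. -/
theorem partner_soliton (h : den A γ α x t ≠ 0) :
    partner (soliton A γ α) x t = soliton A γ α x t - A := by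
  have h1 := congrArg (starRingEnd ℂ) (soliton_mul_den (den_neg_ne_zero h))
  have h2 := conj_den_neg_mul A γ α x t
  have h3 := soliton_mul_den h
  rw [map_mul, Complex.conj_ofReal] at h1
  have h4 : expo A γ α x t = 1 - den A γ α x t := by rw [den_eq]; ring
  apply mul_right_cancel₀ h
  unfold partner
  rw [h4] at h2
  linear_combination -(starRingEnd ℂ) (soliton A γ α (-x) t) * h2 - h3
    + (1 - den A γ α x t) * h1

theorem hasDerivAt_expo_x : HasDerivAt (fun y => expo A γ α y t) (-A * expo A γ α x t) x := by
  have h := ((hasDerivAt_cexp_mul (-A) x).mul_const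
    (Complex.exp (Complex.I / 2 * A ^ 2 * t + Complex.I * A ^ 4 * γ * t + Complex.I * α)))
  have he : ∀ y : ℝ, expo A γ α y t = Complex.exp (-A * y) *
      Complex.exp (Complex.I / 2 * A ^ 2 * t + Complex.I * A ^ 4 * γ * t + Complex.I * α) :=
    fun y => by rw [← Complex.exp_add, expo]; ring_nf
  refine (h.congr_of_eventuallyEq (Eventually.of_forall he)).congr_deriv ?_
  rw [he]; ring

theorem hasDerivAt_expo_t : HasDerivAt (fun s => expo A γ α x s)
    ((Complex.I / 2 * A ^ 2 + Complex.I * A ^ 4 * γ) * expo A γ α x t) t := by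
  have h := ((hasDerivAt_cexp_mul (Complex.I / 2 * A ^ 2 + Complex.I * A ^ 4 * γ) t).mul_const
    (Complex.exp (-A * x + Complex.I * α)))
  have he : ∀ s : ℝ, expo A γ α x s = Complex.exp ((Complex.I / 2 * A ^ 2 + Complex.I * A ^ 4 * γ)
      * s) * Complex.exp (-A * x + Complex.I * α) :=
    fun y => by rw [← Complex.exp_add, expo]; ring_nf
  refine (h.congr_of_eventuallyEq (Eventually.of_forall he)).congr_deriv ?_
  rw [he]; ring

theorem hasDerivAt_soliton_of {s₀ : ℝ} {f : ℝ → ℂ} {f' : ℂ} (hf : HasDerivAt f f' s₀)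
    (h : 1 - f s₀ ≠ 0) :
    HasDerivAt (fun s => (A : ℂ) / (1 - f s)) (A / (1 - f s₀) * (f' / (1 - f s₀))) s₀ := by
  refine ((hasDerivAt_const s₀ (A : ℂ)).div (hf.const_sub 1) h).congr_deriv ?_
  field_simp
  ring

theorem hasDerivAt_soliton_x (h : den A γ α x t ≠ 0) :
    HasDerivAt (fun y => soliton A γ α y t)
      (A * soliton A γ α x t - soliton A γ α x t ^ 2) x := by
  refine (hasDerivAt_soliton_of (A := A) (hasDerivAt_expo_x (A := A) (γ := γ) (α := α) (t := t))
    h).congr_deriv ?_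
  rw [← den_eq]
  have h3 := soliton_mul_den h
  have h4 : expo A γ α x t = 1 - den A γ α x t := by rw [den_eq]; ring
  rw [h4, ← soliton]
  field_simp
  linear_combination soliton A γ α x t * h3

theorem hasDerivAt_soliton_t (h : den A γ α x t ≠ 0) :
    HasDerivAt (fun s => soliton A γ α x s)
      (Complex.I * (A / 2 + A ^ 3 * γ) * soliton A γ α x t * (soliton A γ α x t - A)) t := by
  refine (hasDerivAt_soliton_of (A := A) (hasDerivAt_expo_t (A := A) (γ := γ) (α := α) (x := x))
    h).congr_deriv ?_
  rw [← den_eq]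
  have h3 := soliton_mul_den h
  have h4 : expo A γ α x t = 1 - den A γ α x t := by rw [den_eq]; ring
  rw [h4, ← soliton]
  field_simp
  linear_combination -soliton A γ α x t * (A + 2 * A ^ 3 * γ) * h3

/-- With `q_x = q (A - q)`, `r = q - A` and `q_t = i (A/2 + A³γ) q r`, the equation is a polynomial
identity in `q`. -/
theorem satisfiesLPDAt_soliton (h : den A γ α x t ≠ 0) :
    SatisfiesLPDAt γ (soliton A γ α) x t := by
  have hUo : IsOpen {y : ℝ | den A γ α y t ≠ 0} := by
    have hc : Continuous fun y : ℝ => den A γ α y t := by unfold den; fun_prop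
    exact isOpen_ne_fun hc continuous_const
  have hf : ∀ y ∈ {y : ℝ | den A γ α y t ≠ 0}, HasDerivAt (fun y => soliton A γ α y t)
      (A * soliton A γ α y t - soliton A γ α y t ^ 2) y := fun y hy => hasDerivAt_soliton_x hy
  have hg : ∀ y ∈ {y : ℝ | den A γ α y t ≠ 0}, HasDerivAt
      (fun y => partner (soliton A γ α) y t)
      (A * soliton A γ α y t - soliton A γ α y t ^ 2) y := fun y hy =>
    ((hf y hy).sub_const (A : ℂ)).congr_of_eventuallyEq
      (eventually_of_mem (hUo.mem_nhds hy) fun z hz => partner_soliton hz)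
  obtain ⟨q1, q2, q4⟩ := iteratedDeriv_of_riccati hUo hf hf h
  obtain ⟨r1, r2, -⟩ := iteratedDeriv_of_riccati hUo hf hg h
  unfold SatisfiesLPDAt higherTerm dx
  rw [(hasDerivAt_soliton_t h).deriv, q1, q2, q4, r1, r2, partner_soliton h]
  ring

theorem norm_expo (A γ α x t : ℝ) : ‖expo A γ α x t‖ = Real.exp (-A * x) := by
  rw [expo, Complex.norm_exp]
  congr 1
  simp [← Complex.ofReal_pow]

theorem tendsto_soliton_atTop (hA : 0 < A) :
    Tendsto (fun x => soliton A γ α x t) atTop (𝓝 (A : ℂ)) := by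
  have h : Tendsto (fun x => expo A γ α x t) atTop (𝓝 0) := by
    rw [tendsto_zero_iff_norm_tendsto_zero]
    simp only [norm_expo]
    exact Real.tendsto_exp_atBot.comp (tendsto_id.const_mul_atTop_of_neg (by linarith))
  have h1 := (tendsto_const_nhds (x := (A : ℂ))).div (h.const_sub 1) (by simp)
  rw [sub_zero, div_one] at h1
  exact h1

theorem tendsto_soliton_atBot (hA : 0 < A) :
    Tendsto (fun x => soliton A γ α x t) atBot (𝓝 0) := by
  have h : Tendsto (fun x => ‖expo A γ α x t‖) atBot atTop := by
    simp only [norm_expo]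
    exact Real.tendsto_exp_atTop.comp (tendsto_id.const_mul_atBot_of_neg (by linarith))
  have h2 : Tendsto (fun x => ‖den A γ α x t‖) atBot atTop := by
    refine tendsto_atTop_mono (fun x => ?_) (tendsto_atTop_add_const_right _ (-1) h)
    have := norm_sub_norm_le (expo A γ α x t) 1
    rw [norm_sub_rev, ← den_eq, norm_one] at this
    linarith
  rw [tendsto_zero_iff_norm_tendsto_zero]
  have h3 := (tendsto_const_nhds (x := ‖(A : ℂ)‖)).div_atTop h2
  refine h3.congr fun x => ?_
  rw [soliton, norm_div]

end Soliton

/-! ### The Lax pair -/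

section LaxPair

variable {γ : ℝ} {ξ : ℂ}

/-- The diagonal entry of the `t`-part of the Lax pair, as a function of the jets
`Q = (q, q_x, q_xx, …)` and `R = (r, r_x, r_xx, …)`. -/
noncomputable def laxTa (γ : ℝ) (ξ : ℂ) (Q R : ℕ → ℂ) : ℂ :=
  Complex.I * ξ ^ 2 + Complex.I / 2 * (Q 0 * R 0) + γ * (-8 * Complex.I * ξ ^ 4
    - 4 * Complex.I * ξ ^ 2 * (Q 0 * R 0) - 2 * ξ * (Q 0 * R 1 - Q 1 * R 0)
    + Complex.I * (Q 0 * R 2 - Q 1 * R 1 + Q 2 * R 0) - 3 * Complex.I * (Q 0 * R 0) ^ 2)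

/-- The upper off-diagonal entry of the `t`-part of the Lax pair. -/
noncomputable def laxTb (γ : ℝ) (ξ : ℂ) (Q R : ℕ → ℂ) : ℂ :=
  -ξ * Q 0 - Complex.I / 2 * Q 1 + γ * (8 * ξ ^ 3 * Q 0 + 4 * Complex.I * ξ ^ 2 * Q 1
    + ξ * (-2 * Q 2 + 4 * (Q 0 * Q 0 * R 0)) - Complex.I * Q 3 + 6 * Complex.I * (Q 0 * Q 1 * R 0))

/-- The lower off-diagonal entry of the `t`-part of the Lax pair. -/
noncomputable def laxTc (γ : ℝ) (ξ : ℂ) (Q R : ℕ → ℂ) : ℂ :=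
  -ξ * R 0 + Complex.I / 2 * R 1 + γ * (8 * ξ ^ 3 * R 0 - 4 * Complex.I * ξ ^ 2 * R 1
    + ξ * (-2 * R 2 + 4 * (Q 0 * R 0 * R 0)) + Complex.I * R 3 - 6 * Complex.I * (Q 0 * R 0 * R 1))

/-- The matrix of the `t`-part `ψ_t = V ψ` of the Lax pair. -/
noncomputable def laxT (γ : ℝ) (ξ : ℂ) (Q R : ℕ → ℂ) : Matrix (Fin 2) (Fin 2) ℂ :=
  !![laxTa γ ξ Q R, laxTb γ ξ Q R; laxTc γ ξ Q R, -laxTa γ ξ Q R]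

/-- The value of `q_t` prescribed by the equation. -/
noncomputable def qFlow (γ : ℝ) (Q R : ℕ → ℂ) : ℂ :=
  -(Complex.I / 2) * Q 2 + Complex.I * Q 0 ^ 2 * R 0 + γ * (-Complex.I * Q 4
    + 6 * Complex.I * R 0 * Q 1 ^ 2 + 4 * Complex.I * Q 0 * Q 1 * R 1
    + 8 * Complex.I * R 0 * Q 0 * Q 2 + 2 * Complex.I * Q 0 ^ 2 * R 2
    - 6 * Complex.I * R 0 ^ 2 * Q 0 ^ 3)

/-- The value of `r_t` prescribed by the equation. -/
noncomputable def rFlow (γ : ℝ) (Q R : ℕ → ℂ) : ℂ :=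
  Complex.I / 2 * R 2 - Complex.I * R 0 ^ 2 * Q 0 + γ * (Complex.I * R 4
    - 6 * Complex.I * Q 0 * R 1 ^ 2 - 4 * Complex.I * R 0 * R 1 * Q 1
    - 8 * Complex.I * Q 0 * R 0 * R 2 - 2 * Complex.I * R 0 ^ 2 * Q 2
    + 6 * Complex.I * Q 0 ^ 2 * R 0 ^ 3)

variable {Q R : ℝ → ℕ → ℂ} {x : ℝ}

/-- The diagonal part of the zero curvature equation. -/
theorem hasDerivAt_laxTa (hQ : ∀ k ≤ 3, HasDerivAt (fun y => Q y k) (Q x (k + 1)) x)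
    (hR : ∀ k ≤ 3, HasDerivAt (fun y => R y k) (R x (k + 1)) x) :
    HasDerivAt (fun y => laxTa γ ξ (Q y) (R y))
      (Q x 0 * laxTc γ ξ (Q x) (R x) - laxTb γ ξ (Q x) (R x) * R x 0) x := by
  have h0 := hQ 0 (by norm_num)
  have h1 := hQ 1 (by norm_num)
  have h2 := hQ 2 (by norm_num)
  have k0 := hR 0 (by norm_num)
  have k1 := hR 1 (by norm_num)
  have k2 := hR 2 (by norm_num)
  have p := h0.mul k0
  refine (((p.const_mul (Complex.I / 2)).const_add (Complex.I * ξ ^ 2)).add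
    ((((((p.const_mul (4 * Complex.I * ξ ^ 2)).const_sub (-8 * Complex.I * ξ ^ 4)).sub
    (((h0.mul k1).sub (h1.mul k0)).const_mul (2 * ξ))).add
    ((((h0.mul k2).sub (h1.mul k1)).add (h2.mul k0)).const_mul Complex.I)).sub
    ((p.pow 2).const_mul (3 * Complex.I))).const_mul (γ : ℂ))).congr_deriv ?_
  simp only [laxTb, laxTc, Pi.mul_apply]
  norm_num
  ring

/-- The upper off-diagonal part of the zero curvature equation. -/
theorem hasDerivAt_laxTb (hQ : ∀ k ≤ 3, HasDerivAt (fun y => Q y k) (Q x (k + 1)) x)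
    (hR : ∀ k ≤ 3, HasDerivAt (fun y => R y k) (R x (k + 1)) x) :
    HasDerivAt (fun y => laxTb γ ξ (Q y) (R y)) (qFlow γ (Q x) (R x)
      - 2 * Complex.I * ξ * laxTb γ ξ (Q x) (R x) - 2 * laxTa γ ξ (Q x) (R x) * Q x 0) x := by
  have h0 := hQ 0 (by norm_num)
  have h1 := hQ 1 (by norm_num)
  have h2 := hQ 2 (by norm_num)
  have h3 := hQ 3 (by norm_num)
  have k0 := hR 0 (by norm_num)
  refine (((h0.const_mul (-ξ)).sub (h1.const_mul (Complex.I / 2))).add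
    ((((((h0.const_mul (8 * ξ ^ 3)).add (h1.const_mul (4 * Complex.I * ξ ^ 2))).add
    (((h2.const_mul (-2)).add (((h0.mul h0).mul k0).const_mul 4)).const_mul ξ)).sub
    (h3.const_mul Complex.I)).add (((h0.mul h1).mul k0).const_mul (6 * Complex.I))).const_mul
      (γ : ℂ))).congr_deriv ?_
  simp only [laxTb, laxTa, qFlow, Pi.mul_apply, zero_add, Nat.reduceAdd]
  linear_combination 2 * ξ * (-Q x 1 / 2 + γ * (4 * Q x 1 * ξ ^ 2 - Q x 3
    + 6 * Q x 0 * Q x 1 * R x 0)) * Complex.I_sq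

/-- The lower off-diagonal part of the zero curvature equation. -/
theorem hasDerivAt_laxTc (hQ : ∀ k ≤ 3, HasDerivAt (fun y => Q y k) (Q x (k + 1)) x)
    (hR : ∀ k ≤ 3, HasDerivAt (fun y => R y k) (R x (k + 1)) x) :
    HasDerivAt (fun y => laxTc γ ξ (Q y) (R y)) (rFlow γ (Q x) (R x)
      + 2 * Complex.I * ξ * laxTc γ ξ (Q x) (R x) + 2 * laxTa γ ξ (Q x) (R x) * R x 0) x := by
  have h0 := hQ 0 (by norm_num)
  have k0 := hR 0 (by norm_num)
  have k1 := hR 1 (by norm_num)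
  have k2 := hR 2 (by norm_num)
  have k3 := hR 3 (by norm_num)
  refine (((k0.const_mul (-ξ)).add (k1.const_mul (Complex.I / 2))).add
    ((((((k0.const_mul (8 * ξ ^ 3)).sub (k1.const_mul (4 * Complex.I * ξ ^ 2))).add
    (((k2.const_mul (-2)).add (((h0.mul k0).mul k0).const_mul 4)).const_mul ξ)).add
    (k3.const_mul Complex.I)).sub (((h0.mul k0).mul k1).const_mul (6 * Complex.I))).const_mul
      (γ : ℂ))).congr_deriv ?_
  simp only [laxTc, laxTa, rFlow, Pi.mul_apply, zero_add, Nat.reduceAdd]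
  linear_combination -2 * ξ * (R x 1 / 2 + γ * (-4 * R x 1 * ξ ^ 2 + R x 3
    - 6 * Q x 0 * R x 0 * R x 1)) * Complex.I_sq

/-- The matrix `U_t` of the Lax pair. -/
noncomputable def laxXt (γ : ℝ) (Q R : ℕ → ℂ) : Matrix (Fin 2) (Fin 2) ℂ :=
  !![0, qFlow γ Q R; rFlow γ Q R, 0]

/-- The zero curvature equation `U_t = V_x + VU - UV`, in the form in which it enters the time
evolution: for solutions `v`, `w` of `φ_x = Uφ`, the derivative of `det (V v, w)` is
`det (U_t v, w)`. -/
theorem hasDerivAt_wr_laxT {v w : ℝ → Fin 2 → ℂ}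
    (hQ : ∀ k ≤ 3, HasDerivAt (fun y => Q y k) (Q x (k + 1)) x)
    (hR : ∀ k ≤ 3, HasDerivAt (fun y => R y k) (R x (k + 1)) x)
    (hv : HasDerivAt v (!![-Complex.I * ξ, Q x 0; R x 0, Complex.I * ξ].mulVec (v x)) x)
    (hw : HasDerivAt w (!![-Complex.I * ξ, Q x 0; R x 0, Complex.I * ξ].mulVec (w x)) x) :
    HasDerivAt (fun y => wr ((laxT γ ξ (Q y) (R y)).mulVec (v y)) (w y))
      (wr ((laxXt γ (Q x) (R x)).mulVec (v x)) (w x)) x := by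
  have ha := hasDerivAt_laxTa (γ := γ) (ξ := ξ) hQ hR
  have hb := hasDerivAt_laxTb (γ := γ) (ξ := ξ) hQ hR
  have hc := hasDerivAt_laxTc (γ := γ) (ξ := ξ) hQ hR
  have hv0 := hasDerivAt_pi.1 hv 0
  have hv1 := hasDerivAt_pi.1 hv 1
  have hw0 := hasDerivAt_pi.1 hw 0
  have hw1 := hasDerivAt_pi.1 hw 1
  have h := (((ha.mul hv0).add (hb.mul hv1)).mul hw1).sub
    (((hc.mul hv0).add (ha.neg.mul hv1)).mul hw0)
  refine (h.congr_deriv ?_).congr_of_eventuallyEq (Eventually.of_forall fun y => ?_)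
  · simp [wr, laxXt, Matrix.mulVec, dotProduct, Fin.sum_univ_two]
    ring
  · simp [wr, laxT, Matrix.mulVec, dotProduct, Fin.sum_univ_two]

theorem laxT_trace (γ : ℝ) (ξ : ℂ) (Q R : ℕ → ℂ) : laxT γ ξ Q R 0 0 + laxT γ ξ Q R 1 1 = 0 := by
  simp [laxT]

end LaxPair

/-! ### Jets of classical solutions -/

section Jets

theorem iteratedDeriv_conj (n : ℕ) (f : ℝ → ℂ) :
    iteratedDeriv n (fun x => (starRingEnd ℂ) (f x)) =
      fun x => (starRingEnd ℂ) (iteratedDeriv n f x) := by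
  induction n with
  | zero => simp
  | succ n ih =>
    rw [iteratedDeriv_succ, ih, iteratedDeriv_succ]
    funext x
    exact deriv.star

theorem dx_partner (q : ℝ → ℝ → ℂ) (k : ℕ) (x t : ℝ) :
    dx k (partner q) x t = -((-1) ^ k * (starRingEnd ℂ) (dx k q (-x) t)) := by
  have h1 : (fun y => partner q y t) = -fun y => (fun z => (starRingEnd ℂ) (q z t)) (-y) := rfl
  have h2 : iteratedDeriv k (fun y => (fun z => (starRingEnd ℂ) (q z t)) (-y)) x
      = (-1 : ℝ) ^ k • iteratedDeriv k (fun z => (starRingEnd ℂ) (q z t)) (-x) :=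
    iteratedDeriv_comp_neg k (fun z => (starRingEnd ℂ) (q z t)) x
  rw [dx, h1, iteratedDeriv_neg, h2, iteratedDeriv_conj]
  simp [dx]

variable {A γ T : ℝ} {q₀ : ℝ → ℂ} {q : ℝ → ℝ → ℂ}

theorem IsClassicalSolution.hasDerivAt_dx (hq : IsClassicalSolution A γ T q₀ q) {t : ℝ}
    (ht : t ∈ Set.Ico 0 T) {k : ℕ} (hk : k ≤ 3) (x : ℝ) :
    HasDerivAt (fun y => dx k q y t) (dx (k + 1) q x t) x := by
  have h := (hq.contDiff t ht).differentiable_iteratedDeriv k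
    (by exact_mod_cast Nat.lt_succ_of_le hk)
  unfold dx
  rw [iteratedDeriv_succ]
  exact (h x).hasDerivAt

theorem IsClassicalSolution.hasDerivAt_dx_partner (hq : IsClassicalSolution A γ T q₀ q) {t : ℝ}
    (ht : t ∈ Set.Ico 0 T) {k : ℕ} (hk : k ≤ 3) (x : ℝ) :
    HasDerivAt (fun y => dx k (partner q) y t) (dx (k + 1) (partner q) x t) x := by
  have h := (((hasDerivAt_conj_comp_neg (hq.hasDerivAt_dx ht hk (-x))).const_mul
    ((-1 : ℂ) ^ k)).neg).congr_deriv (g' := dx (k + 1) (partner q) x t)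
    (by rw [dx_partner]; ring)
  exact h.congr_of_eventuallyEq (Eventually.of_forall fun y => dx_partner q k y t)

theorem dx_zero (q : ℝ → ℝ → ℂ) (x t : ℝ) : dx 0 q x t = q x t := by simp [dx]

theorem IsClassicalSolution.hasDerivAt_time (hq : IsClassicalSolution A γ T q₀ q) {t : ℝ}
    (ht : t ∈ Set.Ioo 0 T) (x : ℝ) : HasDerivAt (fun s => q x s)
      (qFlow γ (fun k => dx k q x t) fun k => dx k (partner q) x t) t := by
  have h := (hq.differentiableAt t ht x).hasDerivAt
  refine h.congr_deriv ?_
  have he := hq.equation t ht x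
  unfold SatisfiesLPDAt higherTerm at he
  simp only [qFlow, dx_zero]
  linear_combination he

/-- The equation for `r`, obtained from the equation at `-x` by conjugation. -/
theorem IsClassicalSolution.hasDerivAt_partner_time (hq : IsClassicalSolution A γ T q₀ q) {t : ℝ}
    (ht : t ∈ Set.Ioo 0 T) (x : ℝ) : HasDerivAt (fun s => partner q x s)
      (rFlow γ (fun k => dx k q x t) fun k => dx k (partner q) x t) t := by
  have h := (hq.hasDerivAt_time ht (-x)).star.neg
  refine h.congr_deriv ?_
  have hQ : ∀ k, dx k q x t = -((-1) ^ k * (starRingEnd ℂ) (dx k (partner q) (-x) t)) := by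
    intro k
    rw [dx_partner, neg_neg, map_neg, map_mul, Complex.conj_conj, map_pow, map_neg, map_one,
      mul_neg, neg_neg, ← mul_assoc, ← mul_pow]
    simp
  simp only [qFlow, rFlow, hQ 0, hQ 1, hQ 2, dx_partner q _ x t]
  simp
  ring

end Jets

/-! ### Time evolution of solutions of the scattering problem -/

section Evolution

variable {γ : ℝ} {ξ : ℂ}

theorem continuous_qFlow {X : Type*} [TopologicalSpace X] {Q R : X → ℕ → ℂ}
    (hQ : ∀ k ≤ 4, Continuous fun p => Q p k) (hR : ∀ k ≤ 4, Continuous fun p => R p k) :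
    Continuous fun p => qFlow γ (Q p) (R p) := by
  have h0 := hQ 0 (by norm_num)
  have h1 := hQ 1 (by norm_num)
  have h2 := hQ 2 (by norm_num)
  have h4 := hQ 4 (by norm_num)
  have k0 := hR 0 (by norm_num)
  have k1 := hR 1 (by norm_num)
  have k2 := hR 2 (by norm_num)
  unfold qFlow
  fun_prop

theorem continuous_rFlow {X : Type*} [TopologicalSpace X] {Q R : X → ℕ → ℂ}
    (hQ : ∀ k ≤ 4, Continuous fun p => Q p k) (hR : ∀ k ≤ 4, Continuous fun p => R p k) :
    Continuous fun p => rFlow γ (Q p) (R p) := by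
  have h0 := hQ 0 (by norm_num)
  have h1 := hQ 1 (by norm_num)
  have h2 := hQ 2 (by norm_num)
  have k0 := hR 0 (by norm_num)
  have k1 := hR 1 (by norm_num)
  have k2 := hR 2 (by norm_num)
  have k4 := hR 4 (by norm_num)
  unfold rFlow
  fun_prop

theorem continuous_laxT {X : Type*} [TopologicalSpace X] {Q R : X → ℕ → ℂ}
    (hQ : ∀ k ≤ 4, Continuous fun p => Q p k) (hR : ∀ k ≤ 4, Continuous fun p => R p k) :
    Continuous fun p => laxT γ ξ (Q p) (R p) := by
  have h0 := hQ 0 (by norm_num)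
  have h1 := hQ 1 (by norm_num)
  have h2 := hQ 2 (by norm_num)
  have h3 := hQ 3 (by norm_num)
  have k0 := hR 0 (by norm_num)
  have k1 := hR 1 (by norm_num)
  have k2 := hR 2 (by norm_num)
  have k3 := hR 3 (by norm_num)
  have ha : Continuous fun p => laxTa γ ξ (Q p) (R p) := by unfold laxTa; fun_prop
  have hb : Continuous fun p => laxTb γ ξ (Q p) (R p) := by unfold laxTb; fun_prop
  have hc : Continuous fun p => laxTc γ ξ (Q p) (R p) := by unfold laxTc; fun_prop
  refine continuous_matrix fun i j => ?_
  fin_cases i <;> fin_cases j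
  · exact ha
  · exact hb
  · exact hc
  · exact ha.neg

/-- The matrix `U = -iξσ₃ + Q` of the scattering problem with given off-diagonal entries. -/
noncomputable def laxU (ξ a c : ℂ) : Matrix (Fin 2) (Fin 2) ℂ :=
  !![-Complex.I * ξ, a; c, Complex.I * ξ]

theorem continuous_laxU {X : Type*} [TopologicalSpace X] {f g : X → ℂ} (hf : Continuous f)
    (hg : Continuous g) : Continuous fun p => laxU ξ (f p) (g p) := by
  refine continuous_matrix fun i j => ?_
  fin_cases i <;> fin_cases j
  · exact continuous_const
  · exact hf
  · exact hg
  · exact continuous_const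

theorem laxU_trace (ξ a c : ℂ) : laxU ξ a c 0 0 + laxU ξ a c 1 1 = 0 := by simp [laxU]

theorem hasDerivAt_sub_smul {g : ℝ → ℂ} {t : ℝ} (hg : ContinuousAt g t) :
    HasDerivAt (fun s : ℝ => ((s - t : ℝ) : ℂ) * g s) (g t) t := by
  rw [hasDerivAt_iff_tendsto_slope]
  refine (hg.tendsto.mono_left nhdsWithin_le_nhds).congr' ?_
  filter_upwards [self_mem_nhdsWithin] with s hs
  have : ((s - t : ℝ) : ℂ) ≠ 0 := Complex.ofReal_ne_zero.2 (sub_ne_zero.2 hs)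
  rw [slope_def_module, sub_self, Complex.ofReal_zero, zero_mul, sub_zero, Complex.real_smul,
    Complex.ofReal_inv, inv_mul_cancel_left₀ this]

/-- Hadamard's form of the increment of a function with continuous derivative on an interval. -/
theorem sub_eq_mul_integral {f f' : ℝ → ℂ} {a c : ℝ} (hf : ∀ s ∈ Set.Ioo a c, HasDerivAt f (f' s) s)
    (hf' : Continuous f') {s t : ℝ} (hs : s ∈ Set.Ioo a c) (ht : t ∈ Set.Ioo a c) :
    f s - f t = ((s - t : ℝ) : ℂ) * ∫ ρ in (0 : ℝ)..1, f' (t + (s - t) * ρ) := by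
  have h1 : ∫ σ in t..s, f' σ = f s - f t :=
    intervalIntegral.integral_eq_sub_of_hasDerivAt (fun σ hσ =>
      hf σ (Set.ordConnected_Ioo.uIcc_subset ht hs hσ)) (hf'.intervalIntegrable _ _)
  have h2 := intervalIntegral.smul_integral_comp_add_mul (a := 0) (b := 1) f' (s - t) t
  rw [mul_zero, add_zero, mul_one, add_sub_cancel, h1] at h2
  rw [← h2, Complex.real_smul]

variable {Q R : ℝ → ℝ → ℕ → ℂ} {t₁ : ℝ}

/-- If `ψ(s, ·)` solves the scattering problem at every time `s` and `ψ(·, 0)` solves the `t`-part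
of the Lax pair at `x = 0`, then `ψ(·, x)` solves it at every `x`. No derivative of `ψ` in time is
assumed: the component of `ψ(s, x)` selected by `e` is carried back to `x = 0` by the Wronskian with
the solution `χ` at the fixed time `t` that has `χ(x) = e`. -/
theorem hasDerivAt_time_wr (hQc : ∀ k ≤ 4, Continuous fun p : ℝ × ℝ => Q p.1 p.2 k)
    (hRc : ∀ k ≤ 4, Continuous fun p : ℝ × ℝ => R p.1 p.2 k)
    (hQx : ∀ s y, ∀ k ≤ 3, HasDerivAt (fun y => Q s y k) (Q s y (k + 1)) y)
    (hRx : ∀ s y, ∀ k ≤ 3, HasDerivAt (fun y => R s y k) (R s y (k + 1)) y)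
    (hQt : ∀ y, ∀ s ∈ Set.Ioo 0 t₁, HasDerivAt (fun s => Q s y 0) (qFlow γ (Q s y) (R s y)) s)
    (hRt : ∀ y, ∀ s ∈ Set.Ioo 0 t₁, HasDerivAt (fun s => R s y 0) (rFlow γ (Q s y) (R s y)) s)
    {ψ : ℝ → ℝ → Fin 2 → ℂ} (hψ : Continuous fun p : ℝ × ℝ => ψ p.1 p.2)
    (hψx : ∀ s x, HasDerivAt (ψ s) ((laxU ξ (Q s x 0) (R s x 0)).mulVec (ψ s x)) x)
    (hψ0 : ∀ s, HasDerivAt (fun s => ψ s 0) ((laxT γ ξ (Q s 0) (R s 0)).mulVec (ψ s 0)) s)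
    {t : ℝ} (ht : t ∈ Set.Ioo 0 t₁) (x : ℝ) (e : Fin 2 → ℂ) :
    HasDerivAt (fun s => wr (ψ s x) e) (wr ((laxT γ ξ (Q t x) (R t x)).mulVec (ψ t x)) e) t := by
  have hU : Continuous fun p : ℝ × ℝ => laxU ξ (Q p.1 p.2 0) (R p.1 p.2 0) :=
    continuous_laxU (hQc 0 (by norm_num)) (hRc 0 (by norm_num))
  obtain ⟨χ, hχ, hχx⟩ := exists_linear_ode_solution_at
    (U := fun y => laxU ξ (Q t y 0) (R t y 0)) (hU.comp (Continuous.prodMk_right t)) x e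
  have hχc : Continuous χ := continuous_iff_continuousAt.2 fun y => (hχx y).continuousAt
  have hψc : ∀ s, Continuous (ψ s) := fun s => continuous_iff_continuousAt.2 fun y =>
    (hψx s y).continuousAt
  have hqF : Continuous fun p : ℝ × ℝ => qFlow γ (Q p.1 p.2) (R p.1 p.2) := continuous_qFlow hQc hRc
  have hrF : Continuous fun p : ℝ × ℝ => rFlow γ (Q p.1 p.2) (R p.1 p.2) := continuous_rFlow hQc hRc
  -- the difference quotients of the potentials in time, extended continuously to `s = t`
  set wq : ℝ → ℝ → ℂ := fun s y => ∫ ρ in (0 : ℝ)..1,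
    qFlow γ (Q (t + (s - t) * ρ) y) (R (t + (s - t) * ρ) y) with hwq
  set wr' : ℝ → ℝ → ℂ := fun s y => ∫ ρ in (0 : ℝ)..1,
    rFlow γ (Q (t + (s - t) * ρ) y) (R (t + (s - t) * ρ) y) with hwr
  have hwqc : Continuous fun p : ℝ × ℝ => wq p.1 p.2 :=
    intervalIntegral.continuous_parametric_intervalIntegral_of_continuous'
      (f := fun (p : ℝ × ℝ) ρ => qFlow γ (Q (t + (p.1 - t) * ρ) p.2) (R (t + (p.1 - t) * ρ) p.2))
      (hqF.comp (f := fun z : (ℝ × ℝ) × ℝ => (t + (z.1.1 - t) * z.2, z.1.2)) (by fun_prop)) 0 1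
  have hwrc : Continuous fun p : ℝ × ℝ => wr' p.1 p.2 :=
    intervalIntegral.continuous_parametric_intervalIntegral_of_continuous'
      (f := fun (p : ℝ × ℝ) ρ => rFlow γ (Q (t + (p.1 - t) * ρ) p.2) (R (t + (p.1 - t) * ρ) p.2))
      (hrF.comp (f := fun z : (ℝ × ℝ) × ℝ => (t + (z.1.1 - t) * z.2, z.1.2)) (by fun_prop)) 0 1
  set g : ℝ → ℝ → ℂ := fun s y =>
    wq s y * ψ s y 1 * χ y 1 - wr' s y * ψ s y 0 * χ y 0 with hg
  have hψi : ∀ i, Continuous fun p : ℝ × ℝ => ψ p.1 p.2 i := fun i =>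
    (continuous_apply i).comp hψ
  have hχi : ∀ i, Continuous fun p : ℝ × ℝ => χ p.2 i := fun i =>
    (continuous_apply i).comp (hχc.comp continuous_snd)
  have hgc : Continuous fun p : ℝ × ℝ => g p.1 p.2 :=
    ((hwqc.mul (hψi 1)).mul (hχi 1)).sub ((hwrc.mul (hψi 0)).mul (hχi 0))
  have hdq : ∀ y, ∀ s ∈ Set.Ioo 0 t₁, Q s y 0 - Q t y 0 = ((s - t : ℝ) : ℂ) * wq s y :=
    fun y s hs => sub_eq_mul_integral (f' := fun s => qFlow γ (Q s y) (R s y)) (hQt y)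
      (hqF.comp (Continuous.prodMk_left y)) hs ht
  have hdr : ∀ y, ∀ s ∈ Set.Ioo 0 t₁, R s y 0 - R t y 0 = ((s - t : ℝ) : ℂ) * wr' s y :=
    fun y s hs => sub_eq_mul_integral (f' := fun s => rFlow γ (Q s y) (R s y)) (hRt y)
      (hrF.comp (Continuous.prodMk_left y)) hs ht
  -- the increment of `det (ψ(s, ·), χ)` from `0` to `x`
  have hinc : ∀ s ∈ Set.Ioo 0 t₁, wr (ψ s x) e = wr (ψ s 0) (χ 0)
      + ((s - t : ℝ) : ℂ) * ∫ y in (0 : ℝ)..x, g s y := by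
    intro s hs
    have hd : ∀ y, HasDerivAt (fun y => wr (ψ s y) (χ y)) (((s - t : ℝ) : ℂ) * g s y) y := by
      intro y
      refine (hasDerivAt_wr (hψx s y) (hχx y)).congr_deriv ?_
      have h1 := hdq y s hs
      have h2 := hdr y s hs
      simp only [hg]
      simp [wr, laxU, Matrix.mulVec, dotProduct, Fin.sum_univ_two] at h1 h2 ⊢
      linear_combination (ψ s y 1 * χ y 1) * h1 - (ψ s y 0 * χ y 0) * h2
    have := intervalIntegral.integral_eq_sub_of_hasDerivAt (a := 0) (b := x) (fun y _ => hd y)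
      ((continuous_const.mul (hgc.comp (Continuous.prodMk_right s))).intervalIntegrable _ _)
    rw [intervalIntegral.integral_const_mul, hχ] at this
    linear_combination -this
  -- at time `t` the integrand is an exact derivative, by the zero curvature equation
  have hgt : ∫ y in (0 : ℝ)..x, g t y = wr ((laxT γ ξ (Q t x) (R t x)).mulVec (ψ t x)) e
      - wr ((laxT γ ξ (Q t 0) (R t 0)).mulVec (ψ t 0)) (χ 0) := by
    rw [← hχ]
    refine intervalIntegral.integral_eq_sub_of_hasDerivAt
      (f := fun y => wr ((laxT γ ξ (Q t y) (R t y)).mulVec (ψ t y)) (χ y)) (fun y _ => ?_)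
      ((hgc.comp (Continuous.prodMk_right t)).intervalIntegrable _ _)
    refine (hasDerivAt_wr_laxT (hQx t y) (hRx t y) (hψx t y) (hχx y)).congr_deriv ?_
    simp [hg, hwq, hwr, wr, laxXt, Matrix.mulVec, dotProduct, Fin.sum_univ_two]
  have hIc : Continuous fun s => ∫ y in (0 : ℝ)..x, g s y :=
    intervalIntegral.continuous_parametric_intervalIntegral_of_continuous' hgc 0 x
  have hmain := (hasDerivAt_wr (hψ0 t) (hasDerivAt_const t (χ 0))).add
    (hasDerivAt_sub_smul hIc.continuousAt (t := t))
  refine (hmain.congr_deriv ?_).congr_of_eventuallyEq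
    (eventually_of_mem (isOpen_Ioo.mem_nhds ht) hinc)
  rw [hgt]
  have : wr (ψ t 0) 0 = 0 := by simp [wr]
  rw [this]
  ring

/-- A solution of the scattering problem at time `0` extends to a solution of both parts of the Lax
pair, provided that the coefficients satisfy the evolution equations for `0 < s < t₁`. -/
theorem exists_time_evolution
    (hQc : ∀ k ≤ 4, Continuous fun p : ℝ × ℝ => Q p.1 p.2 k)
    (hRc : ∀ k ≤ 4, Continuous fun p : ℝ × ℝ => R p.1 p.2 k)
    (hQx : ∀ s y, ∀ k ≤ 3, HasDerivAt (fun y => Q s y k) (Q s y (k + 1)) y)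
    (hRx : ∀ s y, ∀ k ≤ 3, HasDerivAt (fun y => R s y k) (R s y (k + 1)) y)
    (hQt : ∀ y, ∀ s ∈ Set.Ioo 0 t₁, HasDerivAt (fun s => Q s y 0) (qFlow γ (Q s y) (R s y)) s)
    (hRt : ∀ y, ∀ s ∈ Set.Ioo 0 t₁, HasDerivAt (fun s => R s y 0) (rFlow γ (Q s y) (R s y)) s)
    {v : ℝ → Fin 2 → ℂ}
    (hv : ∀ x, HasDerivAt v ((laxU ξ (Q 0 x 0) (R 0 x 0)).mulVec (v x)) x) :
    ∃ ψ : ℝ → ℝ → Fin 2 → ℂ, ψ 0 = v ∧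
      (∀ s x, HasDerivAt (ψ s) ((laxU ξ (Q s x 0) (R s x 0)).mulVec (ψ s x)) x) ∧
      ∀ x, Continuous (fun s => ψ s x) ∧ ∀ s ∈ Set.Ico 0 t₁, HasDerivWithinAt (fun s => ψ s x)
        ((laxT γ ξ (Q s x) (R s x)).mulVec (ψ s x)) (Set.Ici s) s := by
  have hU : Continuous fun p : ℝ × ℝ => laxU ξ (Q p.1 p.2 0) (R p.1 p.2 0) :=
    continuous_laxU (hQc 0 (by norm_num)) (hRc 0 (by norm_num))
  have hVx : ∀ x, Continuous fun s => laxT γ ξ (Q s x) (R s x) := fun x =>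
    continuous_laxT (fun k hk => (hQc k hk).comp (Continuous.prodMk_left x))
      fun k hk => (hRc k hk).comp (Continuous.prodMk_left x)
  obtain ⟨c, hc0, hc⟩ := exists_linear_ode_solution_at (hVx 0) 0 (v 0)
  obtain ⟨ψ, hψ, hψ0, hψx⟩ := exists_linear_ode_solution
    (U := fun s y => laxU ξ (Q s y 0) (R s y 0)) hU
    (continuous_iff_continuousAt.2 fun s => (hc s).continuousAt)
  have hψ0' : (fun s => ψ s 0) = c := funext hψ0
  have hψt : ∀ s, HasDerivAt (fun s => ψ s 0) ((laxT γ ξ (Q s 0) (R s 0)).mulVec (ψ s 0)) s :=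
    fun s => by rw [hψ0', hψ0]; exact hc s
  have hcx : ∀ x, Continuous fun s => ψ s x := fun x => hψ.comp (Continuous.prodMk_left x)
  have hderiv : ∀ x, ∀ s ∈ Set.Ioo 0 t₁, HasDerivAt (fun s => ψ s x)
      ((laxT γ ξ (Q s x) (R s x)).mulVec (ψ s x)) s := by
    intro x s hs
    have hw := hasDerivAt_time_wr hQc hRc hQx hRx hQt hRt hψ hψx hψt hs x
    rw [hasDerivAt_pi, Fin.forall_fin_two]
    constructor
    · have := hw ![0, 1]
      simpa [wr] using this
    · refine ((hw ![1, 0]).neg.congr_deriv ?_).congr_of_eventuallyEq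
        (Eventually.of_forall fun s => ?_) <;> simp [wr]
  refine ⟨ψ, ?_, hψx, fun x => ⟨hcx x, fun s hs => ?_⟩⟩
  · refine linear_ode_unique (hU.comp (Continuous.prodMk_right 0))
      (fun x => laxU_trace _ _ _) (hψx 0) hv (x₀ := 0) ?_
    rw [hψ0, hc0]
  · -- at time `0` the derivative from the right is the limit of the derivatives at later times
    rcases eq_or_lt_of_le hs.1 with h0 | h0
    · subst h0
      refine hasDerivWithinAt_Ici_of_tendsto_deriv (s := Set.Ioo 0 t₁)
        (fun s hs => (hderiv x s hs).differentiableAt.differentiableWithinAt)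
        (hcx x).continuousWithinAt (Ioo_mem_nhdsGT hs.2) ?_
      have hcont : Continuous fun s => (laxT γ ξ (Q s x) (R s x)).mulVec (ψ s x) :=
        (hVx x).matrix_mulVec (hcx x)
      refine ((hcont.tendsto 0).mono_left nhdsWithin_le_nhds).congr' ?_
      filter_upwards [Ioo_mem_nhdsGT hs.2] with s hs'
      exact (hderiv x s hs').deriv.symm
    · exact (hderiv x s ⟨h0, hs.2⟩).hasDerivWithinAt

end Evolution

/-! ### Asymptotics of time-dependent solutions -/

section Asymptotics

/-- If the coefficients of `y_s = V(s, x) y` converge, uniformly in `s ∈ [0, t₁]`, along a filter in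
`x`, and the initial values `y(0, x)` converge to an eigenvector of the limit matrix, then so do the
values at time `t₁`, with the exponential factor of the limit system. -/
theorem tendsto_of_uniform_limit {l : Filter ℝ} {t₁ : ℝ} (ht₁ : 0 ≤ t₁)
    {V : ℝ → ℝ → Matrix (Fin 2) (Fin 2) ℂ} {V₀ : Matrix (Fin 2) (Fin 2) ℂ}
    {y : ℝ → ℝ → Fin 2 → ℂ}
    (hV : Tendsto (fun p : ℝ × ℝ => V p.2 p.1) (l ×ˢ 𝓟 (Set.Icc 0 t₁)) (𝓝 V₀))
    (hy : ∀ x, ContinuousOn (fun s => y s x) (Set.Icc 0 t₁))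
    (hd : ∀ x, ∀ s ∈ Set.Ico 0 t₁,
      HasDerivWithinAt (fun s => y s x) ((V s x).mulVec (y s x)) (Set.Ici s) s)
    {v₀ : Fin 2 → ℂ} {ν : ℂ} (hv₀ : V₀.mulVec v₀ = ν • v₀) (h0 : Tendsto (y 0) l (𝓝 v₀)) :
    Tendsto (y t₁) l (𝓝 (Complex.exp (ν * t₁) • v₀)) := by
  obtain ⟨B, hB⟩ := (isCompact_Icc (a := (0 : ℝ)) (b := t₁)).exists_bound_of_continuousOn
    (f := fun s : ℝ => Complex.exp (ν * s)) (by fun_prop)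
  -- far out, `V` is bounded by `K` and the difference to the limit system is small
  set K := matSize V₀ + 1 with hK
  have hKpos : 0 < K := by have := matSize_nonneg V₀; positivity
  have hVs : Tendsto (fun p : ℝ × ℝ => matSize (V p.2 p.1)) (l ×ˢ 𝓟 (Set.Icc 0 t₁))
      (𝓝 (matSize V₀)) := (continuous_matSize.tendsto V₀).comp hV
  have hVd : Tendsto (fun p : ℝ × ℝ => B * ‖(V p.2 p.1 - V₀).mulVec v₀‖) (l ×ˢ 𝓟 (Set.Icc 0 t₁))
      (𝓝 0) := by
    have h1 : Continuous fun W : Matrix (Fin 2) (Fin 2) ℂ => B * ‖(W - V₀).mulVec v₀‖ :=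
      continuous_const.mul
        ((continuous_id.sub continuous_const).matrix_mulVec continuous_const).norm
    have h2 := (h1.tendsto V₀).comp hV
    rw [sub_self, Matrix.zero_mulVec, norm_zero, mul_zero] at h2
    exact h2
  have hw0 : Tendsto (fun x => ‖y 0 x - v₀‖) l (𝓝 0) := tendsto_iff_norm_sub_tendsto_zero.1 h0
  rw [tendsto_iff_norm_sub_tendsto_zero, Metric.tendsto_nhds]
  intro η hη
  set C := Real.exp (K * t₁) + 1 / K * (Real.exp (K * t₁) - 1) with hC
  have hCpos : 0 < C := by
    have : 1 ≤ Real.exp (K * t₁) := Real.one_le_exp (by positivity)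
    have h2 : 0 ≤ 1 / K * (Real.exp (K * t₁) - 1) := mul_nonneg (by positivity) (by linarith)
    linarith
  set ε := η / (2 * C) with hε
  have hεpos : 0 < ε := by positivity
  have e1 := eventually_prod_principal_iff.1 (hVs.eventually_lt_const (lt_add_one (matSize V₀)))
  have e2 := eventually_prod_principal_iff.1 (hVd.eventually_lt_const hεpos)
  have e3 := hw0.eventually_lt_const hεpos
  filter_upwards [e1, e2, e3] with x h1 h2 h3
  have hexp : ∀ s : ℝ, HasDerivAt (fun s : ℝ => Complex.exp (ν * s) • v₀)
      ((ν * Complex.exp (ν * s)) • v₀) s := fun s => (hasDerivAt_cexp_mul ν s).smul_const v₀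
  have key := norm_le_gronwallBound_of_norm_deriv_right_le (δ := ε) (K := K) (ε := ε) (a := 0)
    (b := t₁) (f := fun s => y s x - Complex.exp (ν * s) • v₀)
    (f' := fun s => (V s x).mulVec (y s x) - (ν * Complex.exp (ν * s)) • v₀)
    ((hy x).sub (Continuous.continuousOn (by fun_prop)))
    (fun s hs => (hd x s hs).sub (hexp s).hasDerivWithinAt)
    (by simpa using h3.le) ?_ t₁ ⟨ht₁, le_rfl⟩
  · rw [gronwallBound_of_K_ne_0 hKpos.ne', sub_zero] at key
    have h4 : ε * Real.exp (K * t₁) + ε / K * (Real.exp (K * t₁) - 1) = η / 2 := by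
      have : ε * C = η / 2 := by rw [hε]; field_simp
      rw [← this, hC]; ring
    rw [dist_zero_right, norm_norm]
    have key' : ‖y t₁ x - Complex.exp (ν * t₁) • v₀‖ ≤ η / 2 := h4 ▸ key
    linarith
  · intro s hs
    have hs' : s ∈ Set.Icc 0 t₁ := ⟨hs.1, hs.2.le⟩
    have hsplit : (V s x).mulVec (y s x) - (ν * Complex.exp (ν * s)) • v₀
        = (V s x).mulVec (y s x - Complex.exp (ν * s) • v₀)
          + Complex.exp (ν * s) • (V s x - V₀).mulVec v₀ := by
      rw [Matrix.mulVec_sub, Matrix.sub_mulVec, Matrix.mulVec_smul, hv₀, smul_sub, mul_comm ν,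
        ← smul_smul]
      abel
    rw [hsplit]
    refine (norm_add_le _ _).trans (add_le_add ((norm_mulVec_le _ _).trans ?_) ?_)
    · exact mul_le_mul_of_nonneg_right (h1 s hs').le (norm_nonneg _)
    · rw [norm_smul]
      exact (mul_le_mul_of_nonneg_right (hB s hs') (norm_nonneg _)).trans (h2 s hs').le

end Asymptotics

/-! ### Classical solutions and the Lax pair -/

section Classical

variable {A γ T : ℝ} {q₀ : ℝ → ℂ} {q : ℝ → ℝ → ℂ} {ξ : ℂ} {t₁ : ℝ}

/-- The matrix of the `t`-part of the Lax pair of a field, at the point `(x, s)`. -/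
noncomputable def laxField (γ : ℝ) (q : ℝ → ℝ → ℂ) (ξ : ℂ) (s x : ℝ) :
    Matrix (Fin 2) (Fin 2) ℂ :=
  laxT γ ξ (fun k => dx k q x s) fun k => dx k (partner q) x s

/-- `ψ(s, x)` solves both parts of the Lax pair for times `s ∈ [0, t₁]`; derivatives in time are
from the right. -/
structure SolvesLax (γ : ℝ) (q : ℝ → ℝ → ℂ) (ξ : ℂ) (t₁ : ℝ) (ψ : ℝ → ℝ → Fin 2 → ℂ) : Prop where
  solvesX : ∀ s ∈ Set.Icc 0 t₁, SolvesLaxX (fun x => q x s) ξ (ψ s)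
  continuousOn : ∀ x, ContinuousOn (fun s => ψ s x) (Set.Icc 0 t₁)
  deriv : ∀ x, ∀ s ∈ Set.Ico 0 t₁, HasDerivWithinAt (fun s => ψ s x)
    ((laxField γ q ξ s x).mulVec (ψ s x)) (Set.Ici s) s

/-- Multiplication by a function of `x` preserves the `t`-part of the Lax pair. -/
theorem SolvesLax.smul {ψ : ℝ → ℝ → Fin 2 → ℂ} (h : SolvesLax γ q ξ t₁ ψ) (c : ℝ → ℂ) :
    (∀ x, ContinuousOn (fun s => c x • ψ s x) (Set.Icc 0 t₁)) ∧
    ∀ x, ∀ s ∈ Set.Ico 0 t₁, HasDerivWithinAt (fun s => c x • ψ s x)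
      ((laxField γ q ξ s x).mulVec (c x • ψ s x)) (Set.Ici s) s := by
  refine ⟨fun x => (h.continuousOn x).const_smul (c x), fun x s hs => ?_⟩
  rw [Matrix.mulVec_smul]
  exact (h.deriv x s hs).const_smul (c x)

theorem SolvesLax.const_smul {ψ : ℝ → ℝ → Fin 2 → ℂ} (h : SolvesLax γ q ξ t₁ ψ) (c : ℂ) :
    SolvesLax γ q ξ t₁ fun s x => c • ψ s x :=
  ⟨fun s hs => (h.solvesX s hs).smul c, (h.smul fun _ => c).1, (h.smul fun _ => c).2⟩

/-- The Wronskian of two solutions of the Lax pair does not depend on time. -/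
theorem SolvesLax.wr_eq (ht₁ : 0 ≤ t₁) {ψ χ : ℝ → ℝ → Fin 2 → ℂ} (h : SolvesLax γ q ξ t₁ ψ)
    (h' : SolvesLax γ q ξ t₁ χ) (x : ℝ) : wr (ψ t₁ x) (χ t₁ x) = wr (ψ 0 x) (χ 0 x) := by
  refine constant_of_has_deriv_right_zero (f := fun s => wr (ψ s x) (χ s x)) (a := 0) (b := t₁)
    ?_ ?_ t₁ ⟨ht₁, le_rfl⟩
  · have hv := continuousOn_pi.1 (h.continuousOn x)
    have hw := continuousOn_pi.1 (h'.continuousOn x)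
    exact ((hv 0).mul (hw 1)).sub ((hv 1).mul (hw 0))
  · intro s hs
    have hv := hasDerivWithinAt_pi.1 (h.deriv x s hs)
    have hw := hasDerivWithinAt_pi.1 (h'.deriv x s hs)
    refine (((hv 0).mul (hw 1)).sub ((hv 1).mul (hw 0))).congr_deriv ?_
    have h1 := wr_mulVec (laxField γ q ξ s x) (ψ s x) (χ s x)
    rw [show laxField γ q ξ s x 0 0 + laxField γ q ξ s x 1 1 = 0 from laxT_trace γ ξ _ _,
      zero_mul] at h1
    rw [← h1]
    unfold wr
    ring

/-- Every solution of the scattering problem of the initial datum evolves into a solution of the Lax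
pair. -/
theorem IsClassicalSolution.exists_solvesLax (hq : IsClassicalSolution A γ T q₀ q)
    (ht₁ : t₁ ∈ Set.Ico 0 T) {v : ℝ → Fin 2 → ℂ} (hv : SolvesLaxX q₀ ξ v) :
    ∃ ψ, ψ 0 = v ∧ SolvesLax γ q ξ t₁ ψ := by
  -- times outside `[0, t₁]` are moved to the nearest endpoint
  set τ : ℝ → ℝ := fun s => max 0 (min s t₁) with hτ
  have hτc : Continuous τ := by fun_prop
  have hτT : ∀ s, τ s ∈ Set.Ico 0 T := fun s =>
    ⟨le_max_left _ _, max_lt (ht₁.1.trans_lt ht₁.2) ((min_le_right _ _).trans_lt ht₁.2)⟩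
  have hτe : ∀ s ∈ Set.Icc 0 t₁, τ s = s := fun s hs => by
    simp only [hτ, min_eq_left hs.2, max_eq_right hs.1]
  have hQc : ∀ k ≤ 4, Continuous fun p : ℝ × ℝ => dx k q p.2 (τ p.1) := fun k hk =>
    (hq.continuousOn k hk).comp_continuous (f := fun p : ℝ × ℝ => (p.2, τ p.1)) (by fun_prop)
      fun p => ⟨trivial, hτT p.1⟩
  have hRc : ∀ k ≤ 4, Continuous fun p : ℝ × ℝ => dx k (partner q) p.2 (τ p.1) := fun k hk => by
    simp only [dx_partner]
    have : Continuous fun p : ℝ × ℝ => dx k q (-p.2) (τ p.1) :=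
      (hQc k hk).comp (f := fun p : ℝ × ℝ => (p.1, -p.2)) (by fun_prop)
    exact (continuous_const.mul (Complex.continuous_conj.comp this)).neg
  have hloc : ∀ s ∈ Set.Ioo 0 t₁, τ =ᶠ[𝓝 s] id := fun s hs => by
    filter_upwards [isOpen_Ioo.mem_nhds hs] with σ hσ
    exact hτe σ ⟨hσ.1.le, hσ.2.le⟩
  have hQt : ∀ y, ∀ s ∈ Set.Ioo 0 t₁, HasDerivAt (fun s => dx 0 q y (τ s))
      (qFlow γ (fun k => dx k q y (τ s)) fun k => dx k (partner q) y (τ s)) s := fun y s hs => by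
    rw [hτe s ⟨hs.1.le, hs.2.le⟩]
    refine (hq.hasDerivAt_time ⟨hs.1, hs.2.trans ht₁.2⟩ y).congr_of_eventuallyEq ?_
    filter_upwards [hloc s hs] with σ hσ
    rw [hσ, dx_zero, id]
  have hRt : ∀ y, ∀ s ∈ Set.Ioo 0 t₁, HasDerivAt (fun s => dx 0 (partner q) y (τ s))
      (rFlow γ (fun k => dx k q y (τ s)) fun k => dx k (partner q) y (τ s)) s := fun y s hs => by
    rw [hτe s ⟨hs.1.le, hs.2.le⟩]
    refine (hq.hasDerivAt_partner_time ⟨hs.1, hs.2.trans ht₁.2⟩ y).congr_of_eventuallyEq ?_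
    filter_upwards [hloc s hs] with σ hσ
    rw [hσ, dx_zero, id]
  have h0 : τ 0 = 0 := hτe 0 ⟨le_rfl, ht₁.1⟩
  obtain ⟨ψ, hψ0, hψx, hψt⟩ := exists_time_evolution (γ := γ) (ξ := ξ) (t₁ := t₁) (v := v)
    (Q := fun s y k => dx k q y (τ s)) (R := fun s y k => dx k (partner q) y (τ s)) hQc hRc
    (fun s y k hk => hq.hasDerivAt_dx (hτT s) hk y)
    (fun s y k hk => hq.hasDerivAt_dx_partner (hτT s) hk y) hQt hRt (fun x => by
      have := hv x
      simp only [laxX, ← hq.initial] at this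
      simpa only [h0, dx_zero, laxU, partner] using this)
  refine ⟨ψ, hψ0, fun s hs x => ?_, fun x => (hψt x).1.continuousOn, fun x s hs => ?_⟩
  · have := hψx s x
    simp only [hτe s hs, dx_zero] at this
    exact this
  · have := (hψt x).2 s hs
    simp only [hτe s ⟨hs.1, hs.2.le⟩] at this
    exact this

/-! ### Evolution of the Jost solutions -/

theorem tendsto_laxT {X : Type*} {l : Filter X} {Q R : X → ℕ → ℂ} {Q₀ R₀ : ℕ → ℂ}
    (hQ : ∀ k ≤ 3, Tendsto (fun p => Q p k) l (𝓝 (Q₀ k)))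
    (hR : ∀ k ≤ 3, Tendsto (fun p => R p k) l (𝓝 (R₀ k))) :
    Tendsto (fun p => laxT γ ξ (Q p) (R p)) l (𝓝 (laxT γ ξ Q₀ R₀)) := by
  -- only derivatives of order at most three enter
  set tr : (ℕ → ℂ) → ℕ → ℂ := fun Q k => if k ≤ 3 then Q k else 0 with htr
  have hlax : ∀ Q R, laxT γ ξ (tr Q) (tr R) = laxT γ ξ Q R := fun Q R => by
    simp [laxT, laxTa, laxTb, laxTc, htr]
  have hlim : ∀ {S : X → ℕ → ℂ} {S₀ : ℕ → ℂ},
      (∀ k ≤ 3, Tendsto (fun p => S p k) l (𝓝 (S₀ k))) →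
      Tendsto (fun p => tr (S p)) l (𝓝 (tr S₀)) := fun {S S₀} hS => by
    refine tendsto_pi_nhds.2 fun k => ?_
    by_cases hk : k ≤ 3
    · simpa [htr, hk] using hS k hk
    · simpa [htr, hk] using tendsto_const_nhds
  have hc : Continuous fun p : (ℕ → ℂ) × (ℕ → ℂ) => laxT γ ξ p.1 p.2 :=
    continuous_laxT (fun k _ => (continuous_apply k).comp continuous_fst)
      fun k _ => (continuous_apply k).comp continuous_snd
  have := (hc.tendsto (tr Q₀, tr R₀)).comp ((hlim hQ).prodMk_nhds (hlim hR))
  simpa only [Function.comp_def, hlax] using this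

theorem IsClassicalSolution.tendsto_dx_atTop (hq : IsClassicalSolution A γ T q₀ q) (ht₁ : t₁ < T)
    {k : ℕ} (hk : k ≤ 3) : Tendsto (fun p : ℝ × ℝ => dx k q p.1 p.2)
      (atTop ×ˢ 𝓟 (Set.Icc 0 t₁)) (𝓝 (Pi.single (M := fun _ => ℂ) 0 (A : ℂ) k)) := by
  rcases Nat.eq_zero_or_pos k with rfl | h
  · simp only [dx_zero, Pi.single_eq_same]
    exact tendsto_prod_principal_iff.2 (hq.right t₁ ht₁)
  · rw [Pi.single_eq_of_ne h.ne']
    exact tendsto_prod_principal_iff.2 (hq.right_dx k h hk t₁ ht₁)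

theorem IsClassicalSolution.tendsto_dx_atBot (hq : IsClassicalSolution A γ T q₀ q) (ht₁ : t₁ < T)
    {k : ℕ} (hk : k ≤ 3) : Tendsto (fun p : ℝ × ℝ => dx k q p.1 p.2)
      (atBot ×ˢ 𝓟 (Set.Icc 0 t₁)) (𝓝 0) := by
  rcases Nat.eq_zero_or_pos k with rfl | h
  · simp only [dx_zero]
    exact tendsto_prod_principal_iff.2 (hq.left t₁ ht₁)
  · exact tendsto_prod_principal_iff.2 (hq.left_dx k h hk t₁ ht₁)

theorem tendsto_dx_partner {l l' : Filter ℝ} {I : Set ℝ} (hl : Tendsto (fun x => -x) l l')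
    {k : ℕ} {c : ℂ} (h : Tendsto (fun p : ℝ × ℝ => dx k q p.1 p.2) (l' ×ˢ 𝓟 I) (𝓝 c)) :
    Tendsto (fun p : ℝ × ℝ => dx k (partner q) p.1 p.2) (l ×ˢ 𝓟 I)
      (𝓝 (-((-1) ^ k * (starRingEnd ℂ) c))) := by
  have h1 : Tendsto (fun p : ℝ × ℝ => (-p.1, p.2)) (l ×ˢ 𝓟 I) (l' ×ˢ 𝓟 I) :=
    hl.prodMap tendsto_id
  simp only [dx_partner]
  exact (((Complex.continuous_conj.tendsto c).comp (h.comp h1)).const_mul _).neg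

/-- The limit of the `t`-part of the Lax pair at `+∞`, where `q = A`, `r = 0`. -/
theorem IsClassicalSolution.tendsto_laxField_atTop (hq : IsClassicalSolution A γ T q₀ q)
    (ht₁ : t₁ < T) : Tendsto (fun p : ℝ × ℝ => laxField γ q ξ p.2 p.1)
      (atTop ×ˢ 𝓟 (Set.Icc 0 t₁)) (𝓝 (laxT γ ξ (Pi.single 0 (A : ℂ)) 0)) := by
  refine tendsto_laxT (fun k hk => hq.tendsto_dx_atTop ht₁ hk) fun k hk => ?_
  have := tendsto_dx_partner tendsto_neg_atTop_atBot (hq.tendsto_dx_atBot ht₁ hk)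
  simpa using this

/-- The limit of the `t`-part of the Lax pair at `-∞`, where `q = 0`, `r = -A`. -/
theorem IsClassicalSolution.tendsto_laxField_atBot (hq : IsClassicalSolution A γ T q₀ q)
    (ht₁ : t₁ < T) : Tendsto (fun p : ℝ × ℝ => laxField γ q ξ p.2 p.1)
      (atBot ×ˢ 𝓟 (Set.Icc 0 t₁)) (𝓝 (laxT γ ξ 0 (Pi.single 0 (-A : ℂ)))) := by
  refine tendsto_laxT (fun k hk => hq.tendsto_dx_atBot ht₁ hk) fun k hk => ?_
  have := tendsto_dx_partner tendsto_neg_atBot_atTop (hq.tendsto_dx_atTop ht₁ hk)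
  convert this using 2
  rcases Nat.eq_zero_or_pos k with rfl | h
  · simp
  · simp [Pi.single_eq_of_ne h.ne']

/-- The limits of the `t`-part of the Lax pair at `±∞` have the eigenvalues `±(iξ² - 8iγξ⁴)`. -/
noncomputable def timeExponent (γ : ℝ) (ξ : ℂ) : ℂ :=
  Complex.I * ξ ^ 2 - 8 * Complex.I * γ * ξ ^ 4

theorem SolvesLax.isJostPlus₁ (hq : IsClassicalSolution A γ T q₀ q) (ht₁ : t₁ ∈ Set.Ico 0 T)
    {ψ : ℝ → ℝ → Fin 2 → ℂ} (h : SolvesLax γ q ξ t₁ ψ) (h0 : IsJostPlus₁ q₀ ξ (ψ 0)) :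
    IsJostPlus₁ (fun x => q x t₁) ξ fun x => Complex.exp (-(timeExponent γ ξ * t₁)) • ψ t₁ x := by
  refine ⟨(h.solvesX t₁ ⟨ht₁.1, le_rfl⟩).smul _, ?_⟩
  have hs := h.smul fun x => Complex.exp (Complex.I * ξ * x)
  have := (tendsto_of_uniform_limit ht₁.1 (hq.tendsto_laxField_atTop ht₁.2) hs.1 hs.2
    (ν := timeExponent γ ξ) ?_ h0.2).const_smul (Complex.exp (-(timeExponent γ ξ * t₁)))
  · rw [smul_smul, ← Complex.exp_add, neg_add_cancel, Complex.exp_zero, one_smul] at this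
    exact this.congr fun x => smul_comm _ _ _
  · ext i
    fin_cases i <;>
      simp [laxT, laxTa, laxTb, laxTc, timeExponent, Matrix.mulVec, dotProduct, Fin.sum_univ_two]
    ring

theorem SolvesLax.isJostPlus₂ (hq : IsClassicalSolution A γ T q₀ q) (ht₁ : t₁ ∈ Set.Ico 0 T)
    (hξ : ξ ≠ 0)
    {ψ : ℝ → ℝ → Fin 2 → ℂ} (h : SolvesLax γ q ξ t₁ ψ) (h0 : IsJostPlus₂ A q₀ ξ (ψ 0)) :
    IsJostPlus₂ A (fun x => q x t₁) ξ fun x => Complex.exp (timeExponent γ ξ * t₁) • ψ t₁ x := by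
  refine ⟨(h.solvesX t₁ ⟨ht₁.1, le_rfl⟩).smul _, ?_⟩
  have hs := h.smul fun x => Complex.exp (-(Complex.I * ξ * x))
  have := (tendsto_of_uniform_limit ht₁.1 (hq.tendsto_laxField_atTop ht₁.2) hs.1 hs.2
    (ν := -timeExponent γ ξ) ?_ h0.2).const_smul (Complex.exp (timeExponent γ ξ * t₁))
  · rw [smul_smul, ← Complex.exp_add, neg_mul, add_neg_cancel, Complex.exp_zero, one_smul] at this
    exact this.congr fun x => smul_comm _ _ _
  · ext i
    fin_cases i
    · simp [laxT, laxTa, laxTb, laxTc, timeExponent, Matrix.mulVec, dotProduct, Fin.sum_univ_two]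
      field_simp
      ring_nf
    · simp [laxT, laxTa, laxTb, laxTc, timeExponent, Matrix.mulVec, dotProduct, Fin.sum_univ_two]
      ring

theorem SolvesLax.isJostMinus₁ (hq : IsClassicalSolution A γ T q₀ q) (ht₁ : t₁ ∈ Set.Ico 0 T)
    (hξ : ξ ≠ 0)
    {ψ : ℝ → ℝ → Fin 2 → ℂ} (h : SolvesLax γ q ξ t₁ ψ) (h0 : IsJostMinus₁ A q₀ ξ (ψ 0)) :
    IsJostMinus₁ A (fun x => q x t₁) ξ
      fun x => Complex.exp (-(timeExponent γ ξ * t₁)) • ψ t₁ x := by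
  refine ⟨(h.solvesX t₁ ⟨ht₁.1, le_rfl⟩).smul _, ?_⟩
  have hs := h.smul fun x => Complex.exp (Complex.I * ξ * x)
  have := (tendsto_of_uniform_limit ht₁.1 (hq.tendsto_laxField_atBot ht₁.2) hs.1 hs.2
    (ν := timeExponent γ ξ) ?_ h0.2).const_smul (Complex.exp (-(timeExponent γ ξ * t₁)))
  · rw [smul_smul, ← Complex.exp_add, neg_add_cancel, Complex.exp_zero, one_smul] at this
    exact this.congr fun x => smul_comm _ _ _
  · ext i
    fin_cases i
    · simp [laxT, laxTa, laxTb, laxTc, timeExponent, Matrix.mulVec, dotProduct, Fin.sum_univ_two]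
      ring
    · simp [laxT, laxTa, laxTb, laxTc, timeExponent, Matrix.mulVec, dotProduct, Fin.sum_univ_two]
      field_simp
      ring_nf

theorem SolvesLax.isJostMinus₂ (hq : IsClassicalSolution A γ T q₀ q) (ht₁ : t₁ ∈ Set.Ico 0 T)
    {ψ : ℝ → ℝ → Fin 2 → ℂ} (h : SolvesLax γ q ξ t₁ ψ) (h0 : IsJostMinus₂ q₀ ξ (ψ 0)) :
    IsJostMinus₂ (fun x => q x t₁) ξ fun x => Complex.exp (timeExponent γ ξ * t₁) • ψ t₁ x := by
  refine ⟨(h.solvesX t₁ ⟨ht₁.1, le_rfl⟩).smul _, ?_⟩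
  have hs := h.smul fun x => Complex.exp (-(Complex.I * ξ * x))
  have := (tendsto_of_uniform_limit ht₁.1 (hq.tendsto_laxField_atBot ht₁.2) hs.1 hs.2
    (ν := -timeExponent γ ξ) ?_ h0.2).const_smul (Complex.exp (timeExponent γ ξ * t₁))
  · rw [smul_smul, ← Complex.exp_add, neg_mul, add_neg_cancel, Complex.exp_zero, one_smul] at this
    exact this.congr fun x => smul_comm _ _ _
  · ext i
    fin_cases i <;>
      simp [laxT, laxTa, laxTb, laxTc, timeExponent, Matrix.mulVec, dotProduct, Fin.sum_univ_two]
    ring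

end Classical

/-! ### Classical solutions are solitons -/

section Uniqueness

variable {A γ T : ℝ} {q₀ : ℝ → ℂ} {q : ℝ → ℝ → ℂ} {t : ℝ}

theorem IsClassicalSolution.stepLike (hq : IsClassicalSolution A γ T q₀ q)
    (ht : t ∈ Set.Ico 0 T) : StepLike A fun x => q x t where
  continuous := (hq.contDiff t ht).continuous
  left := (hq.left t ht.2).tendsto_at ⟨ht.1, le_rfl⟩
  right := (hq.right t ht.2).tendsto_at ⟨ht.1, le_rfl⟩
  close := hq.close t ht

/-- The spectral function `a₂` does not depend on time. -/
theorem IsClassicalSolution.a₂_eq (hq : IsClassicalSolution A γ T q₀ q) (hA : 0 < A)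
    (ht : t ∈ Set.Ico 0 T) (hp : IsProfile A q₀) (hl : Tendsto q₀ atBot (𝓝 0))
    (hr : Tendsto q₀ atTop (𝓝 (A : ℂ))) {ξ : ℂ} (hξ : ξ.im ≤ 0) :
    a₂ (fun x => q x t) ξ = a₂ q₀ ξ := by
  have hne : ξ - Complex.I * A / 2 ≠ 0 := sub_ne_zero_of_im_nonpos hA hξ
  have h1 := hp.isJostPlus₁ hr hne
  have h2 := hp.isJostMinus₂ hl hne
  obtain ⟨ψ, hψ0, hψ⟩ := hq.exists_solvesLax ht h1.1
  obtain ⟨χ, hχ0, hχ⟩ := hq.exists_solvesLax ht h2.1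
  rw [← hψ0] at h1
  rw [← hχ0] at h2
  have hc := (hq.stepLike ht).continuous
  rw [a₂, a₂, jostPlus₁_eq hc hξ (hψ.isJostPlus₁ hq ht h1),
    jostMinus₂_eq hc hξ (hχ.isJostMinus₂ hq ht h2), jostPlus₁_eq hp.continuous hξ h1,
    jostMinus₂_eq hp.continuous hξ h2, wr_smul_left, wr_smul_right, ← mul_assoc,
    ← Complex.exp_add, neg_add_cancel, Complex.exp_zero, one_mul, hψ.wr_eq ht.1 hχ]

/-- The spectral function `b` stays zero if it vanishes initially. -/
theorem IsClassicalSolution.b_eq_zero (hq : IsClassicalSolution A γ T q₀ q) (hA : 0 < A)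
    (ht : t ∈ Set.Ico 0 T) (hp : IsProfile A q₀) (hl : Tendsto q₀ atBot (𝓝 0))
    (hr : Tendsto q₀ atTop (𝓝 (A : ℂ))) {s : ℝ} (hs : s ≠ 0) (hb : b A q₀ s = 0) :
    b A (fun x => q x t) s = 0 := by
  have hne : (s : ℂ) - Complex.I * A / 2 ≠ 0 :=
    sub_ne_zero_of_im_nonpos hA (Complex.ofReal_im s).le
  have hs' : (s : ℂ) ≠ 0 := Complex.ofReal_ne_zero.2 hs
  have h1 := hp.isJostMinus₂ hl hne
  have h2 := hp.isJostPlus₂ hr hs'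
  obtain ⟨ψ, hψ0, hψ⟩ := hq.exists_solvesLax ht h1.1
  obtain ⟨χ, hχ0, hχ⟩ := hq.exists_solvesLax ht h2.1
  rw [← hψ0] at h1
  rw [← hχ0] at h2
  have hc := (hq.stepLike ht).continuous
  have hi1 : (s : ℂ).im ≤ 0 := (Complex.ofReal_im s).le
  have hi2 : 0 ≤ (s : ℂ).im := (Complex.ofReal_im s).ge
  rw [b, jostMinus₂_eq hp.continuous hi1 h1, jostPlus₂_eq hp.continuous hi2 h2] at hb
  rw [b, jostMinus₂_eq hc hi1 (hψ.isJostMinus₂ hq ht h1),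
    jostPlus₂_eq hc hi2 (hχ.isJostPlus₂ hq ht hs' h2), wr_smul_left, wr_smul_right,
    hψ.wr_eq ht.1 hχ, hb, mul_zero, mul_zero]

/-- The evolution of the norming constant. The constants `κ`, `κ'` are those in the profiles at the
times `0` and `t`. -/
theorem IsClassicalSolution.norming_eq (hq : IsClassicalSolution A γ T q₀ q) (hA : 0 < A)
    (ht : t ∈ Set.Ico 0 T) (hp : IsProfile A q₀) (hr : Tendsto q₀ atTop (𝓝 (A : ℂ)))
    (hl : Tendsto q₀ atBot (𝓝 0)) {κ κ' : ℂ} (hκ : IsNorming A q₀ (A / 2) κ)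
    (hκ' : IsNorming A (fun x => q x t) (A / 2) κ') :
    κ' = κ * Complex.exp (Complex.I / 2 * A ^ 2 * t + Complex.I * A ^ 4 * γ * t) := by
  have him : 0 ≤ (Complex.I * ((A / 2 : ℝ) : ℂ)).im := by simp; positivity
  have h0 : Complex.I * ((A / 2 : ℝ) : ℂ) ≠ 0 := by simp [hA.ne']
  have h2 := hp.isJostPlus₂ hr h0
  have h1 := hp.isJostMinus₁ hl h0
  have hc := (hq.stepLike ht).continuous
  obtain ⟨χ, hχ0, hχ⟩ := hq.exists_solvesLax ht h2.1
  rw [← hχ0] at h2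
  -- `κ φ₊⁽²⁾` evolves both as `φ₋⁽¹⁾` and as `κ φ₊⁽²⁾`, with opposite exponents
  have h3 : IsJostMinus₁ A q₀ (Complex.I * ((A / 2 : ℝ) : ℂ)) fun x => κ • χ 0 x := by
    have : (fun x => κ • χ 0 x) = jostMinus₁ A q₀ (Complex.I * ((A / 2 : ℝ) : ℂ)) :=
      funext fun x => by rw [hκ x, jostPlus₂_eq hp.continuous him h2]
    rw [this]
    exact Classical.epsilon_spec ⟨_, h1⟩
  set E := timeExponent γ (Complex.I * ((A / 2 : ℝ) : ℂ)) * t with hE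
  have hj := (hχ.const_smul κ).isJostMinus₁ hq ht h0 h3
  have hj2 := hχ.isJostPlus₂ hq ht h0 h2
  -- `φ₊⁽²⁾` has no zeros
  obtain ⟨x, i, hx⟩ : ∃ x i, χ t x i ≠ 0 := by
    by_contra! hcon
    have hz : (fun x : ℝ => Complex.exp (-(Complex.I * (Complex.I * ((A / 2 : ℝ) : ℂ)) * x)) •
        Complex.exp E • χ t x) = fun _ => 0 := funext fun x => by
      rw [show χ t x = 0 from funext (hcon x), smul_zero, smul_zero]
    have := hj2.2
    rw [hz] at this
    have := congrFun (tendsto_nhds_unique tendsto_const_nhds this) 1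
    simp at this
  have hk := congrFun (hκ' x) i
  rw [jostMinus₁_eq hc him hj, jostPlus₂_eq hc him hj2] at hk
  simp only [Pi.smul_apply, smul_eq_mul, ← hE] at hk
  have hk' : Complex.exp (-E) * κ = κ' * Complex.exp E := mul_right_cancel₀ hx (by
    linear_combination hk)
  have hexp : Complex.exp (Complex.I / 2 * A ^ 2 * t + Complex.I * A ^ 4 * γ * t)
      = Complex.exp (-E) * Complex.exp (-E) := by
    rw [← Complex.exp_add]
    congr 1
    rw [hE, timeExponent, mul_pow, mul_pow, Complex.I_sq, Complex.I_pow_four]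
    push_cast
    ring
  have hEE : Complex.exp E * Complex.exp (-E) = 1 := by
    rw [← Complex.exp_add, add_neg_cancel, Complex.exp_zero]
  rw [hexp]
  linear_combination -(Complex.exp (-E)) * hk' - κ' * hEE

/-- The profile of a classical solution keeps its form, and the phase of the constant in it grows
linearly in time. -/
theorem IsClassicalSolution.profile_eq (hq : IsClassicalSolution A γ T q₀ q) (hA : 0 < A)
    (ht : t ∈ Set.Ico 0 T) (hq₀ : StepLike A q₀) {d₂ : ℂ}
    (hz : ∀ ξ : ℂ, ξ.im ≤ 0 → (a₂ q₀ ξ = 0 ↔ ξ = 0))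
    (hd : HasDerivWithinAt (a₂ q₀) d₂ {ξ : ℂ | ξ.im ≤ 0} 0) (hd0 : d₂ ≠ 0)
    (hb : ∀ s : ℝ, s ≠ 0 → b A q₀ s = 0) {κ : ℂ} (hκ : ‖κ‖ = 1)
    (hκp : ∀ x : ℝ, q₀ x * (1 - κ * Complex.exp (-(A * x))) = A) (x : ℝ) :
    q x t * (1 - κ * Complex.exp (Complex.I / 2 * A ^ 2 * t + Complex.I * A ^ 4 * γ * t)
      * Complex.exp (-(A * x))) = A := by
  have hp := isProfile_of_eq hA hκ hκp
  have hu := hq.stepLike ht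
  have ha : ∀ ξ : ℂ, ξ.im ≤ 0 → a₂ (fun x => q x t) ξ = a₂ q₀ ξ := fun ξ hξ =>
    hq.a₂_eq hA ht hp hq₀.left hq₀.right hξ
  obtain ⟨κ', hκ'1, hκ'⟩ := hu.exists_eq_profile hA (fun ξ hξ => by rw [ha ξ hξ, hz ξ hξ])
    (hd.congr ha (ha 0 le_rfl)) hd0
    fun s hs => hq.b_eq_zero hA ht hp hq₀.left hq₀.right hs (hb s hs)
  have hp' := isProfile_of_eq hA hκ'1 hκ'
  rw [← hq.norming_eq hA ht hp hq₀.right hq₀.left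
    (hp.isNorming hq₀.left hq₀.right hA hκp) (hp'.isNorming hu.left hu.right hA hκ')]
  exact hκ' x

theorem den_eq_one_sub (A γ α x t : ℝ) : den A γ α x t
    = 1 - Complex.exp (Complex.I * α)
      * Complex.exp (Complex.I / 2 * A ^ 2 * t + Complex.I * A ^ 4 * γ * t)
      * Complex.exp (-(A * x)) := by
  rw [den, ← Complex.exp_add, ← Complex.exp_add]
  congr 2
  ring

theorem den_ne_zero_and_eq_soliton (hA : 0 < A) {α x : ℝ} {z : ℂ} (h : z * den A γ α x t = A) :
    den A γ α x t ≠ 0 ∧ z = soliton A γ α x t := by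
  have hd : den A γ α x t ≠ 0 := fun h0 => by
    rw [h0, mul_zero] at h
    exact hA.ne' (Complex.ofReal_eq_zero.1 h.symm)
  exact ⟨hd, (eq_div_iff hd).2 h⟩

end Uniqueness

end NonlocalLPD

open NonlocalLPD in
theorem mainTheorem4 (A γ : ℝ) (hA : 0 < A) (hγ : 0 < γ)
    (q₀ : ℝ → ℂ) (hq₀ : StepLike A q₀)
    (ξ₁ : ℝ) (a₁₁ d₂ : ℂ) (hcase : Case2 A q₀ ξ₁ a₁₁ d₂)
    (hb : ∀ s : ℝ, s ≠ 0 → b A q₀ s = 0) :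
    ξ₁ = A / 2 ∧
    ∃ (r₁ : ℂ) (α : ℝ), IsNorming A q₀ ξ₁ r₁ ∧ r₁ = Complex.exp (Complex.I * α) ∧
      -- the Riemann-Hilbert problem is solved, uniquely, by the explicit matrix
      (∀ x t : ℝ, 0 ≤ t → den A γ α x t ≠ 0 →
        IsRHSolution A γ q₀ ξ₁ a₁₁ d₂ r₁ x t (solM A γ α x t) ∧
        (∀ M : ℂ → Matrix (Fin 2) (Fin 2) ℂ, IsRHSolution A γ q₀ ξ₁ a₁₁ d₂ r₁ x t M →
          ∀ ξ : ℂ, ξ.im ≠ 0 → ξ ≠ Complex.I * ξ₁ → M ξ = solM A γ α x t ξ) ∧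
        Tendsto (fun ξ : ℂ => 2 * Complex.I * (ξ * solM A γ α x t ξ 0 1)) (cocompact ℂ)
          (𝓝 (soliton A γ α x t))) ∧
      -- the one-soliton solves the initial boundary value problem off its singular points
      (∀ x : ℝ, den A γ α x 0 ≠ 0 ∧ soliton A γ α x 0 = q₀ x) ∧
      (∀ x t : ℝ, 0 < t → den A γ α x t ≠ 0 →
        ContDiffAt ℝ (⊤ : ℕ∞) (fun p : ℝ × ℝ => soliton A γ α p.1 p.2) (x, t) ∧
        SatisfiesLPDAt γ (soliton A γ α) x t) ∧
      (∀ t : ℝ, 0 ≤ t →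
        Tendsto (fun x => soliton A γ α x t) atBot (𝓝 0) ∧
        Tendsto (fun x => soliton A γ α x t) atTop (𝓝 (A : ℂ))) ∧
      -- every classical solution is this one-soliton
      (∀ (T : ℝ) (q : ℝ → ℝ → ℂ), IsClassicalSolution A γ T q₀ q →
        ∀ x : ℝ, ∀ t ∈ Set.Ico 0 T, den A γ α x t ≠ 0 ∧ q x t = soliton A γ α x t) := by
  obtain ⟨κ, hκ, hκp⟩ := hq₀.exists_eq_profile hA hcase.zero_a₂ hcase.deriv_a₂ hcase.deriv_a₂_ne hb
  have hp := isProfile_of_eq hA hκ hκp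
  obtain ⟨rfl, rfl, rfl⟩ := hcase.data_of_isProfile hp hq₀.left hq₀.right hA
  obtain ⟨α, rfl⟩ : ∃ α : ℝ, Complex.exp (Complex.I * α) = κ :=
    ⟨κ.arg, by simpa [hκ, mul_comm] using Complex.norm_mul_exp_arg_mul_I κ⟩
  have hd₁ := hp.deriv_a₁ hq₀.left hq₀.right hA
  refine ⟨rfl, Complex.exp (Complex.I * α), α, hp.isNorming hq₀.left hq₀.right hA hκp, rfl,
    fun x t _ hden => ⟨isRHSolution_solM hA hd₁ hb hden,
      fun M hM ξ hξ hξp => eq_solM_of_isRHSolution hA hd₁ hb hden hM hξ hξp,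
      tendsto_solM A γ α x t⟩,
    fun x => ?_, fun x t _ hden => ⟨contDiffAt_soliton hden, satisfiesLPDAt_soliton hden⟩,
    fun t _ => ⟨tendsto_soliton_atBot hA, tendsto_soliton_atTop hA⟩, fun T q hq x t ht => ?_⟩
  · -- the profile of `q₀` is the soliton at time `0`
    have h := den_ne_zero_and_eq_soliton (γ := γ) (t := 0) (α := α) (x := x) (z := q₀ x) hA (by
      rw [den_eq_one_sub]
      simpa using hκp x)
    exact ⟨h.1, h.2.symm⟩
  · refine den_ne_zero_and_eq_soliton hA ?_
    rw [den_eq_one_sub]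
    exact hq.profile_eq hA ht hq₀ hcase.zero_a₂ hcase.deriv_a₂ hcase.deriv_a₂_ne hb hκ hκp x
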